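/- **Conventions.** $\mathbb N=\{1,2,3,\dots\}$, and "constant $c<\infty$" means $0<c<\infty$. A *$\varphi$-function* is a continuous strictly increasing $F:[0,\infty)\to[0,\infty)$ with $F(0)=0$ and $F(t)\to\infty$ as $t\to\infty$; $F^{-1}$ is its inverse, and $\tilde F(t)=1/F(1/t)$ for $t>0$, $\tilde F(0)=0$. $F$ is *dilatory* if for some $c_1,c_2>1$, $F(c_1t)\ge c_2F(t)$ for all $t\ge0$; $F$ satisfies the *$\Delta_2$-condition* if $F^{-1}$ is dilatory. $F\asymp G$ means that for some $c<\infty$, $F(c^{-1}t)\le G(t)\le F(ct)$ for all $t\ge0$. The measure space is $[0,\infty)$ with Lebesgue measure $\mu$. For measurable $f:[0,\infty)\to\mathbb C$ put $f^*(x)=\sup\{t\ge 0:\mu(|f|\ge t)\ge x\}\in[0,\infty]$, $\|f\|_G=\inf\{c>0:\int_0^\infty G(|f|/c)\,d\mu\le1\}$ (with $G(\infty)=\infty$, $\inf\emptyset=\infty$; $|f|$ may take the value $\infty$), and $\|f\|_{F,G}=\|f^*\circ\tilde F\circ\tilde G^{-1}\|_G$. The space $L_{F,G}$ consists of the measurable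 $f$ with $\|f\|_{F,G}<\infty$. $L_{F_1,G_1}$ and $L_{F_2,G_2}$ are *equivalent* if for some $c<\infty$ and all measurable $f$: $f\in L_{F_1,G_1}\Leftrightarrow f\in L_{F_2,G_2}$, and $c^{-1}\|f\|_{F_1,G_1}\le\|f\|_{F_2,G_2}\le c\,\|f\|_{F_1,G_1}$. A $\varphi$-function $G$ is *almost linear* if there are $a>1$, $b>1$, $N\in\mathbb N$ such that for all $m\in\mathbb N$ the number of $n\in\mathbb Z$ for which $$a^{m-N}G(a^n)\le G(a^{n+m})\le a^{m+N}G(a^n)$$ fails is less than $b^m$. $G_1$ is *almost equivalent to* $G_2$ if there are $a>1$, $b>1$, $N\in\mathbb N$ such that for all $m\in\mathbb N$ the number of $n\in\mathbb Z$ for which $$a^{-N}\frac{G_2(a^{n+m})}{G_2(a^n)}\le\frac{G_1(a^{n+m})}{G_1(a^n)}\le a^{N}\frac{G_2(a^{n+m})}{G_2(a^n)}$$ fails is less than $b^m$. An *N-function* is a $\varphi$-function $H\asymp F_0$ for some $\varphi$-function $F_0$ such that $F_0(t)/t$ is strictly increasing, tends to $\infty$ as $t\to\infty$ and to $0$ as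 $t\to0$. For an N-function $H$, $H^*$ denotes a complementary $\varphi$-function, that is, one with $c^{-1}t\le H^{-1}(t)\,(H^{*})^{-1}(t)\le ct$ for all $t\ge0$ and some $c<\infty$ (it exists and is unique up to $\asymp$). $H$ satisfies *condition (J)* if $\bigl\|1/(\widetilde{H^*})^{-1}\bigr\|_{H^*}<\infty$. A *weight function* is a measurable $w:(0,\infty)\to(0,\infty)$ such that $W(t)=\int_0^tw(s)\,ds$ is a $\varphi$-function. It is *strictly monotone* if it is either strictly increasing with $w(t)\to0$ as $t\to0$ and $w(t)\to\infty$ as $t\to\infty$, or strictly decreasing with $w(t)\to\infty$ as $t\to0$ and $w(t)\to0$ as $t\to\infty$. A strictly monotone weight function $w$ satisfies *condition (L)* if it maps onto $(0,\infty)$, so that $w^{-1}:(0,\infty)\to(0,\infty)$ exists, and $\int_0^\infty\frac{dt}{w^{-1}(c\,w(t))}<\infty$ for some $0<c<\infty$. **Theorem 4.3.** Let $F_1,F_2,G_1,G_2$ be $\varphi$-functions such that one of $G_1$, $G_2$ is dilatory and one of $G_1$, $G_2$ satisfies the $\Delta_2$-condition. Then the following are equivalent. 1. $L_{F_1,G_1}$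 and $L_{F_2,G_2}$ are equivalent. 2. $F_1\asymp F_2$, and $G_1\circ G_2^{-1}$ is almost linear. 3. $F_1\asymp F_2$, and there are N-functions $H,K$ satisfying condition (J) with $G_1\circ G_2^{-1}=H\circ K^{-1}$. 4. $F_1\asymp F_2$, and there are N-functions $H,K$ satisfying condition (J) with $G_1\circ G_2^{-1}=H^{-1}\circ K$. 5. $F_1\asymp F_2$, and $G_1$ is almost equivalent to $G_2$. 6. $F_1\asymp F_2$, and there are N-functions $H,K$ satisfying condition (J) and $c<\infty$ with $c^{-1}G_1/G_2\le H/K\le c\,G_1/G_2$ on $(0,\infty)$. 7. $F_1\asymp F_2$, and there are strictly monotone weight functions $w_0,w_1$ satisfying condition (L) and $c<\infty$ with $c^{-1}G_1/G_2\le w_0w_1\le c\,G_1/G_2$ on $(0,\infty)$. 8. $F_1\asymp F_2$, and there are an almost linear $\varphi$-function $F$ and $c<\infty$ with $c^{-1}F(t)\le tG_1(t)/G_2(t)\le c\,F(t)$ for all $t>0$. -/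

import Mathlib

open MeasureTheory Filter Topology
open scoped NNReal ENNReal

noncomputable section

namespace OrliczLorentz

/-- Lebesgue measure on `[0,∞)`. -/
def leb : Measure ℝ≥0 := Measure.comap (fun x : ℝ≥0 => (x : ℝ)) volume

/-- A φ-function on `[0,∞)`. -/
structure IsPhi (F : ℝ≥0 → ℝ≥0) : Prop where
  map_zero : F 0 = 0
  tendsto_atTop : Tendsto F atTop atTop
  strictMono : StrictMono F
  continuous : Continuous F

/-- The inverse function `F⁻¹`. A φ-function is a bijection of `[0,∞)`, so for φ-functions this
is the genuine two-sided inverse. -/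
def phiInv (F : ℝ≥0 → ℝ≥0) : ℝ≥0 → ℝ≥0 := Function.invFun F

/-- `F̃(t) = 1 / F(1/t)` for `t > 0`, and `F̃(0) = 0`. -/
def tilde (F : ℝ≥0 → ℝ≥0) (t : ℝ≥0) : ℝ≥0 := if t = 0 then 0 else 1 / F (1 / t)

def IsDilatory (F : ℝ≥0 → ℝ≥0) : Prop :=
  ∃ c₁ c₂ : ℝ≥0, 1 < c₁ ∧ 1 < c₂ ∧ ∀ t, c₂ * F t ≤ F (c₁ * t)

/-- The `Δ₂`-condition. -/
def SatisfiesDelta2 (F : ℝ≥0 → ℝ≥0) : Prop := IsDilatory (phiInv F)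

/-- Equivalence `F ≍ G` of φ-functions. -/
def PhiEquiv (F G : ℝ≥0 → ℝ≥0) : Prop :=
  ∃ c : ℝ≥0, 0 < c ∧ ∀ t, F (c⁻¹ * t) ≤ G t ∧ G t ≤ F (c * t)

/-! ### Luxemburg and Orlicz–Lorentz functionals -/

/-- Extension of `F : [0,∞) → [0,∞)` to `[0,∞]` by `F(∞) = ∞`. -/
def extendTop (F : ℝ≥0 → ℝ≥0) (t : ℝ≥0∞) : ℝ≥0∞ := if t = ∞ then ∞ else (F t.toNNReal : ℝ≥0∞)

/-- The Luxemburg functional `‖h‖_F = inf {c : ∫ F(h/c) dμ ≤ 1}` of a function `h` with values in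
`[0,∞]` (the modulus of the function under consideration); it is `∞` if there is no such `c`. -/
def luxemburg {Ω : Type*} [MeasurableSpace Ω] (μ : Measure Ω) (F : ℝ≥0 → ℝ≥0)
    (h : Ω → ℝ≥0∞) : ℝ≥0∞ :=
  ⨅ (c : ℝ≥0) (_ : 0 < c ∧ ∫⁻ ω, extendTop F (h ω / (c : ℝ≥0∞)) ∂μ ≤ 1), (c : ℝ≥0∞)

/-- The non-increasing rearrangement `f*(x) = sup {t : μ(|f| ≥ t) ≥ x}`, with values in `[0,∞]`. -/
def rearrangement {Ω : Type*} [MeasurableSpace Ω] (μ : Measure Ω) (f : Ω → ℂ) (x : ℝ≥0) : ℝ≥0∞ :=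
  ⨆ (t : ℝ≥0) (_ : (x : ℝ≥0∞) ≤ μ {ω | t ≤ ‖f ω‖₊}), (t : ℝ≥0∞)

/-- The Orlicz–Lorentz functional `‖f‖_{F,G} = ‖f* ∘ F̃ ∘ G̃⁻¹‖_G`, the outer Luxemburg functional
being taken on `[0,∞)` with Lebesgue measure. -/
def orliczLorentz {Ω : Type*} [MeasurableSpace Ω] (μ : Measure Ω) (F G : ℝ≥0 → ℝ≥0)
    (f : Ω → ℂ) : ℝ≥0∞ :=
  luxemburg leb G (fun x => rearrangement μ f (tilde F (phiInv (tilde G) x)))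

/-- The functions (representing the elements) of the Orlicz–Lorentz space `L_{F,G}(μ)`. -/
def orliczLorentzSpace {Ω : Type*} [MeasurableSpace Ω] (μ : Measure Ω) (F G : ℝ≥0 → ℝ≥0) :
    Set (Ω → ℂ) :=
  {f | Measurable f ∧ orliczLorentz μ F G f < ∞}

/-- `L_{F₁,G₁}(μ)` and `L_{F₂,G₂}(μ)` are equivalent: they have the same elements, and their
functionals are comparable up to a constant on all measurable functions. -/
def SpacesEquiv {Ω : Type*} [MeasurableSpace Ω] (μ : Measure Ω) (F₁ G₁ F₂ G₂ : ℝ≥0 → ℝ≥0) : Prop :=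
  ∃ c : ℝ≥0, 0 < c ∧ ∀ f : Ω → ℂ, Measurable f →
    (f ∈ orliczLorentzSpace μ F₁ G₁ ↔ f ∈ orliczLorentzSpace μ F₂ G₂) ∧
    (c : ℝ≥0∞)⁻¹ * orliczLorentz μ F₁ G₁ f ≤ orliczLorentz μ F₂ G₂ f ∧
    orliczLorentz μ F₂ G₂ f ≤ (c : ℝ≥0∞) * orliczLorentz μ F₁ G₁ f

/-! ### The almost properties -/

/-- The set `S` has cardinality less than `r`. -/
def CardLT (S : Set ℤ) (r : ℝ≥0) : Prop := S.Finite ∧ (S.ncard : ℝ≥0) < r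

def IsAlmostLinear (G : ℝ≥0 → ℝ≥0) : Prop :=
  ∃ (a b : ℝ≥0) (N : ℕ), 1 < a ∧ 1 < b ∧ 1 ≤ N ∧ ∀ m : ℕ, 1 ≤ m →
    CardLT {n : ℤ | ¬ (a ^ ((m : ℤ) - (N : ℤ)) * G (a ^ n) ≤ G (a ^ (n + (m : ℤ))) ∧
      G (a ^ (n + (m : ℤ))) ≤ a ^ ((m : ℤ) + (N : ℤ)) * G (a ^ n))} (b ^ m)

def IsAlmostEquiv (G₁ G₂ : ℝ≥0 → ℝ≥0) : Prop :=
  ∃ (a b : ℝ≥0) (N : ℕ), 1 < a ∧ 1 < b ∧ 1 ≤ N ∧ ∀ m : ℕ, 1 ≤ m →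
    CardLT {n : ℤ |
      ¬ (a ^ (-(N : ℤ)) * (G₂ (a ^ (n + (m : ℤ))) / G₂ (a ^ n)) ≤
          G₁ (a ^ (n + (m : ℤ))) / G₁ (a ^ n) ∧
        G₁ (a ^ (n + (m : ℤ))) / G₁ (a ^ n) ≤
          a ^ (N : ℤ) * (G₂ (a ^ (n + (m : ℤ))) / G₂ (a ^ n)))} (b ^ m)

/-! ### N-functions and condition (J) -/

/-- N-functions: φ-functions equivalent to a φ-function `F₀` such that `F₀(t)/t` increases strictly
from `0` to `∞` on `(0,∞)`. -/
def IsNFunction (F : ℝ≥0 → ℝ≥0) : Prop :=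
  IsPhi F ∧ ∃ F₀ : ℝ≥0 → ℝ≥0, IsPhi F₀ ∧ PhiEquiv F F₀ ∧
    StrictMonoOn (fun t => F₀ t / t) (Set.Ioi 0) ∧
    Tendsto (fun t => F₀ t / t) atTop atTop ∧
    Tendsto (fun t => F₀ t / t) (𝓝[>] 0) (𝓝 0)

/-- `F` is complementary to `G`. -/
def IsComplementary (F G : ℝ≥0 → ℝ≥0) : Prop :=
  ∃ c : ℝ≥0, 0 < c ∧ ∀ t, c⁻¹ * t ≤ phiInv F t * phiInv G t ∧ phiInv F t * phiInv G t ≤ c * t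

/-- Condition (J) for an N-function `H`: the function `1 / (H*)˜⁻¹` has finite Luxemburg functional
with respect to `H*`, where `H*` is a φ-function complementary to `H`. Such an `H*` exists and is
unique up to equivalence, and the finiteness does not depend on the choice. -/
def ConditionJ (H : ℝ≥0 → ℝ≥0) : Prop :=
  ∃ Hs : ℝ≥0 → ℝ≥0, IsPhi Hs ∧ IsComplementary Hs H ∧
    luxemburg leb Hs (fun x => ((phiInv (tilde Hs) x : ℝ≥0) : ℝ≥0∞)⁻¹) < ∞

/-! ### Weights and condition (L) -/

/-- A weight function on `(0,∞)`; the value at the point `0` is irrelevant. -/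
structure IsWeight (w : ℝ≥0 → ℝ≥0) : Prop where
  measurable : Measurable w
  pos : ∀ t, 0 < t → 0 < w t
  primitive : ∃ W : ℝ≥0 → ℝ≥0, IsPhi W ∧
    ∀ t, (W t : ℝ≥0∞) = ∫⁻ s in Set.Ioc 0 t, (w s : ℝ≥0∞) ∂leb

def IsStrictlyMonotoneWeight (w : ℝ≥0 → ℝ≥0) : Prop :=
  IsWeight w ∧
    ((StrictMonoOn w (Set.Ioi 0) ∧ Tendsto w (𝓝[>] 0) (𝓝 0) ∧ Tendsto w atTop atTop) ∨
      (StrictAntiOn w (Set.Ioi 0) ∧ Tendsto w (𝓝[>] 0) atTop ∧ Tendsto w atTop (𝓝 0)))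

/-- Condition (L) for a strictly monotone weight `w`: the inverse `w⁻¹ : (0,∞) → (0,∞)` exists
(that is, the injective function `w` is also onto), and `∫₀^∞ dt / w⁻¹(c w(t)) < ∞` for some
`c`. -/
def ConditionL (w : ℝ≥0 → ℝ≥0) : Prop :=
  Set.SurjOn w (Set.Ioi 0) (Set.Ioi 0) ∧ ∃ c : ℝ≥0, 0 < c ∧
    ∫⁻ t in Set.Ioi (0 : ℝ≥0), ((Function.invFunOn w (Set.Ioi 0) (c * w t) : ℝ≥0) : ℝ≥0∞)⁻¹ ∂leb < ∞

end OrliczLorentz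

end

open OrliczLorentz

/-!
In logarithmic coordinates `t = exp x` a φ-function is an order automorphism of the real line
(`ofIso`, `IsPhi.exists_eq_ofIso`). Write `fᵢ`, `gᵢ` for the automorphisms given by `Fᵢ`, `Gᵢ`.
Then `F₁ ≍ F₂` says that `f₁` and `f₂` agree up to bounded translations of the variable, "dilatory"
says that `g` is coarsely expanding, and the `Δ₂`-condition says that `g` is coarsely Lipschitz.

All eight conditions turn out to be equivalent to `F₁ ≍ F₂` together with the *slowness* (`Slow`) of
`g₁ - g₂`. A function `f` on the line is slow if the distance `T n` from an integer `n` over which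
the value of `f` changes by more than a constant `N` satisfies `∑ exp (-B T n) < ∞` for some `N`,
`B`. Slow functions form an additive group, stable under bounded perturbations and quasi-isometric
changes of variable. The key fact is that the exponent `B` can be made arbitrarily small at the
cost of a larger `N` (`Slow.exists_small`): if `f` changes by `2N` between `n` and `x`, then it
changes by `N` between the midpoint and one of the two ends. Slow functions are sublinear
(`Slow.sublinear`), because only finitely many `n` have `T n` below a given bound; so adding one
preserves quasi-isometries. Slowness has two more descriptions:

* by counting: for each `m`, the number of `n` with `|f (n + m) - f n| > N` is at most exponential
  in `m` (`slow_of_count`, `Slow.exists_count`); applied to `g - id` and to `g₁ - g₂` this is what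
  almost linearity and almost equivalence mean;
* for an automorphism `ρ`, by an integral: `∫ exp (-|ρ⁻¹ (ρ x ± γ) - x|) dx < ∞` for some `γ`
  (`slow_of_lintegral_forward_gap`, `Slow.lintegral_gap_le`). Conditions (J) and (L) are such
  integrals, so condition (J) for `H = exp ∘ η ∘ log` says that `η - id` is slow, and condition (L)
  says that the weight is `exp (± ρ (log t))` with `ρ` slow.

To pass from slowness back to the existence of N-functions and weights, one writes a slow function
as the difference `ρ - ω` of two slow automorphisms up to a bounded error
(`Slow.exists_orderIso_control`).

It remains to treat the spaces. After a logarithmic change of variable the norm of `u` is given by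
the modular `∫ G (k (g⁻¹ z)) exp (-z) dz` with `k y = u* (exp (-f y))`, which compares, up to
constants, with the sum of `exp (g (log k y) - g y)` over a lattice of points `y`. If `g₁ - g₂` is
slow, the terms for `g₁` and `g₂` are comparable after division of `k` by a constant, except where
`log k y` is so far from `y` that slowness bounds them by a summable sequence
(`exists_modular_bound`). Conversely, indicator functions recover `F₁ ≍ F₂` (`exists_shift_le`),
and step functions give an inequality between the sums `∑ exp (gᵢ (a n) - gᵢ (v n))` (`TestBound`).
It transfers the coarse hypotheses from one of `g₁`, `g₂` to the other, and a bootstrapping argument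
derives from it the counting description of the slowness of `g₁ - g₂` (`slow_of_testBound`).
-/

namespace OrliczLorentz

/-! ### Coarse geometry of the real line -/

/-- The exponential function with values in `[0,∞)`. -/
noncomputable def nexp (x : ℝ) : ℝ≥0 := ⟨Real.exp x, (Real.exp_pos x).le⟩

@[simp] lemma coe_nexp (x : ℝ) : (nexp x : ℝ) = Real.exp x := rfl

lemma nexp_add (x y : ℝ) : nexp (x + y) = nexp x * nexp y := by
  ext; simp [Real.exp_add]

lemma nexp_pos (x : ℝ) : 0 < nexp x := Real.exp_pos x

@[simp] lemma nexp_ne_zero (x : ℝ) : nexp x ≠ 0 := (nexp_pos x).ne'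

@[simp] lemma nexp_zero : nexp 0 = 1 := by ext; simp

lemma nexp_neg (x : ℝ) : nexp (-x) = (nexp x)⁻¹ := by ext; simp [Real.exp_neg]

lemma nexp_sub (x y : ℝ) : nexp (x - y) = nexp x / nexp y := by ext; simp [Real.exp_sub]

lemma nexp_strictMono : StrictMono nexp := fun _ _ h => Real.exp_lt_exp.2 h

@[simp] lemma nexp_le_nexp {x y : ℝ} : nexp x ≤ nexp y ↔ x ≤ y := nexp_strictMono.le_iff_le

@[simp] lemma nexp_lt_nexp {x y : ℝ} : nexp x < nexp y ↔ x < y := nexp_strictMono.lt_iff_lt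

lemma continuous_nexp : Continuous nexp := by
  unfold nexp; exact Real.continuous_exp.subtype_mk _

lemma nexp_log {t : ℝ≥0} (ht : 0 < t) : nexp (Real.log t) = t := by
  ext; simp [Real.exp_log (NNReal.coe_pos.2 ht)]

lemma nexp_zpow (x : ℝ) (n : ℤ) : nexp x ^ n = nexp (x * n) := by
  ext; push_cast; rw [coe_nexp, coe_nexp, Real.exp_mul, Real.rpow_intCast]

lemma nexp_pow (x : ℝ) (n : ℕ) : nexp x ^ n = nexp (x * n) := by
  ext; push_cast; simp [mul_comm x, Real.exp_nat_mul]

/-- Large-scale Lipschitz functions. -/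
def CoarseLipschitz (f : ℝ → ℝ) : Prop :=
  ∃ Q : ℝ, 0 ≤ Q ∧ ∀ x y, |f x - f y| ≤ Q * |x - y| + Q

/-- Functions that do not contract large distances by more than a constant factor. -/
def CoarseExpanding (f : ℝ → ℝ) : Prop :=
  ∃ Q : ℝ, 0 ≤ Q ∧ ∀ x y, |x - y| ≤ Q * |f x - f y| + Q

/-- Quasi-isometric embeddings of the real line into itself. -/
structure QuasiIsometry (f : ℝ → ℝ) : Prop where
  lipschitz : CoarseLipschitz f
  expanding : CoarseExpanding f

lemma CoarseLipschitz.comp {f g : ℝ → ℝ} (hf : CoarseLipschitz f) (hg : CoarseLipschitz g) :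
    CoarseLipschitz (fun x => f (g x)) := by
  obtain ⟨Q, hQ, h⟩ := hf
  obtain ⟨R, hR, k⟩ := hg
  refine ⟨Q * R + Q, by positivity, fun x y => (h _ _).trans ?_⟩
  nlinarith [k x y, abs_nonneg (x - y), mul_nonneg hQ (abs_nonneg (x - y)),
    mul_le_mul_of_nonneg_left (k x y) hQ]

lemma CoarseExpanding.comp {f g : ℝ → ℝ} (hf : CoarseExpanding f) (hg : CoarseExpanding g) :
    CoarseExpanding (fun x => f (g x)) := by
  obtain ⟨Q, hQ, h⟩ := hf
  obtain ⟨R, hR, k⟩ := hg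
  refine ⟨R * Q + R, by positivity, fun x y => (k _ _).trans ?_⟩
  nlinarith [h (g x) (g y), abs_nonneg (f (g x) - f (g y)),
    mul_nonneg hR (abs_nonneg (f (g x) - f (g y))), mul_le_mul_of_nonneg_left (h (g x) (g y)) hR]

lemma QuasiIsometry.comp {f g : ℝ → ℝ} (hf : QuasiIsometry f) (hg : QuasiIsometry g) :
    QuasiIsometry (fun x => f (g x)) :=
  ⟨hf.1.comp hg.1, hf.2.comp hg.2⟩

lemma CoarseLipschitz.expanding_symm {g : ℝ ≃o ℝ} (h : CoarseLipschitz g) :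
    CoarseExpanding g.symm := by
  obtain ⟨Q, hQ, h⟩ := h
  exact ⟨Q, hQ, fun x y => by simpa using h (g.symm x) (g.symm y)⟩

lemma CoarseExpanding.lipschitz_symm {g : ℝ ≃o ℝ} (h : CoarseExpanding g) :
    CoarseLipschitz g.symm := by
  obtain ⟨Q, hQ, h⟩ := h
  exact ⟨Q, hQ, fun x y => by simpa using h (g.symm x) (g.symm y)⟩

lemma QuasiIsometry.symm {g : ℝ ≃o ℝ} (h : QuasiIsometry g) : QuasiIsometry g.symm :=
  ⟨h.2.lipschitz_symm, h.1.expanding_symm⟩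

lemma CoarseLipschitz.of_near {f g : ℝ → ℝ} (hf : CoarseLipschitz f) {C : ℝ}
    (h : ∀ x, |g x - f x| ≤ C) : CoarseLipschitz g := by
  obtain ⟨Q, hQ, k⟩ := hf
  have hC : 0 ≤ C := (abs_nonneg _).trans (h 0)
  refine ⟨Q + 2 * C, by positivity, fun x y => ?_⟩
  have h1 : |g x - g y| ≤ |f x - f y| + 2 * C := by
    have := h x; have := h y
    simp only [abs_le] at *
    constructor <;> rcases abs_cases (f x - f y) with ⟨e, _⟩ | ⟨e, _⟩ <;> linarith
  nlinarith [k x y, abs_nonneg (x - y)]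

lemma CoarseExpanding.of_near {f g : ℝ → ℝ} (hf : CoarseExpanding f) {C : ℝ}
    (h : ∀ x, |g x - f x| ≤ C) : CoarseExpanding g := by
  obtain ⟨Q, hQ, k⟩ := hf
  have hC : 0 ≤ C := (abs_nonneg _).trans (h 0)
  refine ⟨Q + 2 * Q * C, by positivity, fun x y => ?_⟩
  have h1 : |f x - f y| ≤ |g x - g y| + 2 * C := by
    have := h x; have := h y
    simp only [abs_le] at *
    constructor <;> rcases abs_cases (g x - g y) with ⟨e, _⟩ | ⟨e, _⟩ <;> linarith
  nlinarith [k x y, abs_nonneg (g x - g y), mul_nonneg hQ hC,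
    mul_nonneg (mul_nonneg hQ hC) (abs_nonneg (g x - g y)), mul_le_mul_of_nonneg_left h1 hQ]

lemma quasiIsometry_mul {a : ℝ} (ha : 0 < a) : QuasiIsometry (fun x => a * x) := by
  constructor
  · refine ⟨a, ha.le, fun x y => ?_⟩
    rw [← mul_sub, abs_mul, abs_of_pos ha]; linarith
  · refine ⟨a⁻¹, by positivity, fun x y => ?_⟩
    rw [← mul_sub, abs_mul, abs_of_pos ha, ← mul_assoc, inv_mul_cancel₀ ha.ne', one_mul]
    linarith [inv_pos.2 ha]

lemma quasiIsometry_neg : QuasiIsometry (fun x => -x) := by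
  constructor <;>
  · refine ⟨1, zero_le_one, fun x y => ?_⟩
    rw [show -x - -y = -(x - y) by ring, abs_neg]; linarith

/-! ### Summation over the integers with exponential weights -/

lemma nexp_le_mul {a b d : ℝ} {q : ℝ≥0∞} (h : (nexp a : ℝ≥0∞) ≤ q) (hb : b ≤ d + a) :
    (nexp b : ℝ≥0∞) ≤ nexp d * q := by
  calc (nexp b : ℝ≥0∞) ≤ nexp (d + a) := by exact_mod_cast nexp_le_nexp.2 hb
    _ = nexp d * nexp a := by rw [nexp_add]; push_cast; rfl
    _ ≤ _ := by gcongr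

lemma tsum_nexp_ne_top {c : ℝ} (hc : 0 < c) :
    ∑' n : ℤ, (nexp (-(c * |(n : ℝ)|)) : ℝ≥0∞) ≠ ∞ := by
  rw [ENNReal.tsum_coe_ne_top_iff_summable, ← NNReal.summable_coe]
  have h : Summable (fun n : ℕ => Real.exp (-c) ^ n) :=
    summable_geometric_of_lt_one (Real.exp_pos _).le (Real.exp_lt_one_iff.2 (by linarith))
  have h' : ∀ n : ℕ, Real.exp (-(c * n)) = Real.exp (-c) ^ n := fun n => by
    rw [← Real.exp_nat_mul]; congr 1; ring
  apply Summable.of_nat_of_neg <;> simpa [h'] using h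

lemma tsum_nexp_shift (c : ℝ) (k : ℤ) :
    ∑' n : ℤ, (nexp (-(c * |((k : ℝ) - n)|)) : ℝ≥0∞) =
      ∑' n : ℤ, (nexp (-(c * |(n : ℝ)|)) : ℝ≥0∞) := by
  rw [← (Equiv.subLeft k).tsum_eq (fun n : ℤ => (nexp (-(c * |(n : ℝ)|)) : ℝ≥0∞))]
  simp

/-- Convolution of `q` with `exp (-c |n|)`. -/
noncomputable def expConv (c : ℝ) (q : ℤ → ℝ≥0∞) (n : ℤ) : ℝ≥0∞ :=
  ∑' k : ℤ, (nexp (-(c * |(k : ℝ) - n|)) : ℝ≥0∞) * q k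

lemma le_expConv (c : ℝ) (q : ℤ → ℝ≥0∞) (n k : ℤ) :
    (nexp (-(c * |(k : ℝ) - n|)) : ℝ≥0∞) * q k ≤ expConv c q n :=
  ENNReal.le_tsum k

lemma tsum_expConv_ne_top {c : ℝ} (hc : 0 < c) {q : ℤ → ℝ≥0∞} (hq : ∑' n, q n ≠ ∞) :
    ∑' n, expConv c q n ≠ ∞ := by
  unfold expConv
  rw [ENNReal.tsum_comm]
  simp_rw [ENNReal.tsum_mul_right, tsum_nexp_shift, ENNReal.tsum_mul_left]
  exact ENNReal.mul_ne_top (tsum_nexp_ne_top hc) hq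

/-- Summability is preserved by reindexing along a map with fibres of bounded length. -/
lemma tsum_comp_ne_top {q : ℤ → ℝ≥0∞} (hq : ∑' n, q n ≠ ∞) {σ : ℤ → ℤ} {M : ℝ}
    (hσ : ∀ m n, σ m = σ n → |(m : ℝ) - n| ≤ M) : ∑' n, q (σ n) ≠ ∞ := by
  classical
  set E := ∑' n : ℤ, (nexp (-(1 * |(n : ℝ)|)) : ℝ≥0∞) with hE
  have h1 : ∀ n, q (σ n) = ∑' k, if σ n = k then q k else 0 := fun n => by
    rw [tsum_eq_single (σ n) (fun k hk => if_neg (Ne.symm hk))]; simp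
  have h2 : ∀ k, ∑' n, (if σ n = k then q k else 0) ≤ nexp M * E * q k := fun k => by
    by_cases hk : ∃ m, σ m = k
    · obtain ⟨m, hm⟩ := hk
      rw [hE, ← tsum_nexp_shift 1 m, ← ENNReal.tsum_mul_left, ← ENNReal.tsum_mul_right]
      refine ENNReal.tsum_le_tsum fun n => ?_
      split_ifs with h
      · have : (1 : ℝ≥0∞) ≤ nexp M * nexp (-(1 * |(m : ℝ) - n|)) := by
          have := hσ m n (hm.trans h.symm)
          calc (1 : ℝ≥0∞) = nexp 0 := by simp
            _ ≤ _ := nexp_le_mul le_rfl (by linarith)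
        calc q k = 1 * q k := (one_mul _).symm
          _ ≤ _ := by gcongr
      · exact zero_le
    · push Not at hk
      simp [hk]
  refine ne_top_of_le_ne_top
    (b := nexp M * E * ∑' n, q n) (ENNReal.mul_ne_top
    (ENNReal.mul_ne_top ENNReal.coe_ne_top (tsum_nexp_ne_top one_pos)) hq) ?_
  simp_rw [h1]
  rw [ENNReal.tsum_comm, ← ENNReal.tsum_mul_left]
  exact ENNReal.tsum_le_tsum h2

/-! ### Slow functions -/

/-- `q n` dominates `exp (-B T)`, where `T` is the distance from the integer `n` to the nearest point
at which `f` has left the `N`-neighbourhood of its value at `n`. -/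
def SlowWith (f : ℝ → ℝ) (N B : ℝ) (q : ℤ → ℝ≥0∞) : Prop :=
  ∀ (n : ℤ) (x : ℝ), N < |f x - f n| → (nexp (-(B * |x - n|)) : ℝ≥0∞) ≤ q n

/-- A function is slow if it is locally bounded and the distances `T n` needed to change its value
at an integer `n` by more than a constant satisfy `∑ exp (-B T n) < ∞` for some `B`. The sum is
expressed through a summable majorant `q`, which avoids naming `T`. -/
structure Slow (f : ℝ → ℝ) : Prop where
  bdd : ∀ R : ℝ, ∃ M : ℝ, ∀ x, |x| ≤ R → |f x| ≤ M
  exists_slowWith : ∃ (N B : ℝ) (q : ℤ → ℝ≥0∞), 0 ≤ N ∧ 0 < B ∧ ∑' n, q n ≠ ∞ ∧ SlowWith f N B q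

lemma SlowWith.mono {f : ℝ → ℝ} {N B N' B' : ℝ} {q : ℤ → ℝ≥0∞} (h : SlowWith f N B q)
    (hN : N ≤ N') (hB : B ≤ B') : SlowWith f N' B' q := fun n x hx =>
  le_trans (by
    have := mul_le_mul_of_nonneg_right hB (abs_nonneg (x - n))
    exact_mod_cast nexp_le_nexp.2 (by linarith)) (h n x (hN.trans_lt hx))

lemma Slow.of_continuous {f : ℝ → ℝ} (hf : Continuous f)
    (h : ∃ (N B : ℝ) (q : ℤ → ℝ≥0∞), 0 ≤ N ∧ 0 < B ∧ ∑' n, q n ≠ ∞ ∧ SlowWith f N B q) :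
    Slow f := by
  refine ⟨fun R => ?_, h⟩
  obtain ⟨M, hM⟩ := (isCompact_Icc (a := -R) (b := R)).exists_bound_of_continuousOn hf.continuousOn
  exact ⟨M, fun x hx => hM x (abs_le.1 hx)⟩

lemma Slow.neg {f : ℝ → ℝ} (hf : Slow f) : Slow (fun x => -f x) := by
  obtain ⟨N, B, q, hN, hB, hq, h⟩ := hf.2
  refine ⟨fun R => ?_, N, B, q, hN, hB, hq, fun n x hx => h n x ?_⟩
  · simpa using hf.1 R
  · rwa [show -f x - -f n = -(f x - f n) by ring, abs_neg] at hx

lemma Slow.add {f g : ℝ → ℝ} (hf : Slow f) (hg : Slow g) : Slow (fun x => f x + g x) := by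
  obtain ⟨N, B, q, hN, hB, hq, h⟩ := hf.2
  obtain ⟨N', B', q', hN', hB', hq', h'⟩ := hg.2
  refine ⟨fun R => ?_, N + N', max B B', fun n => q n + q' n, by positivity, by positivity, ?_,
    fun n x hx => ?_⟩
  · obtain ⟨M, hM⟩ := hf.1 R
    obtain ⟨M', hM'⟩ := hg.1 R
    exact ⟨M + M', fun x hx => (abs_add_le _ _).trans (add_le_add (hM x hx) (hM' x hx))⟩
  · rw [ENNReal.tsum_add]; exact ENNReal.add_ne_top.2 ⟨hq, hq'⟩
  · have h1 : |f x + g x - (f n + g n)| ≤ |f x - f n| + |g x - g n| := by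
      rw [show f x + g x - (f n + g n) = (f x - f n) + (g x - g n) by ring]
      exact abs_add_le _ _
    rcases lt_or_ge N |f x - f n| with h2 | h2
    · exact ((h.mono le_rfl (le_max_left B B')) n x h2).trans le_self_add
    · exact ((h'.mono le_rfl (le_max_right B B')) n x (by linarith)).trans le_add_self

lemma Slow.sub {f g : ℝ → ℝ} (hf : Slow f) (hg : Slow g) : Slow (fun x => f x - g x) := by
  simpa [sub_eq_add_neg] using hf.add hg.neg

lemma Slow.of_near {f g : ℝ → ℝ} (hf : Slow f) {C : ℝ} (hC : ∀ x, |g x - f x| ≤ C) : Slow g := by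
  obtain ⟨N, B, q, hN, hB, hq, h⟩ := hf.2
  have hC0 : 0 ≤ C := (abs_nonneg _).trans (hC 0)
  refine ⟨fun R => ?_, N + 2 * C, B, q, by positivity, hB, hq, fun n x hx => h n x ?_⟩
  · obtain ⟨M, hM⟩ := hf.1 R
    refine ⟨M + C, fun x hx => ?_⟩
    have := abs_add_le (g x - f x) (f x)
    rw [sub_add_cancel] at this
    linarith [hM x hx, hC x]
  · have h1 : |g x - g n| ≤ |f x - f n| + 2 * C := by
      have := hC x; have := hC n
      simp only [abs_le] at *
      constructor <;> rcases abs_cases (f x - f n) with ⟨e, _⟩ | ⟨e, _⟩ <;> linarith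
    linarith

lemma Slow.const_mul {f : ℝ → ℝ} (hf : Slow f) {C : ℝ} (hC : 0 < C) : Slow (fun x => C * f x) := by
  obtain ⟨N, B, q, hN, hB, hq, h⟩ := hf.2
  refine ⟨fun R => ?_, C * N, B, q, by positivity, hB, hq, fun n x hx => h n x ?_⟩
  · obtain ⟨M, hM⟩ := hf.1 R
    refine ⟨C * M, fun x hx => ?_⟩
    rw [abs_mul, abs_of_pos hC]
    exact mul_le_mul_of_nonneg_left (hM x hx) hC.le
  · rw [← mul_sub, abs_mul, abs_of_pos hC] at hx
    exact lt_of_mul_lt_mul_left hx hC.le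

/-- Slowness is invariant under quasi-isometric changes of variable: such a map sends only boundedly
many integers near a given one, and stretches distances by at most a factor. -/
lemma Slow.comp {f φ : ℝ → ℝ} (hf : Slow f) (hφ : QuasiIsometry φ) : Slow (fun x => f (φ x)) := by
  obtain ⟨N, B, q, hN, hB, hq, h⟩ := hf.2
  obtain ⟨⟨Q, hQ, hl⟩, ⟨Q', hQ', he⟩⟩ := hφ
  refine ⟨fun R => ?_, 2 * N, B * (Q + 1), fun n => nexp (B * (Q + 1)) * q ⌊φ n⌋, by positivity,
    by positivity, ?_, fun n x hx => ?_⟩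
  · obtain ⟨M, hM⟩ := hf.1 (|φ 0| + Q * R + Q)
    refine ⟨M, fun x hx => hM _ ?_⟩
    have h1 := hl x 0
    have h2 := abs_add_le (φ x - φ 0) (φ 0)
    rw [sub_add_cancel] at h2
    rw [sub_zero] at h1
    nlinarith
  · rw [ENNReal.tsum_mul_left]
    refine ENNReal.mul_ne_top ENNReal.coe_ne_top (tsum_comp_ne_top hq (M := Q' * 1 + Q') ?_)
    intro m n hmn
    refine (he m n).trans ?_
    have : |φ m - φ n| ≤ 1 := by
      have h1 := Int.floor_le (φ m); have h2 := Int.lt_floor_add_one (φ m)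
      have h3 := Int.floor_le (φ n); have h4 := Int.lt_floor_add_one (φ n)
      rw [hmn] at h1 h2
      rw [abs_le]; constructor <;> linarith
    nlinarith
  · set k := ⌊φ n⌋ with hk
    have hk1 : |φ n - k| ≤ 1 := by
      have h3 := Int.floor_le (φ n); have h4 := Int.lt_floor_add_one (φ n)
      rw [abs_le]; constructor <;> linarith
    have h1 := abs_sub_le (f (φ x)) (f k) (f (φ n))
    rw [abs_sub_comm (f k)] at h1
    have h0 : 0 ≤ |x - n| := abs_nonneg _
    rcases lt_or_ge N |f (φ x) - f k| with h2 | h2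
    · refine nexp_le_mul (h k (φ x) h2) ?_
      have h3 := abs_sub_le (φ x) (φ n) k
      have h4 := hl x n
      nlinarith
    · refine nexp_le_mul (h k (φ n) (by linarith)) ?_
      nlinarith [mul_nonneg hQ h0]

/-- The midpoint trick: splitting `[n, x]` in the middle improves the exponent. -/
lemma SlowWith.improve {f : ℝ → ℝ} {N B : ℝ} {q : ℤ → ℝ≥0∞} (h : SlowWith f N B q) (hB : 0 < B) :
    SlowWith f (2 * N) (2 / 3 * B)
      (fun n => nexp B * q n + nexp (2 * B) * expConv (B / 3) q n) := by
  intro n x hx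
  -- `f` changes by more than `N` between the midpoint `k` and `n`, or between `k` and `x`; the second
  -- case gives `exp (-B |x - n| / 2)` at `k`, and the factor `exp (-B |k - n| / 3)` that makes the
  -- sum over `k` converge costs `exp (-B |x - n| / 6)`, whence `2 / 3 = 1 / 2 + 1 / 6`
  set k : ℤ := round ((n + x) / 2) with hk
  have hk1 : |(n + x) / 2 - k| ≤ 1 / 2 := abs_sub_round _
  have h1 := abs_sub_le (f x) (f k) (f n)
  have e1 : |(k : ℝ) - n| ≤ |x - n| / 2 + 1 / 2 := by
    have := abs_sub_le (k : ℝ) ((n + x) / 2) n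
    rw [abs_sub_comm (k : ℝ) ((n + x) / 2), show (n + x) / 2 - (n : ℝ) = (x - n) / 2 by ring, abs_div,
      abs_of_pos (two_pos : (0 : ℝ) < 2)] at this
    linarith
  have e2 : |x - k| ≤ |x - n| / 2 + 1 / 2 := by
    have := abs_sub_le x ((n + x) / 2) k
    rw [show x - (n + x) / 2 = (x - n) / 2 by ring, abs_div,
      abs_of_pos (two_pos : (0 : ℝ) < 2)] at this
    linarith
  have h0 : 0 ≤ |x - n| := abs_nonneg _
  rcases lt_or_ge N |f k - f n| with h2 | h2
  · refine (nexp_le_mul (h n k h2) ?_).trans le_self_add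
    nlinarith
  · have h3 := h k x (by linarith)
    refine le_trans ?_ ((mul_le_mul_right (le_expConv (B / 3) q n k) _).trans le_add_self)
    rw [← mul_assoc, ← ENNReal.coe_mul, ← nexp_add]
    refine nexp_le_mul h3 ?_
    nlinarith

/-- The exponent in the definition of slowness can be taken arbitrarily small. -/
lemma Slow.exists_small {f : ℝ → ℝ} (hf : Slow f) {ε : ℝ} (hε : 0 < ε) :
    ∃ (N : ℝ) (q : ℤ → ℝ≥0∞), 0 ≤ N ∧ ∑' n, q n ≠ ∞ ∧ SlowWith f N ε q := by
  obtain ⟨N, B, q, hN, hB, hq, h⟩ := hf.2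
  have key : ∀ j : ℕ, ∃ (N : ℝ) (q : ℤ → ℝ≥0∞), 0 ≤ N ∧ ∑' n, q n ≠ ∞ ∧
      SlowWith f N ((2 / 3) ^ j * B) q := by
    intro j
    induction j with
    | zero => exact ⟨N, q, hN, hq, by simpa using h⟩
    | succ j ih =>
      obtain ⟨N, q, hN, hq, h⟩ := ih
      have hB' : 0 < (2 / 3 : ℝ) ^ j * B := by positivity
      refine ⟨2 * N, _, by positivity, ?_, by
        have := h.improve hB'; rwa [← mul_assoc, ← pow_succ'] at this⟩
      rw [ENNReal.tsum_add, ENNReal.tsum_mul_left, ENNReal.tsum_mul_left]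
      exact ENNReal.add_ne_top.2 ⟨ENNReal.mul_ne_top ENNReal.coe_ne_top hq,
        ENNReal.mul_ne_top ENNReal.coe_ne_top (tsum_expConv_ne_top (by positivity) hq)⟩
  obtain ⟨j, hj⟩ := exists_pow_lt_of_lt_one (show 0 < ε / B by positivity)
    (show (2 / 3 : ℝ) < 1 by norm_num)
  obtain ⟨N, q, hN, hq, h⟩ := key j
  exact ⟨N, q, hN, hq, h.mono le_rfl ((lt_div_iff₀ hB).1 hj).le⟩

/-- A slow function grows more slowly than any linear function. -/
lemma Slow.sublinear {f : ℝ → ℝ} (hf : Slow f) {ε : ℝ} (hε : 0 < ε) :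
    ∃ C : ℝ, 0 ≤ C ∧ ∀ x y, |f x - f y| ≤ ε * |x - y| + C := by
  classical
  obtain ⟨N, B, q, hN, hB, hq, h⟩ := hf.2
  obtain ⟨m, hm⟩ := exists_nat_gt (max 1 (N / ε))
  have hm1 : (1 : ℝ) < m := (le_max_left _ _).trans_lt hm
  have hm2 : N / ε < m := (le_max_right _ _).trans_lt hm
  have hm0 : (0 : ℝ) < m := by linarith
  have hfin : {n : ℤ | (nexp (-(B * m)) : ℝ≥0∞) ≤ q n}.Finite :=
    ENNReal.finite_const_le_of_tsum_ne_top hq (by simp)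
  set S := hfin.toFinset with hS
  -- all but finitely many integers see no variation above `N` at distances up to `m`
  have hgood : ∀ n : ℤ, n ∉ S → ∀ x : ℝ, |x - n| ≤ m → |f x - f n| ≤ N := by
    intro n hn x hx
    by_contra hc
    refine hn (hfin.mem_toFinset.2 (le_trans ?_ (h n x (not_le.1 hc))))
    have := mul_le_mul_of_nonneg_left hx hB.le
    exact_mod_cast nexp_le_nexp.2 (by linarith)
  -- `M` bounds the oscillation of `f` at distance `m` of the finitely many exceptional integers
  obtain ⟨M, hM0, hM⟩ : ∃ M, 0 ≤ M ∧ ∀ n ∈ S, ∀ x : ℝ, |x - n| ≤ m → |f x - f n| ≤ M := by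
    choose b hb using hf.1
    refine ⟨∑ n ∈ S, 2 * |b (|(n : ℝ)| + m)|, by positivity, fun n hn x hx => ?_⟩
    refine le_trans ?_ (Finset.single_le_sum
      (f := fun n : ℤ => 2 * |b (|(n : ℝ)| + m)|) (fun i _ => by positivity) hn)
    have h1 := hb (|(n : ℝ)| + m) x (by
      have := abs_add_le (x - n) n
      rw [sub_add_cancel] at this; linarith)
    have h2 := hb (|(n : ℝ)| + m) n (by linarith)
    have h3 := abs_sub (f x) (f n)
    have h4 := le_abs_self (b (|(n : ℝ)| + m))
    linarith
  have hany : ∀ n : ℤ, ∀ x : ℝ, |x - n| ≤ m → |f x - f n| ≤ N + if n ∈ S then M else 0 := by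
    intro n x hx
    split_ifs with hn
    · linarith [hM n hn x hx]
    · linarith [hgood n hn x hx]
  have hany' : ∀ n : ℤ, ∀ x : ℝ, |x - n| ≤ m → |f x - f n| ≤ N + M := by
    intro n x hx
    have := hany n x hx
    split_ifs at this <;> linarith
  -- walking from `n` in steps of length `m` meets each exceptional integer at most once
  have hwalk : ∀ (n : ℤ) (k : ℕ), |f ((n + k * m : ℤ) : ℝ) - f n| ≤ k * N + S.card * M := by
    intro n k
    have h1 : |f ((n + k * m : ℤ) : ℝ) - f n| ≤
        ∑ i ∈ Finset.range k, (N + if (n + i * m : ℤ) ∈ S then M else 0) := by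
      induction k with
      | zero => simp
      | succ k ih =>
        rw [Finset.sum_range_succ]
        refine (abs_sub_le _ (f ((n + k * m : ℤ) : ℝ)) _).trans ?_
        rw [add_comm]
        refine add_le_add ih (hany (n + k * m) _ ?_)
        push_cast
        rw [show (n + (k + 1) * m - (n + k * m) : ℝ) = m by ring, abs_of_pos hm0]
    refine h1.trans ?_
    rw [Finset.sum_add_distrib, Finset.sum_const, Finset.card_range, nsmul_eq_mul,
      ← Finset.sum_filter, Finset.sum_const, nsmul_eq_mul]
    gcongr
    refine Finset.card_le_card_of_injOn (fun i : ℕ => (n + i * m : ℤ)) ?_ ?_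
    · intro i hi; simpa using (Finset.mem_filter.1 hi).2
    · intro i _ j _ hij
      have hmz : (m : ℤ) ≠ 0 := by
        have : (m : ℤ) > 0 := by exact_mod_cast hm0
        omega
      have hm' : m ≠ 0 := by exact_mod_cast hmz
      simpa [hm'] using hij
  have hle : ∀ x y, x ≤ y → |f y - f x| ≤ ε * (y - x) + (3 * (N + M) + S.card * M) := by
    intro x y hxy
    set n := ⌊x⌋
    have hn1 := Int.floor_le x
    have hn2 := Int.lt_floor_add_one x
    set k := ⌊(y - n) / m⌋₊
    have hyn : 0 ≤ (y - n) / m := div_nonneg (by linarith) hm0.le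
    have hk1 := Nat.floor_le hyn
    have hk2 := Nat.lt_floor_add_one ((y - n) / m)
    rw [le_div_iff₀ hm0] at hk1
    rw [div_lt_iff₀ hm0] at hk2
    have a1 := hany' n x (by rw [abs_le]; constructor <;> linarith)
    have a2 := hwalk n k
    have a3 := hany' (n + k * m) y (by
      push_cast; rw [abs_le]; constructor <;> nlinarith)
    have hmN : N ≤ ε * m := by
      rw [div_lt_iff₀ hε] at hm2; linarith
    have a4 : k * N ≤ ε * (y - x) + N := by
      rcases Nat.eq_zero_or_pos k with hk | hk
      · rw [hk]; simp only [Nat.cast_zero, zero_mul]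
        have := mul_nonneg hε.le (sub_nonneg.2 hxy); linarith
      · have : (k - 1 : ℝ) * N ≤ ε * (y - x) := by
          have hk' : (0 : ℝ) ≤ k - 1 := by
            have : (1 : ℝ) ≤ k := by exact_mod_cast hk
            linarith
          calc (k - 1 : ℝ) * N ≤ (k - 1) * (ε * m) := by gcongr
            _ = ε * ((k - 1) * m) := by ring
            _ ≤ _ := by
              apply mul_le_mul_of_nonneg_left _ hε.le
              nlinarith
        linarith
    rw [abs_le] at a1 a2 a3 ⊢
    constructor <;> linarith
  refine ⟨3 * (N + M) + S.card * M, by positivity, fun x y => ?_⟩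
  rcases le_total x y with hxy | hxy
  · rw [abs_sub_comm, abs_sub_comm x, abs_of_nonneg (sub_nonneg.2 hxy)]; exact hle x y hxy
  · rw [abs_of_nonneg (sub_nonneg.2 hxy)]; exact hle y x hxy

lemma Slow.coarseLipschitz {f : ℝ → ℝ} (hf : Slow f) : CoarseLipschitz f := by
  obtain ⟨C, hC, h⟩ := hf.sublinear one_pos
  exact ⟨max 1 C, by positivity, fun x y => (h x y).trans (by
    have := mul_le_mul_of_nonneg_right (le_max_left 1 C) (abs_nonneg (x - y))
    linarith [le_max_right 1 C])⟩

lemma CoarseLipschitz.add {f g : ℝ → ℝ} (hf : CoarseLipschitz f) (hg : CoarseLipschitz g) :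
    CoarseLipschitz (fun x => f x + g x) := by
  obtain ⟨Q, hQ, h⟩ := hf
  obtain ⟨R, hR, k⟩ := hg
  refine ⟨Q + R, by positivity, fun x y => ?_⟩
  rw [show f x + g x - (f y + g y) = (f x - f y) + (g x - g y) by ring]
  linarith [abs_add_le (f x - f y) (g x - g y), h x y, k x y]

lemma CoarseExpanding.add_slow {f g : ℝ → ℝ} (hf : CoarseExpanding f) (hg : Slow g) :
    CoarseExpanding (fun x => f x + g x) := by
  obtain ⟨Q, hQ, h⟩ := hf
  obtain ⟨C, hC, k⟩ := hg.sublinear (show 0 < 1 / (2 * (Q + 1)) by positivity)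
  refine ⟨2 * Q * (C + 1), by positivity, fun x y => ?_⟩
  have h1 : |f x - f y| ≤ |f x + g x - (f y + g y)| + |g x - g y| := by
    have := abs_sub (f x + g x - (f y + g y)) (g x - g y)
    rwa [show f x + g x - (f y + g y) - (g x - g y) = f x - f y by ring] at this
  have h2 := h x y
  have h3 := k x y
  have h4 : Q * (1 / (2 * (Q + 1)) * |x - y|) ≤ 1 / 2 * |x - y| := by
    rw [← mul_assoc]
    apply mul_le_mul_of_nonneg_right _ (abs_nonneg _)
    rw [mul_one_div, div_le_div_iff₀ (by positivity) (by positivity)]; linarith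
  have h5 := mul_le_mul_of_nonneg_left h1 hQ
  have h6 := mul_le_mul_of_nonneg_left h3 hQ
  have h7 := mul_nonneg (mul_nonneg hQ hC) (abs_nonneg (f x + g x - (f y + g y)))
  nlinarith

lemma QuasiIsometry.add_slow {f g : ℝ → ℝ} (hf : QuasiIsometry f) (hg : Slow g) :
    QuasiIsometry (fun x => f x + g x) :=
  ⟨hf.1.add hg.coarseLipschitz, hf.2.add_slow hg⟩

lemma quasiIsometry_id : QuasiIsometry (fun x => x) := by
  simpa using quasiIsometry_mul one_pos

lemma QuasiIsometry.of_near {f g : ℝ → ℝ} (hf : QuasiIsometry f) {C : ℝ}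
    (h : ∀ x, |g x - f x| ≤ C) : QuasiIsometry g :=
  ⟨hf.1.of_near h, hf.2.of_near h⟩

/-! ### Order automorphisms of the line near given functions -/

lemma exists_orderIso_eq {f : ℝ → ℝ} (hm : StrictMono f) (hc : Continuous f)
    (htop : ∀ M, ∃ x, M ≤ f x) (hbot : ∀ M, ∃ x, f x ≤ M) : ∃ ρ : ℝ ≃o ℝ, ∀ x, ρ x = f x :=
  ⟨hm.orderIsoOfSurjective f (hc.surjective (tendsto_atTop_atTop_of_monotone hm.monotone htop)
    (tendsto_atBot_atBot_of_monotone hm.monotone hbot)), fun _ => rfl⟩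

lemma exists_orderIso_add (f g : ℝ ≃o ℝ) : ∃ ρ : ℝ ≃o ℝ, ∀ x, ρ x = f x + g x := by
  refine exists_orderIso_eq (fun x y h => add_lt_add (f.strictMono h) (g.strictMono h))
    (f.continuous.add g.continuous) (fun M => ?_) (fun M => ?_)
  · refine ⟨max (f.symm M) (g.symm 0), ?_⟩
    have h1 := f.monotone (le_max_left (f.symm M) (g.symm 0))
    have h2 := g.monotone (le_max_right (f.symm M) (g.symm 0))
    simp only [OrderIso.apply_symm_apply] at h1 h2; linarith
  · refine ⟨min (f.symm M) (g.symm 0), ?_⟩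
    have h1 := f.monotone (min_le_left (f.symm M) (g.symm 0))
    have h2 := g.monotone (min_le_right (f.symm M) (g.symm 0))
    simp only [OrderIso.apply_symm_apply] at h1 h2; linarith

lemma exists_orderIso_id_add (ρ : ℝ ≃o ℝ) : ∃ η : ℝ ≃o ℝ, ∀ x, η x = x + ρ x :=
  exists_orderIso_add (OrderIso.refl ℝ) ρ

/-- A coarsely increasing unbounded function lies at bounded distance from an order automorphism:
average its running supremum over unit intervals. -/
lemma exists_orderIso_near {u : ℝ → ℝ} {C : ℝ} (hu : ∀ x y, x ≤ y → u x ≤ u y + C)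
    (hu1 : ∀ x, u (x + 1) ≤ u x + C) (htop : ∀ M, ∃ x, M ≤ u x) (hbot : ∀ M, ∃ x, u x ≤ M) :
    ∃ (ρ : ℝ ≃o ℝ) (D : ℝ), ∀ x, |ρ x - u x| ≤ D := by
  set V : ℝ → ℝ := fun x => sSup (u '' Set.Iic x) with hV
  have hbdd : ∀ x, BddAbove (u '' Set.Iic x) := fun x =>
    ⟨u x + C, by rintro _ ⟨y, hy, rfl⟩; exact hu y x hy⟩
  have hV1 : ∀ x, u x ≤ V x := fun x => le_csSup (hbdd x) ⟨x, Set.mem_Iic.2 le_rfl, rfl⟩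
  have hV2 : ∀ x, V x ≤ u x + C := fun x =>
    csSup_le ⟨_, x, Set.mem_Iic.2 le_rfl, rfl⟩ (by rintro _ ⟨y, hy, rfl⟩; exact hu y x hy)
  have hVm : Monotone V := fun x y h =>
    csSup_le_csSup (hbdd y) ⟨_, x, Set.mem_Iic.2 le_rfl, rfl⟩
      (Set.image_mono (Set.Iic_subset_Iic.2 h))
  have hint : ∀ a b, IntervalIntegrable V volume a b := fun a b => hVm.intervalIntegrable
  set v : ℝ → ℝ := fun x => ∫ t in x..(x + 1), V t with hv
  have hv' : ∀ x, v x = (∫ t in (0 : ℝ)..(x + 1), V t) - ∫ t in (0 : ℝ)..x, V t := fun x =>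
    (intervalIntegral.integral_interval_sub_left (hint _ _) (hint _ _)).symm
  have hvc : Continuous v := by
    have := intervalIntegral.continuous_primitive hint 0
    rw [show v = _ from funext hv']
    exact (this.comp (continuous_add_const 1)).sub this
  have hvm : Monotone v := by
    intro x y h
    have e : ∀ z, v z = ∫ t in (0 : ℝ)..1, V (t + z) := fun z => by
      rw [intervalIntegral.integral_comp_add_right, zero_add, add_comm 1 z]
    rw [e x, e y]
    refine intervalIntegral.integral_mono_on zero_le_one ?_ ?_ fun t _ => hVm (by linarith)
    · exact Monotone.intervalIntegrable fun a b hab => hVm (by linarith)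
    · exact Monotone.intervalIntegrable fun a b hab => hVm (by linarith)
  have hv1 : ∀ x, V x ≤ v x := fun x => by
    have := intervalIntegral.integral_mono_on (show x ≤ x + 1 by linarith)
      (intervalIntegrable_const (c := V x) (μ := volume)) (hint x (x + 1)) (fun t ht => hVm ht.1)
    simpa using this
  have hv2 : ∀ x, v x ≤ V (x + 1) := fun x => by
    have := intervalIntegral.integral_mono_on (show x ≤ x + 1 by linarith)
      (hint x (x + 1)) (intervalIntegrable_const (c := V (x + 1)) (μ := volume))
      (fun t ht => hVm ht.2)
    simpa using this
  -- adding `arctan` makes the monotone function strictly monotone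
  have ha : ∀ x, |Real.arctan x| ≤ 2 := fun x => by
    rw [abs_le]
    have h1 := Real.neg_pi_div_two_lt_arctan x
    have h2 := Real.arctan_lt_pi_div_two x
    have h3 := Real.pi_lt_four
    constructor <;> linarith
  obtain ⟨ρ, hρ⟩ := exists_orderIso_eq (f := fun x => v x + Real.arctan x)
    (fun x y h => add_lt_add_of_le_of_lt (hvm h.le) (Real.arctan_strictMono h))
    (hvc.add Real.continuous_arctan)
    (fun M => by
      obtain ⟨x, hx⟩ := htop (M + 2)
      exact ⟨x, by linarith [hV1 x, hv1 x, (abs_le.1 (ha x)).1]⟩)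
    (fun M => by
      obtain ⟨x, hx⟩ := hbot (M - 2 - 2 * C)
      exact ⟨x, by linarith [hv2 x, hV2 (x + 1), hu1 x, (abs_le.1 (ha x)).2]⟩)
  have hC : 0 ≤ C := by linarith [hu 0 0 le_rfl]
  refine ⟨ρ, 2 * C + 2, fun x => ?_⟩
  rw [hρ, abs_le]
  have := abs_le.1 (ha x)
  constructor
  · linarith [hV1 x, hv1 x]
  · linarith [hv2 x, hV2 (x + 1), hu1 x]

/-! ### Controlling slow functions by slow automorphisms -/

/-- The variation of a slow function is controlled by the increments of a slow increasing function.
With `q` as in the definition of slowness, made positive by adding `exp (-|k|)`, the density of the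
latter at `k` is `1 / max 1 (log (1 / q k))`: this is large along every interval on which `f` varies appreciably, but rarely large. -/
lemma Slow.exists_monotone_control {f : ℝ → ℝ} (hf : Slow f) :
    ∃ ω : ℝ → ℝ, Monotone ω ∧ Continuous ω ∧ Slow ω ∧
      ∃ C, 0 ≤ C ∧ ∀ x y, x ≤ y → |f y - f x| ≤ C * (ω y - ω x) + C := by
  obtain ⟨N, B, q, hN, hB, hq, h⟩ := hf.2
  obtain ⟨C₁, hC₁, hlip⟩ := hf.sublinear one_pos
  set r' : ℤ → ℝ≥0∞ := fun k => q k + nexp (-(1 * |(k : ℝ)|)) with hr'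
  have hr'sum : ∑' k, r' k ≠ ∞ := by
    rw [ENNReal.tsum_add]; exact ENNReal.add_ne_top.2 ⟨hq, tsum_nexp_ne_top one_pos⟩
  have hr'top : ∀ k, r' k ≠ ∞ := fun k => ENNReal.ne_top_of_tsum_ne_top hr'sum k
  set r : ℤ → ℝ := fun k => (r' k).toReal with hr
  have hrpos : ∀ k, 0 < r k := fun k => ENNReal.toReal_pos (by simp [hr']) (hr'top k)
  have hcoe : ∀ (k : ℤ) (a : ℝ), (nexp a : ℝ≥0∞) ≤ r' k ↔ a ≤ Real.log (r k) := fun k a => by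
    rw [Real.le_log_iff_exp_le (hrpos k), ← coe_nexp, hr, ← ENNReal.coe_toReal,
      ENNReal.toReal_le_toReal ENNReal.coe_ne_top (hr'top k)]
  set p : ℝ → ℝ := fun t => 1 / max 1 (-Real.log (r ⌊t⌋)) with hp
  have hp0 : ∀ t, 0 ≤ p t := fun t => by positivity
  have hp1 : ∀ t, p t ≤ 1 := fun t => by
    rw [hp]; exact (div_le_one (by positivity)).2 (le_max_left _ _)
  have hpm : Measurable p :=
    (measurable_from_top (f := fun k : ℤ => 1 / max 1 (-Real.log (r k)))).comp Int.measurable_floor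
  have hint : ∀ a b, IntervalIntegrable p volume a b := fun a b =>
    (intervalIntegrable_const (c := (1 : ℝ))).mono_fun' hpm.aestronglyMeasurable
      (Eventually.of_forall fun t => (Real.norm_of_nonneg (hp0 t)).trans_le (hp1 t))
  set ω : ℝ → ℝ := fun x => ∫ t in (0 : ℝ)..x, p t with hω
  have hωsub : ∀ x y, ω y - ω x = ∫ t in x..y, p t := fun x y =>
    intervalIntegral.integral_interval_sub_left (hint _ _) (hint _ _)
  have hωm : Monotone ω := fun x y hxy => by
    have := intervalIntegral.integral_nonneg (μ := volume) hxy fun t _ => hp0 t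
    rw [← hωsub] at this; linarith
  have hωc : Continuous ω := intervalIntegral.continuous_primitive hint 0
  refine ⟨ω, hωm, hωc, Slow.of_continuous hωc
    ⟨2, 2, fun n => nexp 4 * expConv 1 r' n, two_pos.le, two_pos, ?_, ?_⟩, ?_⟩
  · rw [ENNReal.tsum_mul_left]
    exact ENNReal.mul_ne_top ENNReal.coe_ne_top (tsum_expConv_ne_top one_pos hr'sum)
  · intro n x hx
    -- if `ω` changes by more than `2`, the density exceeds its mean value somewhere on the way
    obtain ⟨t, ht, htp⟩ : ∃ t ∈ Set.uIoc (n : ℝ) x, 2 < p t * |x - n| := by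
      by_contra! hc
      have hT : 0 < |x - n| := by
        rw [abs_pos]; intro h0
        rw [sub_eq_zero.1 h0, sub_self, abs_zero] at hx; linarith
      have := intervalIntegral.norm_integral_le_of_norm_le_const (a := (n : ℝ)) (b := x) (f := p)
        (C := 2 / |x - n|) (fun t ht => by
          rw [Real.norm_of_nonneg (hp0 t), le_div_iff₀ hT]; exact hc t ht)
      rw [← hωsub, div_mul_cancel₀ _ hT.ne', Real.norm_eq_abs] at this
      linarith
    have hT0 : 0 ≤ |x - n| := abs_nonneg _
    have hlog : -Real.log (r ⌊t⌋) ≤ |x - n| := by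
      have h1 : 0 < max 1 (-Real.log (r ⌊t⌋)) := by positivity
      rw [hp] at htp
      simp only at htp
      rw [one_div, inv_mul_eq_div, lt_div_iff₀ h1] at htp
      nlinarith [le_max_right 1 (-Real.log (r ⌊t⌋))]
    have htn : |(⌊t⌋ : ℝ) - n| ≤ |x - n| + 1 := by
      have h1 := Int.floor_le t
      have h2 := Int.lt_floor_add_one t
      rw [Set.mem_uIoc] at ht
      have h3 := le_abs_self (x - n)
      have h4 := neg_abs_le (x - n)
      rw [abs_le]
      rcases ht with ht | ht <;> constructor <;> linarith
    have h1 : (nexp (-|x - n|) : ℝ≥0∞) ≤ r' ⌊t⌋ := (hcoe _ _).2 (by linarith)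
    refine le_trans ?_ (mul_le_mul_right (le_expConv 1 r' n ⌊t⌋) _)
    rw [← mul_assoc, ← ENNReal.coe_mul, ← nexp_add]
    exact nexp_le_mul h1 (by linarith)
  · -- intervals over which `ω` grows by less than `c` are short or carry little variation of `f`
    set c : ℝ := 1 / (1 + 2 * B) with hc
    have hc0 : 0 < c := by positivity
    set K : ℝ := 2 * N + (1 + C₁) with hK
    have hK0 : 0 ≤ K := by positivity
    have hstep : ∀ x y, x ≤ y → ω y - ω x < c → |f y - f x| ≤ K := by
      intro x y hxy hlt
      rcases le_or_gt (y - x) 1 with hT | hT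
      · have := hlip y x
        rw [abs_of_nonneg (sub_nonneg.2 hxy)] at this
        linarith
      by_contra! hbig
      have hbig : 2 * N < |f y - f x| := by linarith
      -- as `f` changes by more than `2N` between `x` and `y`, it does so by more than `N` between
      -- any integer in between and one of the ends
      have hplow : ∀ t ∈ Set.Icc x y, 1 / (1 + B * (y - x + 1)) ≤ p t := by
        intro t ht
        have h1 := Int.floor_le t
        have h2 := Int.lt_floor_add_one t
        have hq1 : (nexp (-(B * (y - x + 1))) : ℝ≥0∞) ≤ r' ⌊t⌋ := by
          refine le_trans ?_ (le_self_add (a := q ⌊t⌋))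
          have h3 := abs_sub_le (f y) (f ⌊t⌋) (f x)
          rw [abs_sub_comm (f ⌊t⌋)] at h3
          rcases lt_or_ge N |f y - f ⌊t⌋| with h4 | h4
          · refine (ENNReal.coe_le_coe.2 (nexp_le_nexp.2 ?_)).trans (h _ _ h4)
            have : |y - ⌊t⌋| ≤ y - x + 1 := by
              rw [abs_le]; constructor <;> linarith [ht.1, ht.2]
            nlinarith
          · refine (ENNReal.coe_le_coe.2 (nexp_le_nexp.2 ?_)).trans (h ⌊t⌋ x (by linarith))
            have : |x - ⌊t⌋| ≤ y - x + 1 := by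
              rw [abs_le]; constructor <;> linarith [ht.1, ht.2]
            nlinarith
        rw [hcoe] at hq1
        apply one_div_le_one_div_of_le (by positivity)
        refine max_le ?_ ?_
        · nlinarith
        · linarith
      have hge := intervalIntegral.integral_mono_on hxy
        (intervalIntegrable_const (c := 1 / (1 + B * (y - x + 1))) (μ := volume)) (hint x y) hplow
      rw [← hωsub, intervalIntegral.integral_const, smul_eq_mul, mul_one_div] at hge
      have : c ≤ (y - x) / (1 + B * (y - x + 1)) := by
        rw [hc, div_le_div_iff₀ (by positivity) (by nlinarith)]
        nlinarith
      linarith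
    have hmany : ∀ j : ℕ, ∀ x y, x ≤ y → ω y - ω x < (j + 1) * c →
        |f y - f x| ≤ (j + 1) * K := by
      intro j
      induction j with
      | zero => intro x y hxy hlt; simpa using hstep x y hxy (by simpa using hlt)
      | succ j ih =>
        intro x y hxy hlt
        have hD : 0 ≤ ω y - ω x := sub_nonneg.2 (hωm hxy)
        push_cast at hlt ⊢
        have hj : (0 : ℝ) < j + 1 + 1 := by positivity
        have e1 : (ω y - ω x) / (j + 1 + 1) < c := by rw [div_lt_iff₀ hj]; linarith
        have e2 : (ω y - ω x) / (j + 1 + 1) * (j + 1 + 1) = ω y - ω x := div_mul_cancel₀ _ hj.ne'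
        have e3 : 0 ≤ (ω y - ω x) / (j + 1 + 1) := by positivity
        obtain ⟨z, hz, hzω⟩ := intermediate_value_Icc hxy hωc.continuousOn
          (show ω x + (ω y - ω x) / (j + 1 + 1) ∈ Set.Icc (ω x) (ω y) from
            ⟨by linarith, by nlinarith⟩)
        have h1 := hstep x z hz.1 (by linarith)
        have h2 := ih z y hz.2 (by nlinarith)
        have h3 := abs_sub_le (f y) (f z) (f x)
        linarith
    refine ⟨K / c + K, by positivity, fun x y hxy => ?_⟩
    have hD : 0 ≤ ω y - ω x := sub_nonneg.2 (hωm hxy)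
    have h1 := hmany ⌊(ω y - ω x) / c⌋₊ x y hxy (by
      have := Nat.lt_floor_add_one ((ω y - ω x) / c)
      rwa [div_lt_iff₀ hc0] at this)
    have h2 := Nat.floor_le (div_nonneg hD hc0.le)
    have h3 : (ω y - ω x) / c * K = K / c * (ω y - ω x) := by ring
    have h4 : 0 ≤ K / c := by positivity
    nlinarith [mul_le_mul_of_nonneg_right h2 hK0, mul_nonneg hK0 hD]

/-- An unbounded slow automorphism; it behaves like `± log |x|` at infinity. -/
lemma slow_arsinh : Slow Real.arsinh := by
  refine Slow.of_continuous Real.continuous_arsinh ⟨1, 2, fun n => nexp (-(1 * |(n : ℝ)|)),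
    one_pos.le, two_pos, tsum_nexp_ne_top one_pos, fun n x hx => ?_⟩
  refine ENNReal.coe_le_coe.2 (nexp_le_nexp.2 ?_)
  by_contra! hT
  set T := |x - n| with hTdef
  have hT0 : 0 ≤ T := abs_nonneg _
  have hTn : 2 * T < |(n : ℝ)| := by linarith
  -- on the interval between `n` and `x` the derivative of `arsinh` is at most `1 / T`
  have hmem : ∀ z ∈ Set.uIcc (n : ℝ) x, T ≤ |z| := by
    intro z hz
    have h1 : |z - n| ≤ T := by
      rw [Set.mem_uIcc] at hz
      have h3 := le_abs_self (x - n)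
      have h4 := neg_abs_le (x - n)
      rw [abs_le]
      rcases hz with hz | hz <;> constructor <;> linarith
    have h2 := abs_add_le (n - z) z
    rw [sub_add_cancel, abs_sub_comm] at h2
    linarith
  have hbound : ∀ z ∈ Set.uIcc (n : ℝ) x, ‖(√(1 + z ^ 2))⁻¹‖ ≤ 1 / (max T 1) := by
    intro z hz
    rw [Real.norm_of_nonneg (by positivity), inv_eq_one_div]
    apply one_div_le_one_div_of_le (by positivity)
    apply Real.le_sqrt_of_sq_le
    have h1 := hmem z hz
    have h2 : T ^ 2 ≤ z ^ 2 := by rw [← sq_abs z]; gcongr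
    rcases max_cases T 1 with ⟨e, _⟩ | ⟨e, _⟩ <;> rw [e] <;> nlinarith [sq_nonneg z]
  have := (convex_uIcc (n : ℝ) x).norm_image_sub_le_of_norm_hasDerivWithin_le
    (fun z _ => (Real.hasDerivAt_arsinh z).hasDerivWithinAt) hbound Set.left_mem_uIcc
    Set.right_mem_uIcc
  rw [Real.norm_eq_abs, Real.norm_eq_abs, ← hTdef] at this
  have h2 : 1 / max T 1 * T ≤ 1 := by
    rw [one_div, inv_mul_eq_div]; exact (div_le_one (by positivity)).2 (le_max_left _ _)
  linarith

/-- A slow function differs from a slow automorphism by the negative of a slow automorphism, up to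
a bounded error. -/
lemma Slow.exists_orderIso_control {f : ℝ → ℝ} (hf : Slow f) :
    ∃ ω ρ : ℝ ≃o ℝ, Slow ω ∧ Slow ρ ∧ ∃ D : ℝ, ∀ x, |ρ x - (f x + ω x)| ≤ D := by
  obtain ⟨ω₀, hm, hc, hs, C, hC, hctl⟩ := hf.exists_monotone_control
  have hsA := slow_arsinh
  -- the multiple of `ω₀` absorbs the variation of `f`, and `arsinh` makes both `ω` and `f + ω`
  -- unbounded in both directions
  obtain ⟨ω, hω⟩ := exists_orderIso_eq (f := fun x => (C + 1) * ω₀ x + 2 * Real.arsinh x)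
    (fun x y h => add_lt_add_of_le_of_lt
      (mul_le_mul_of_nonneg_left (hm h.le) (by positivity))
      (by linarith [Real.arsinh_strictMono h]))
    ((hc.const_mul _).add (Real.continuous_arsinh.const_mul 2))
    (fun M => by
      obtain ⟨x, hx⟩ := Real.arsinh_surjective (max 0 (M - (C + 1) * ω₀ 0))
      have hx0 : 0 ≤ x := by
        rw [← Real.arsinh_nonneg_iff, hx]; exact le_max_left _ _
      refine ⟨x, ?_⟩
      have h1 := mul_le_mul_of_nonneg_left (hm hx0) (show 0 ≤ C + 1 by positivity)
      have h2 := le_max_right 0 (M - (C + 1) * ω₀ 0)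
      have h3 := le_max_left 0 (M - (C + 1) * ω₀ 0)
      rw [hx]; linarith)
    (fun M => by
      obtain ⟨x, hx⟩ := Real.arsinh_surjective (min 0 (M - (C + 1) * ω₀ 0))
      have hx0 : x ≤ 0 := by
        rw [← Real.arsinh_nonpos_iff, hx]; exact min_le_left _ _
      refine ⟨x, ?_⟩
      have h1 := mul_le_mul_of_nonneg_left (hm hx0) (show 0 ≤ C + 1 by positivity)
      have h2 := min_le_right 0 (M - (C + 1) * ω₀ 0)
      have h3 := min_le_left 0 (M - (C + 1) * ω₀ 0)
      rw [hx]; linarith)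
  have hωs : Slow ω := by
    have := (hs.const_mul (show 0 < C + 1 by positivity)).add (hsA.const_mul two_pos)
    rwa [show (ω : ℝ → ℝ) = _ from funext hω]
  have hsum := hf.add hωs
  obtain ⟨C₁, hC₁, hlip⟩ := hsum.sublinear one_pos
  have hvar : ∀ x y, x ≤ y →
      f x + ω x + (Real.arsinh y - Real.arsinh x) ≤ f y + ω y + C := by
    intro x y hxy
    have h1 := (abs_le.1 (hctl x y hxy)).1
    have h2 := hm hxy
    have h3 := Real.arsinh_strictMono.monotone hxy
    rw [hω, hω]; linarith
  obtain ⟨ρ, D, hρ⟩ := exists_orderIso_near (u := fun x => f x + ω x) (C := max C (1 + C₁))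
    (fun x y hxy => by
      have h1 := hvar x y hxy
      have h3 := Real.arsinh_strictMono.monotone hxy
      linarith [le_max_left C (1 + C₁)])
    (fun x => by
      have h1 := (abs_le.1 (hlip (x + 1) x)).2
      simp only [add_sub_cancel_left, abs_one] at h1
      linarith [le_max_right C (1 + C₁)])
    (fun M => by
      obtain ⟨y, hy⟩ := Real.arsinh_surjective (max 0 (M - f 0 - ω 0 + C))
      have hy0 : 0 ≤ y := by
        rw [← Real.arsinh_nonneg_iff, hy]; exact le_max_left _ _
      have := hvar 0 y hy0
      rw [hy, Real.arsinh_zero] at this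
      exact ⟨y, by linarith [le_max_right 0 (M - f 0 - ω 0 + C)]⟩)
    (fun M => by
      obtain ⟨y, hy⟩ := Real.arsinh_surjective (min 0 (M - f 0 - ω 0 - C))
      have hy0 : y ≤ 0 := by
        rw [← Real.arsinh_nonpos_iff, hy]; exact min_le_left _ _
      have := hvar y 0 hy0
      rw [hy, Real.arsinh_zero] at this
      exact ⟨y, by linarith [min_le_right 0 (M - f 0 - ω 0 - C)]⟩)
  exact ⟨ω, ρ, hωs, hsum.of_near hρ, D, hρ⟩

/-- The identity plus a slow function is at bounded distance from an order automorphism. -/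
lemma Slow.exists_orderIso_near_id_add {f : ℝ → ℝ} (hf : Slow f) :
    ∃ (ρ : ℝ ≃o ℝ) (D : ℝ), ∀ x, |ρ x - (x + f x)| ≤ D := by
  obtain ⟨C, hC, h⟩ := hf.sublinear (show (0 : ℝ) < 1 / 2 by norm_num)
  refine exists_orderIso_near (C := C + 2) (fun x y hxy => ?_) (fun x => ?_) (fun M => ?_)
    (fun M => ?_)
  · have h1 := (abs_le.1 (h x y)).2
    rw [abs_sub_comm, abs_of_nonneg (sub_nonneg.2 hxy)] at h1
    linarith
  · have h1 := (abs_le.1 (h (x + 1) x)).2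
    simp only [add_sub_cancel_left, abs_one] at h1
    linarith
  · refine ⟨2 * |M - f 0 + C|, ?_⟩
    have h1 := (abs_le.1 (h (2 * |M - f 0 + C|) 0)).1
    rw [sub_zero, abs_of_nonneg (by positivity)] at h1
    linarith [le_abs_self (M - f 0 + C)]
  · refine ⟨-(2 * |M - f 0 - C|), ?_⟩
    have h1 := (abs_le.1 (h (-(2 * |M - f 0 - C|)) 0)).2
    rw [sub_zero, abs_neg (2 * |M - f 0 - C|),
      abs_of_nonneg (show 0 ≤ 2 * |M - f 0 - C| by positivity)] at h1
    linarith [neg_abs_le (M - f 0 - C)]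

/-! ### Integral characterization of slow automorphisms -/

lemma pairwise_disjoint_unit_Ico :
    Pairwise (Function.onFun Disjoint fun n : ℤ => Set.Ico (n : ℝ) (n + 1)) := by
  simpa using Set.pairwise_disjoint_Ico_intCast ℝ

lemma lintegral_eq_tsum_unit (F : ℝ → ℝ≥0∞) :
    ∫⁻ x, F x = ∑' n : ℤ, ∫⁻ x in Set.Ico (n : ℝ) (n + 1), F x := by
  rw [← lintegral_iUnion (fun _ => measurableSet_Ico) pairwise_disjoint_unit_Ico,
    iUnion_Ico_intCast, setLIntegral_univ]

/-- If `τ` moves every point far enough to change a slow function `f` by a large constant, then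
`exp (-|τ x - x|)` has integral at most `1`: on each unit interval `[n, n + 1)` it is a small multiple
of the summable bound `q n`. -/
lemma Slow.lintegral_gap_le {f : ℝ → ℝ} (hf : Slow f) :
    ∃ γ₀ : ℝ, 0 < γ₀ ∧ ∀ τ : ℝ → ℝ, (∀ x, γ₀ ≤ |f (τ x) - f x|) →
      ∫⁻ x, (nexp (-|τ x - x|) : ℝ≥0∞) ≤ 1 := by
  obtain ⟨N, q, hN, hq, h⟩ := hf.exists_small (show (0 : ℝ) < 1 / 2 by norm_num)
  obtain ⟨C, hC, hlip⟩ := hf.sublinear one_pos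
  obtain ⟨κ, hκ0, hκ⟩ : ∃ κ : ℝ, 0 ≤ κ ∧ ∑' n, q n ≤ nexp κ := by
    refine ⟨(∑' n, q n).toReal, ENNReal.toReal_nonneg, ?_⟩
    rw [← ENNReal.toReal_le_toReal hq ENNReal.coe_ne_top]
    have := Real.add_one_le_exp (∑' n, q n).toReal
    rw [ENNReal.coe_toReal, coe_nexp]; linarith
  refine ⟨N + 2 + 2 * C + 1 + 2 * κ, by positivity, fun τ hτ => ?_⟩
  have hpt : ∀ n : ℤ, ∀ x ∈ Set.Ico (n : ℝ) (n + 1),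
      (nexp (-|τ x - x|) : ℝ≥0∞) ≤ nexp (-κ) * q n := by
    intro n x hx
    have hxn : |x - n| ≤ 1 := by rw [abs_le]; constructor <;> linarith [hx.1, hx.2]
    have h1 := hτ x
    have h2 := hlip x n
    have h3 := abs_sub_le (f (τ x)) (f n) (f x)
    rw [abs_sub_comm (f n)] at h3
    have h4 := hlip (τ x) x
    have h5 := h n (τ x) (by linarith)
    have h6 := abs_sub_le (τ x) x n
    exact nexp_le_mul h5 (by linarith)
  rw [lintegral_eq_tsum_unit]
  calc ∑' n : ℤ, ∫⁻ x in Set.Ico (n : ℝ) (n + 1), (nexp (-|τ x - x|) : ℝ≥0∞)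
      ≤ ∑' n : ℤ, nexp (-κ) * q n := by
        refine ENNReal.tsum_le_tsum fun n => ?_
        refine (setLIntegral_mono' measurableSet_Ico (hpt n)).trans ?_
        simp
    _ ≤ nexp (-κ) * nexp κ := by rw [ENNReal.tsum_mul_left]; gcongr
    _ = 1 := by rw [← ENNReal.coe_mul, ← nexp_add]; simp

/-- An automorphism is slow if the distances over which it grows by `γ` are exponentially large in
the mean. -/
lemma slow_of_lintegral_forward_gap {ρ : ℝ ≃o ℝ} {γ : ℝ} (hγ : 0 < γ)
    (h : ∫⁻ x, (nexp (-|ρ.symm (ρ x + γ) - x|) : ℝ≥0∞) ≠ ∞) : Slow ρ := by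
  rw [lintegral_eq_tsum_unit] at h
  set r : ℤ → ℝ≥0∞ := fun k =>
    ∫⁻ x in Set.Ico (k : ℝ) (k + 1), (nexp (-|ρ.symm (ρ x + γ) - x|) : ℝ≥0∞) with hr
  refine Slow.of_continuous ρ.continuous ⟨γ, 2, fun n => nexp 4 * expConv 1 r n, hγ.le, two_pos,
    ?_, fun n x hx => ?_⟩
  · rw [ENNReal.tsum_mul_left]
    exact ENNReal.mul_ne_top ENNReal.coe_ne_top (tsum_expConv_ne_top one_pos h)
  -- if `ρ` grows by more than `γ` from `a` to `b`, then the gaps at the points of the unit interval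
  -- ending at `⌊a⌋` are at most `b - a + 2`
  have key : ∀ a b : ℝ, ρ a + γ < ρ b →
      (nexp (-(b - a + 2)) : ℝ≥0∞) ≤ r (⌊a⌋ - 1) := by
    intro a b hab
    have h1 := Int.floor_le a
    have h2 := Int.lt_floor_add_one a
    calc (nexp (-(b - a + 2)) : ℝ≥0∞)
        = ∫⁻ _x in Set.Ico ((⌊a⌋ - 1 : ℤ) : ℝ) ((⌊a⌋ - 1 : ℤ) + 1),
            (nexp (-(b - a + 2)) : ℝ≥0∞) := by simp
      _ ≤ _ := by
        refine setLIntegral_mono' measurableSet_Ico fun t ht => ?_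
        refine ENNReal.coe_le_coe.2 (nexp_le_nexp.2 ?_)
        push_cast at ht
        have h3 : t ≤ ρ.symm (ρ t + γ) := by rw [OrderIso.le_symm_apply]; linarith
        have h4 : ρ.symm (ρ t + γ) < b := by
          rw [OrderIso.symm_apply_lt]
          have := ρ.monotone (show t ≤ a by linarith [ht.2])
          linarith
        rw [abs_of_nonneg (by linarith)]
        linarith [ht.1]
  -- either `x` lies to the right of `n`, or `n` lies to the right of `x`
  have fin : ∀ a : ℝ, |a - n| ≤ |x - n| → (nexp (-(|x - n| + 2)) : ℝ≥0∞) ≤ r (⌊a⌋ - 1) →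
      (nexp (-(2 * |x - n|)) : ℝ≥0∞) ≤ nexp 4 * expConv 1 r n := by
    intro a ha hle
    refine le_trans ?_ (mul_le_mul_right (le_expConv 1 r n (⌊a⌋ - 1)) _)
    rw [← mul_assoc, ← ENNReal.coe_mul, ← nexp_add]
    refine nexp_le_mul hle ?_
    have h1 := Int.floor_le a
    have h2 := Int.lt_floor_add_one a
    have : |((⌊a⌋ - 1 : ℤ) : ℝ) - n| ≤ |a - n| + 2 := by
      push_cast
      have h3 := le_abs_self (a - n)
      have h4 := neg_abs_le (a - n)
      rw [abs_le]; constructor <;> linarith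
    linarith
  rcases lt_abs.1 hx with hx | hx
  · have hnx : (n : ℝ) ≤ x := by
      by_contra! hc
      linarith [ρ.strictMono hc]
    have := key n x (by linarith)
    refine fin n (by simp) ?_
    rwa [abs_of_nonneg (sub_nonneg.2 hnx)]
  · have hnx : x ≤ n := by
      by_contra! hc
      linarith [ρ.strictMono hc]
    have := key x n (by linarith)
    refine fin x le_rfl ?_
    rwa [abs_sub_comm, abs_of_nonneg (sub_nonneg.2 hnx)]

/-- The mirror image of `slow_of_lintegral_forward_gap` under `x ↦ -x`. -/
lemma slow_of_lintegral_backward_gap {ρ : ℝ ≃o ℝ} {γ : ℝ} (hγ : 0 < γ)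
    (h : ∫⁻ x, (nexp (-|ρ.symm (ρ x - γ) - x|) : ℝ≥0∞) ≠ ∞) : Slow ρ := by
  obtain ⟨σ, hσ⟩ := exists_orderIso_eq (f := fun x => -ρ (-x))
    (fun x y hxy => neg_lt_neg (ρ.strictMono (neg_lt_neg hxy)))
    (ρ.continuous.comp continuous_neg).neg
    (fun M => ⟨-ρ.symm (-M), by simp⟩) (fun M => ⟨-ρ.symm (-M), by simp⟩)
  have hsymm : ∀ y, σ.symm y = -ρ.symm (-y) := fun y => by
    rw [OrderIso.symm_apply_eq, hσ]; simp
  have hs : Slow σ := by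
    refine slow_of_lintegral_forward_gap hγ ?_
    rw [← lintegral_neg_eq_self]
    convert h using 4 with x
    rw [hsymm, hσ, neg_neg, show -(-ρ x + γ) = ρ x - γ by ring,
      show ∀ z : ℝ, -z - -x = -(z - x) by intro z; ring, abs_neg]
  have := (hs.comp quasiIsometry_neg).neg
  simpa [hσ] using this

/-! ### Counting characterization of slow functions -/

/-- A function is slow if, for every step `m`, it changes by more than a constant over that step at
only exponentially many integers. The hypothesis `hloc` controls the values between integers. -/
lemma slow_of_count {f : ℝ → ℝ} (hbdd : ∀ R : ℝ, ∃ M : ℝ, ∀ x, |x| ≤ R → |f x| ≤ M)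
    {N M : ℝ} (hN : 0 ≤ N) {b : ℝ≥0} (hb : 1 < b)
    (hcount : ∀ m : ℕ, 1 ≤ m → CardLT {n : ℤ | N < |f ((n : ℝ) + m) - f n|} (b ^ m))
    (hloc : {n : ℤ | ∃ x ∈ Set.Icc (n : ℝ) (n + 1), M < |f x - f n|}.Finite) : Slow f := by
  classical
  refine ⟨hbdd, ?_⟩
  obtain ⟨M', hM'0, hM'⟩ : ∃ M' : ℝ, 0 ≤ M' ∧
      ∀ n : ℤ, ∀ x ∈ Set.Icc (n : ℝ) (n + 1), |f x - f n| ≤ M' := by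
    choose B hB using hbdd
    refine ⟨|M| + ∑ n ∈ hloc.toFinset, 2 * |B (|(n : ℝ)| + 1)|, by positivity, fun n x hx => ?_⟩
    by_cases hn : ∃ x ∈ Set.Icc (n : ℝ) (n + 1), M < |f x - f n|
    · have h1 := hB (|(n : ℝ)| + 1) x (by
        have h1 := le_abs_self (n : ℝ)
        have h2 := neg_abs_le (n : ℝ)
        rw [abs_le]; constructor <;> linarith [hx.1, hx.2])
      have h2 := hB (|(n : ℝ)| + 1) n (by linarith)
      have h3 := abs_sub (f x) (f n)
      have h4 := le_abs_self (B (|(n : ℝ)| + 1))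
      have h5 := Finset.single_le_sum (f := fun n : ℤ => 2 * |B (|(n : ℝ)| + 1)|)
        (fun i _ => by positivity) (hloc.mem_toFinset.2 hn)
      linarith [abs_nonneg M]
    · push Not at hn
      have h1 := hn x hx
      have : 0 ≤ ∑ n ∈ hloc.toFinset, 2 * |B (|(n : ℝ)| + 1)| := by positivity
      linarith [le_abs_self M]
  set β := Real.log b with hβ
  have hβ0 : 0 < β := Real.log_pos (by exact_mod_cast hb)
  have hbβ : b = nexp β := (nexp_log (one_pos.trans hb)).symm
  set E : ℕ → Set ℤ := fun m => {n : ℤ | N < |f ((n : ℝ) + (m + 1 : ℕ)) - f n|} with hE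
  -- an exceptional integer for the step `m` receives the weight `exp (-(β + 1) m)`
  set q : ℤ → ℝ≥0∞ := fun n => ∑' m : ℕ,
    if n ∈ E m then (nexp (-((β + 1) * (m + 1 : ℕ))) : ℝ≥0∞) else 0 with hq
  have hqsum : ∑' n, q n ≠ ∞ := by
    rw [hq, ENNReal.tsum_comm]
    have hb : ∀ m : ℕ, ∑' n : ℤ, (if n ∈ E m then
        (nexp (-((β + 1) * (m + 1 : ℕ))) : ℝ≥0∞) else 0) ≤ nexp (-(1 * |((m : ℤ) : ℝ)|)) := by
      intro m
      obtain ⟨hfin, hcard⟩ := hcount (m + 1) (by omega)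
      rw [tsum_eq_sum (s := hfin.toFinset) (fun n hn => by
        rw [if_neg]; simpa [hE] using hn)]
      calc _ ≤ ∑ n ∈ hfin.toFinset, (nexp (-((β + 1) * (m + 1 : ℕ))) : ℝ≥0∞) :=
            Finset.sum_le_sum fun n _ => by split_ifs <;> simp
        _ ≤ (nexp (β * (m + 1 : ℕ)) : ℝ≥0∞) * nexp (-((β + 1) * (m + 1 : ℕ))) := by
            rw [Finset.sum_const, nsmul_eq_mul]
            gcongr
            rw [hbβ, nexp_pow, Set.ncard_eq_toFinset_card _ hfin] at hcard
            exact_mod_cast hcard.le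
        _ ≤ _ := by
            rw [← ENNReal.coe_mul, ← nexp_add]
            refine ENNReal.coe_le_coe.2 (nexp_le_nexp.2 ?_)
            push_cast
            rw [abs_of_nonneg (Nat.cast_nonneg m)]
            linarith
    refine ne_top_of_le_ne_top (tsum_nexp_ne_top one_pos) ((ENNReal.tsum_le_tsum hb).trans ?_)
    exact ENNReal.tsum_comp_le_tsum_of_injective Nat.cast_injective
      (fun n : ℤ => (nexp (-(1 * |(n : ℝ)|)) : ℝ≥0∞))
  refine ⟨N + M', β + 2, fun n => nexp (β + 2) * expConv 1 q n, by positivity, by positivity, ?_,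
    fun n x hx => ?_⟩
  · rw [ENNReal.tsum_mul_left]
    exact ENNReal.mul_ne_top ENNReal.coe_ne_top (tsum_expConv_ne_top one_pos hqsum)
  set k := ⌊x⌋ with hk
  have hk1 := Int.floor_le x
  have hk2 := Int.lt_floor_add_one x
  have h1 := hM' k x ⟨hk1, hk2.le⟩
  have h2 := abs_sub_le (f x) (f k) (f n)
  have h3 : N < |f k - f n| := by linarith
  have hkn : |(k : ℝ) - n| ≤ |x - n| + 1 := by
    have h3 := le_abs_self (x - n)
    have h4 := neg_abs_le (x - n)
    rw [abs_le]; constructor <;> linarith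
  have key : ∀ (i j : ℤ), i < j → N < |f j - f i| →
      (nexp (-((β + 1) * |(j : ℝ) - i|)) : ℝ≥0∞) ≤ q i := by
    intro i j hij hlt
    obtain ⟨m, rfl⟩ : ∃ m : ℕ, j = i + (m + 1 : ℕ) := ⟨(j - i - 1).toNat, by omega⟩
    have hmem : i ∈ E m := by simp only [hE, Set.mem_ofPred_eq]; push_cast at hlt ⊢; exact hlt
    refine le_trans ?_ (ENNReal.le_tsum m)
    rw [if_pos hmem]
    push_cast
    rw [add_sub_cancel_left, abs_of_nonneg (by positivity)]
  have h0 := abs_nonneg (x - n)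
  rcases lt_trichotomy n k with hlt | heq | hgt
  · refine le_trans ?_ (mul_le_mul_right (le_expConv 1 q n n) _)
    rw [← mul_assoc, ← ENNReal.coe_mul, ← nexp_add]
    refine nexp_le_mul (key n k hlt h3) ?_
    rw [sub_self, abs_zero]
    nlinarith
  · rw [heq, sub_self, abs_zero] at h3; linarith
  · refine le_trans ?_ (mul_le_mul_right (le_expConv 1 q n k) _)
    rw [← mul_assoc, ← ENNReal.coe_mul, ← nexp_add]
    refine nexp_le_mul (key k n hgt (by rwa [abs_sub_comm])) ?_
    rw [abs_sub_comm (n : ℝ)]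
    nlinarith

/-- Slow functions have the counting property, by Markov's inequality for the sum of `q`. -/
lemma Slow.exists_count {f : ℝ → ℝ} (hf : Slow f) :
    ∃ (N : ℕ) (b : ℝ≥0), 1 ≤ N ∧ 1 < b ∧ ∀ m : ℕ, 1 ≤ m →
      CardLT {n : ℤ | (N : ℝ) < |f ((n : ℝ) + m) - f n|} (b ^ m) := by
  obtain ⟨N, B, q, hN, hB, hq, h⟩ := hf.2
  set Q := (∑' n, q n).toNNReal with hQ
  have hQ' : (Q : ℝ≥0∞) = ∑' n, q n := ENNReal.coe_toNNReal hq
  have h1B : 1 < nexp B := by rw [← nexp_zero, nexp_lt_nexp]; exact hB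
  refine ⟨⌈N⌉₊ + 1, nexp B * (Q + 2), by omega, ?_, fun m hm => ?_⟩
  · calc (1 : ℝ≥0) < nexp B * 1 := by simpa using h1B
      _ ≤ _ := by gcongr; exact le_add_self.trans' one_le_two
  obtain ⟨hfin, hcard⟩ := ENNReal.finset_card_const_le_le_of_tsum_le hq le_rfl
    (show (nexp (-(B * m)) : ℝ≥0∞) ≠ 0 by simp)
  have hsub : {n : ℤ | ((⌈N⌉₊ + 1 : ℕ) : ℝ) < |f ((n : ℝ) + m) - f n|} ⊆
      {n | (nexp (-(B * m)) : ℝ≥0∞) ≤ q n} := by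
    intro n hn
    have hn' : N < |f ((n : ℝ) + m) - f n| := by
      refine lt_trans ?_ hn
      push_cast
      linarith [Nat.le_ceil N]
    have := h n _ hn'
    rwa [add_sub_cancel_left, abs_of_nonneg (Nat.cast_nonneg m)] at this
  refine ⟨hfin.subset hsub, ?_⟩
  have h1 : ({n : ℤ | ((⌈N⌉₊ + 1 : ℕ) : ℝ) < |f ((n : ℝ) + m) - f n|}.ncard : ℝ≥0) ≤
      hfin.toFinset.card := by
    rw [← Set.ncard_eq_toFinset_card _ hfin]
    exact_mod_cast Set.ncard_le_ncard hsub hfin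
  have h2 : (hfin.toFinset.card : ℝ≥0) ≤ nexp (B * m) * Q := by
    rw [← hQ', ← ENNReal.coe_div (by simp)] at hcard
    have : (hfin.toFinset.card : ℝ≥0) ≤ Q / nexp (-(B * m)) := by exact_mod_cast hcard
    refine this.trans_eq ?_
    rw [nexp_neg, div_inv_eq_mul, mul_comm]
  refine (h1.trans h2).trans_lt ?_
  rw [mul_pow, nexp_pow]
  refine mul_lt_mul_of_pos_left ?_ (nexp_pos _)
  calc Q < Q + 2 := by simp
    _ = (Q + 2) ^ 1 := (pow_one _).symm
    _ ≤ (Q + 2) ^ m := pow_le_pow_right₀ (le_add_self.trans' one_le_two) hm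

/-! ### φ-functions in logarithmic coordinates -/

/-- The φ-function whose graph in logarithmic coordinates is that of `g`. -/
noncomputable def ofIso (g : ℝ ≃o ℝ) (t : ℝ≥0) : ℝ≥0 :=
  if t = 0 then 0 else nexp (g (Real.log t))

@[simp] lemma ofIso_zero (g : ℝ ≃o ℝ) : ofIso g 0 = 0 := if_pos rfl

@[simp] lemma ofIso_nexp (g : ℝ ≃o ℝ) (x : ℝ) : ofIso g (nexp x) = nexp (g x) := by
  simp [ofIso]

lemma eq_zero_or_nexp (t : ℝ≥0) : t = 0 ∨ ∃ x, t = nexp x := by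
  rcases eq_zero_or_pos t with h | h
  · exact Or.inl h
  · exact Or.inr ⟨_, (nexp_log h).symm⟩

lemma exists_nexp {t : ℝ≥0} (ht : 0 < t) : ∃ x, t = nexp x := ⟨_, (nexp_log ht).symm⟩

lemma ofIso_strictMono (g : ℝ ≃o ℝ) : StrictMono (ofIso g) := by
  intro s t hst
  obtain ⟨y, rfl⟩ := exists_nexp (zero_le.trans_lt hst)
  rcases eq_zero_or_nexp s with rfl | ⟨x, rfl⟩
  · simpa using nexp_pos _
  · simpa using hst

lemma ofIso_ofIso (f g : ℝ ≃o ℝ) (t : ℝ≥0) : ofIso f (ofIso g t) = ofIso (g.trans f) t := by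
  rcases eq_zero_or_nexp t with rfl | ⟨x, rfl⟩ <;> simp

lemma ofIso_symm_ofIso (g : ℝ ≃o ℝ) (t : ℝ≥0) : ofIso g.symm (ofIso g t) = t := by
  rcases eq_zero_or_nexp t with rfl | ⟨x, rfl⟩ <;> simp

lemma ofIso_ofIso_symm (g : ℝ ≃o ℝ) (t : ℝ≥0) : ofIso g (ofIso g.symm t) = t := by
  rcases eq_zero_or_nexp t with rfl | ⟨x, rfl⟩ <;> simp

/-- `ofIso g` as an order automorphism of `[0,∞)`. -/
noncomputable def ofIsoOrderIso (g : ℝ ≃o ℝ) : ℝ≥0 ≃o ℝ≥0 :=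
  (ofIso_strictMono g).orderIsoOfSurjective (ofIso g) fun t => ⟨_, ofIso_ofIso_symm g t⟩

lemma continuous_ofIso (g : ℝ ≃o ℝ) : Continuous (ofIso g) := (ofIsoOrderIso g).continuous

lemma isPhi_ofIso (g : ℝ ≃o ℝ) : IsPhi (ofIso g) where
  map_zero := ofIso_zero g
  tendsto_atTop := (ofIsoOrderIso g).tendsto_atTop
  strictMono := ofIso_strictMono g
  continuous := continuous_ofIso g

lemma IsPhi.exists_eq_ofIso {G : ℝ≥0 → ℝ≥0} (hG : IsPhi G) : ∃ g : ℝ ≃o ℝ, G = ofIso g := by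
  have hpos : ∀ x, 0 < G (nexp x) := fun x => by
    have := hG.strictMono (nexp_pos x); rwa [hG.map_zero] at this
  have hsurj : ∀ y, ∃ t, G t = y := fun y => by
    obtain ⟨b, hb⟩ := (hG.tendsto_atTop.eventually_ge_atTop y).exists
    obtain ⟨t, _, ht⟩ := intermediate_value_Icc (zero_le (a := b)) hG.continuous.continuousOn
      (show y ∈ Set.Icc (G 0) (G b) by rw [hG.map_zero]; exact ⟨zero_le, hb⟩)
    exact ⟨t, ht⟩
  let g : ℝ ≃o ℝ := StrictMono.orderIsoOfSurjective (fun x => Real.log (G (nexp x)))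
    (fun x y h => Real.log_lt_log (NNReal.coe_pos.2 (hpos x))
      (NNReal.coe_lt_coe.2 (hG.strictMono (nexp_strictMono h))))
    (fun y => by
      obtain ⟨t, ht⟩ := hsurj (nexp y)
      rcases eq_zero_or_nexp t with rfl | ⟨x, rfl⟩
      · rw [hG.map_zero] at ht; exact absurd ht.symm (nexp_ne_zero y)
      · exact ⟨x, by simp [ht]⟩)
  refine ⟨g, funext fun t => ?_⟩
  rcases eq_zero_or_nexp t with rfl | ⟨x, rfl⟩
  · simp [hG.map_zero]
  · rw [ofIso_nexp]; exact (nexp_log (hpos x)).symm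

lemma phiInv_ofIso (g : ℝ ≃o ℝ) : phiInv (ofIso g) = ofIso g.symm := by
  funext t
  have h : ofIso g (phiInv (ofIso g) t) = t := Function.invFun_eq ⟨_, ofIso_ofIso_symm g t⟩
  rw [← ofIso_symm_ofIso g (phiInv (ofIso g) t), h]

/-- Conjugation of an automorphism of the line by `x ↦ -x`. -/
noncomputable def negConj (g : ℝ ≃o ℝ) : ℝ ≃o ℝ :=
  StrictMono.orderIsoOfSurjective (fun x => -g (-x))
    (fun _ _ h => neg_lt_neg (g.strictMono (neg_lt_neg h))) (fun y => ⟨-g.symm (-y), by simp⟩)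

@[simp] lemma negConj_apply (g : ℝ ≃o ℝ) (x : ℝ) : negConj g x = -g (-x) := rfl

@[simp] lemma negConj_symm_apply (g : ℝ ≃o ℝ) (x : ℝ) : (negConj g).symm x = -g.symm (-x) := by
  rw [OrderIso.symm_apply_eq]; simp

lemma tilde_ofIso (g : ℝ ≃o ℝ) : tilde (ofIso g) = ofIso (negConj g) := by
  funext t
  rcases eq_zero_or_nexp t with rfl | ⟨x, rfl⟩
  · simp [tilde]
  · simp [tilde, ← nexp_neg]

lemma ofIso_comp_phiInv (f g : ℝ ≃o ℝ) : ofIso f ∘ phiInv (ofIso g) = ofIso (g.symm.trans f) := by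
  funext t; simp [phiInv_ofIso, ofIso_ofIso]

lemma phiInv_comp_ofIso (f g : ℝ ≃o ℝ) : phiInv (ofIso f) ∘ ofIso g = ofIso (g.trans f.symm) := by
  funext t; simp [phiInv_ofIso, ofIso_ofIso]

lemma ofIso_injective {f g : ℝ ≃o ℝ} (h : ofIso f = ofIso g) (x : ℝ) : f x = g x := by
  have := congrFun h (nexp x)
  rw [ofIso_nexp, ofIso_nexp] at this
  exact nexp_strictMono.injective this

/-- A dilatory φ-function expands large distances in logarithmic coordinates. -/
lemma coarseExpanding_of_isDilatory {g : ℝ ≃o ℝ} (h : IsDilatory (ofIso g)) :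
    CoarseExpanding g := by
  obtain ⟨c₁, c₂, h₁, h₂, h⟩ := h
  obtain ⟨p, rfl⟩ := exists_nexp (one_pos.trans h₁)
  obtain ⟨s, rfl⟩ := exists_nexp (one_pos.trans h₂)
  have hp : 0 < p := by rwa [← nexp_zero, nexp_lt_nexp] at h₁
  have hs : 0 < s := by rwa [← nexp_zero, nexp_lt_nexp] at h₂
  have hstep : ∀ x, s + g x ≤ g (p + x) := fun x => by
    have := h (nexp x)
    rwa [← nexp_add, ofIso_nexp, ofIso_nexp, ← nexp_add, nexp_le_nexp] at this
  have hmany : ∀ (k : ℕ) x, k * s + g x ≤ g (k * p + x) := by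
    intro k
    induction k with
    | zero => simp
    | succ k ih =>
      intro x
      have h1 := hstep (k * p + x)
      have h2 := ih x
      push_cast
      rw [show ((k : ℝ) + 1) * p + x = p + (k * p + x) by ring]
      linarith
  have hle : ∀ x y, x ≤ y → y - x ≤ p / s * (g y - g x) + p := by
    intro x y hxy
    have h0 : 0 ≤ (y - x) / p := div_nonneg (by linarith) hp.le
    set k := ⌊(y - x) / p⌋₊
    have h1 := Nat.floor_le h0
    have h2 := Nat.lt_floor_add_one ((y - x) / p)
    rw [le_div_iff₀ hp] at h1
    rw [div_lt_iff₀ hp] at h2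
    have h3 := hmany k x
    have h4 := g.monotone (show k * p + x ≤ y by linarith)
    have h5 : k * p ≤ p / s * (g y - g x) := by
      rw [div_mul_eq_mul_div, le_div_iff₀ hs]
      nlinarith
    linarith
  refine ⟨p / s + p, by positivity, fun x y => ?_⟩
  have hps : 0 ≤ p / s := by positivity
  rcases le_total x y with hxy | hxy
  · have := hle x y hxy
    rw [abs_sub_comm, abs_of_nonneg (sub_nonneg.2 hxy), abs_sub_comm (g x),
      abs_of_nonneg (sub_nonneg.2 (g.monotone hxy))]
    nlinarith [sub_nonneg.2 (g.monotone hxy), mul_nonneg hp.le (sub_nonneg.2 (g.monotone hxy))]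
  · have := hle y x hxy
    rw [abs_of_nonneg (sub_nonneg.2 hxy), abs_of_nonneg (sub_nonneg.2 (g.monotone hxy))]
    nlinarith [sub_nonneg.2 (g.monotone hxy), mul_nonneg hp.le (sub_nonneg.2 (g.monotone hxy))]

lemma coarseLipschitz_of_satisfiesDelta2 {g : ℝ ≃o ℝ} (h : SatisfiesDelta2 (ofIso g)) :
    CoarseLipschitz g := by
  rw [SatisfiesDelta2, phiInv_ofIso] at h
  have := (coarseExpanding_of_isDilatory h).lipschitz_symm
  simpa using this

lemma phiEquiv_ofIso_of_near {f g : ℝ ≃o ℝ} {C : ℝ} (h : ∀ x, f (x - C) ≤ g x ∧ g x ≤ f (x + C)) :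
    PhiEquiv (ofIso f) (ofIso g) := by
  refine ⟨nexp C, nexp_pos C, fun t => ?_⟩
  rcases eq_zero_or_nexp t with rfl | ⟨x, rfl⟩
  · simp
  · rw [← nexp_neg, ← nexp_add, ← nexp_add]
    simpa [sub_eq_neg_add, add_comm] using h x

lemma nexp_log_sandwich {c : ℝ≥0} (hc : 0 < c) {x y : ℝ} :
    c⁻¹ * nexp x ≤ nexp y ∧ nexp y ≤ c * nexp x ↔ |y - x| ≤ Real.log c := by
  obtain ⟨C, rfl⟩ := exists_nexp hc
  rw [← nexp_neg, ← nexp_add, ← nexp_add, nexp_le_nexp, nexp_le_nexp, coe_nexp, Real.log_exp,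
    abs_le]
  constructor <;> rintro ⟨h1, h2⟩ <;> constructor <;> linarith

/-- Comparability of two positive functions, in logarithmic coordinates. -/
lemma exists_const_sandwich_iff {A B : ℝ≥0 → ℝ≥0} {a b : ℝ → ℝ} (hA : ∀ x, A (nexp x) = nexp (a x))
    (hB : ∀ x, B (nexp x) = nexp (b x)) :
    (∃ c : ℝ≥0, 0 < c ∧ ∀ t : ℝ≥0, 0 < t → c⁻¹ * A t ≤ B t ∧ B t ≤ c * A t) ↔
      ∃ C : ℝ, ∀ x, |b x - a x| ≤ C := by
  constructor
  · rintro ⟨c, hc, h⟩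
    refine ⟨Real.log c, fun x => ?_⟩
    have := h (nexp x) (nexp_pos x)
    rwa [hA, hB, nexp_log_sandwich hc] at this
  · rintro ⟨C, h⟩
    refine ⟨nexp C, nexp_pos C, fun t ht => ?_⟩
    obtain ⟨x, rfl⟩ := exists_nexp ht
    rw [hA, hB, nexp_log_sandwich (nexp_pos C)]
    simpa using h x

lemma ofIso_div_ofIso (f g : ℝ ≃o ℝ) (x : ℝ) :
    ofIso f (nexp x) / ofIso g (nexp x) = nexp (f x - g x) := by
  rw [ofIso_nexp, ofIso_nexp, nexp_sub]

/-! ### Almost linear functions and almost equivalence -/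

lemma slow_of_slow_mul {f : ℝ → ℝ} {α : ℝ} (hα : 0 < α) (h : Slow fun x => f (α * x)) : Slow f := by
  have := h.comp (quasiIsometry_mul (inv_pos.2 hα))
  simpa [mul_inv_cancel_left₀ hα.ne'] using this

lemma bdd_of_continuous {f : ℝ → ℝ} (hf : Continuous f) (R : ℝ) :
    ∃ M : ℝ, ∀ x, |x| ≤ R → |f x| ≤ M := by
  obtain ⟨M, hM⟩ := (isCompact_Icc (a := -R) (b := R)).exists_bound_of_continuousOn hf.continuousOn
  exact ⟨M, fun x hx => hM x (abs_le.1 hx)⟩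

lemma almostLinear_set_eq (g : ℝ ≃o ℝ) (α : ℝ) (N m : ℕ) :
    {n : ℤ | ¬ (nexp α ^ ((m : ℤ) - (N : ℤ)) * ofIso g (nexp α ^ n) ≤
        ofIso g (nexp α ^ (n + (m : ℤ))) ∧
      ofIso g (nexp α ^ (n + (m : ℤ))) ≤ nexp α ^ ((m : ℤ) + (N : ℤ)) * ofIso g (nexp α ^ n))} =
    {n : ℤ | α * N < |(g (α * ((n : ℝ) + m)) - α * ((n : ℝ) + m)) - (g (α * n) - α * n)|} := by
  ext n
  simp only [nexp_zpow, ofIso_nexp, ← nexp_add, nexp_le_nexp, Set.mem_ofPred_eq]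
  push_cast
  rw [← not_le, not_iff_not, abs_le]
  constructor <;> rintro ⟨h1, h2⟩ <;> constructor <;> nlinarith

lemma isAlmostLinear_iff (g : ℝ ≃o ℝ) :
    IsAlmostLinear (ofIso g) ↔ Slow (fun x => g x - x) := by
  constructor
  · rintro ⟨a, b, N, ha, hb, hN, h⟩
    obtain ⟨α, rfl⟩ := exists_nexp (one_pos.trans ha)
    have hα : 0 < α := by rwa [← nexp_zero, nexp_lt_nexp] at ha
    simp only [almostLinear_set_eq] at h
    refine slow_of_slow_mul hα (slow_of_count (M := α + α * N) (N := α * N)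
      (bdd_of_continuous (by fun_prop)) (by positivity) hb h ?_)
    refine (h 1 le_rfl).1.subset ?_
    rintro n ⟨x, hx, hlt⟩
    simp only [Set.mem_ofPred_eq, Nat.cast_one]
    by_contra! hc
    have h1 := g.monotone (mul_le_mul_of_nonneg_left hx.1 hα.le)
    have h2 := g.monotone (mul_le_mul_of_nonneg_left hx.2 hα.le)
    have h3 := mul_le_mul_of_nonneg_left hx.1 hα.le
    have h4 := mul_le_mul_of_nonneg_left hx.2 hα.le
    have h5 : 0 ≤ α * N := by positivity
    rw [abs_le] at hc
    refine absurd hlt (not_lt.2 (abs_le.2 ⟨?_, ?_⟩)) <;> linarith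
  · intro h
    obtain ⟨N, b, hN, hb, h⟩ := h.exists_count
    refine ⟨nexp 1, b, N, ?_, hb, hN, fun m hm => ?_⟩
    · rw [← nexp_zero, nexp_lt_nexp]; exact one_pos
    · rw [almostLinear_set_eq]
      simpa using h m hm

lemma almostEquiv_set_eq (f g : ℝ ≃o ℝ) (α : ℝ) (N m : ℕ) :
    {n : ℤ | ¬ (nexp α ^ (-(N : ℤ)) * (ofIso g (nexp α ^ (n + (m : ℤ))) / ofIso g (nexp α ^ n)) ≤
          ofIso f (nexp α ^ (n + (m : ℤ))) / ofIso f (nexp α ^ n) ∧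
        ofIso f (nexp α ^ (n + (m : ℤ))) / ofIso f (nexp α ^ n) ≤
          nexp α ^ (N : ℤ) * (ofIso g (nexp α ^ (n + (m : ℤ))) / ofIso g (nexp α ^ n)))} =
    {n : ℤ | α * N < |(f (α * ((n : ℝ) + m)) - g (α * ((n : ℝ) + m))) - (f (α * n) - g (α * n))|} := by
  ext n
  simp only [nexp_zpow, ofIso_nexp, ← nexp_sub, ← nexp_add, nexp_le_nexp, Set.mem_ofPred_eq]
  push_cast
  rw [← not_le, not_iff_not, abs_le]
  constructor <;> rintro ⟨h1, h2⟩ <;> constructor <;> linarith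

/-- The coarse Lipschitz hypothesis is needed only to control `f - g` between the points of the lattice
that the definition of almost equivalence looks at. -/
lemma isAlmostEquiv_iff {f g : ℝ ≃o ℝ} (hfg : CoarseLipschitz f ∨ CoarseLipschitz g) :
    IsAlmostEquiv (ofIso f) (ofIso g) ↔ Slow (fun x => f x - g x) := by
  constructor
  · rintro ⟨a, b, N, ha, hb, hN, h⟩
    obtain ⟨α, rfl⟩ := exists_nexp (one_pos.trans ha)
    have hα : 0 < α := by rwa [← nexp_zero, nexp_lt_nexp] at ha
    simp only [almostEquiv_set_eq] at h
    obtain ⟨Q, hQ⟩ : ∃ Q, ∀ n : ℤ, f (α * (n + 1)) - f (α * n) ≤ Q ∨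
        g (α * (n + 1)) - g (α * n) ≤ Q := by
      rcases hfg with ⟨Q, hQ, k⟩ | ⟨Q, hQ, k⟩ <;> refine ⟨Q * α + Q, fun n => ?_⟩
      · have := (abs_le.1 (k (α * (n + 1)) (α * n))).2
        rw [show α * ((n : ℝ) + 1) - α * n = α by ring, abs_of_pos hα] at this
        exact Or.inl this
      · have := (abs_le.1 (k (α * (n + 1)) (α * n))).2
        rw [show α * ((n : ℝ) + 1) - α * n = α by ring, abs_of_pos hα] at this
        exact Or.inr this
    refine slow_of_slow_mul hα (slow_of_count (M := Q + α * N) (N := α * N)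
      (bdd_of_continuous (by fun_prop)) (by positivity) hb h ?_)
    refine (h 1 le_rfl).1.subset ?_
    rintro n ⟨x, hx, hlt⟩
    simp only [Set.mem_ofPred_eq, Nat.cast_one]
    by_contra! hc
    have h1 := f.monotone (mul_le_mul_of_nonneg_left hx.1 hα.le)
    have h2 := f.monotone (mul_le_mul_of_nonneg_left hx.2 hα.le)
    have h3 := g.monotone (mul_le_mul_of_nonneg_left hx.1 hα.le)
    have h4 := g.monotone (mul_le_mul_of_nonneg_left hx.2 hα.le)
    have h5 : 0 ≤ α * N := by positivity
    rw [abs_le] at hc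
    refine absurd hlt (not_lt.2 (abs_le.2 ⟨?_, ?_⟩)) <;>
      rcases hQ n with h6 | h6 <;> linarith
  · intro h
    obtain ⟨N, b, hN, hb, h⟩ := h.exists_count
    refine ⟨nexp 1, b, N, ?_, hb, hN, fun m hm => ?_⟩
    · rw [← nexp_zero, nexp_lt_nexp]; exact one_pos
    · rw [almostEquiv_set_eq]
      simpa using h m hm

/-! ### Lebesgue measure on the half-line -/

lemma measurableEmbedding_coe : MeasurableEmbedding (fun x : ℝ≥0 => (x : ℝ)) :=
  MeasurableEmbedding.subtype_coe measurableSet_Ici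

lemma lintegral_leb_eq_setLIntegral (Φ : ℝ≥0 → ℝ≥0∞) :
    ∫⁻ t, Φ t ∂leb = ∫⁻ r in Set.Ici (0 : ℝ), Φ r.toNNReal := by
  have h : Measure.map (fun x : ℝ≥0 => (x : ℝ)) leb = volume.restrict (Set.Ici 0) := by
    rw [leb, measurableEmbedding_coe.map_comap]
    congr 1
    exact Subtype.range_coe
  rw [← h, measurableEmbedding_coe.lintegral_map]
  simp

/-- The substitution `t = exp x`. -/
lemma lintegral_leb_eq (Φ : ℝ≥0 → ℝ≥0∞) :
    ∫⁻ t, Φ t ∂leb = ∫⁻ x, Φ (nexp x) * nexp x := by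
  rw [lintegral_leb_eq_setLIntegral, setLIntegral_congr Ioi_ae_eq_Ici.symm]
  have himg : Real.exp '' Set.univ = Set.Ioi 0 := by rw [Set.image_univ, Real.range_exp]
  rw [← himg, lintegral_image_eq_lintegral_abs_deriv_mul MeasurableSet.univ
    (fun x _ => (Real.hasDerivAt_exp x).hasDerivWithinAt) Real.exp_injective.injOn,
    setLIntegral_univ]
  refine lintegral_congr fun x => ?_
  rw [abs_of_pos (Real.exp_pos x), mul_comm]
  have : (Real.exp x).toNNReal = nexp x := by
    ext; simp [(Real.exp_pos x).le]
  rw [this, ← this]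
  rfl

lemma setLIntegral_Ioi_leb_eq (Φ : ℝ≥0 → ℝ≥0∞) :
    ∫⁻ t in Set.Ioi (0 : ℝ≥0), Φ t ∂leb = ∫⁻ x, Φ (nexp x) * nexp x := by
  rw [← lintegral_indicator measurableSet_Ioi, lintegral_leb_eq]
  refine lintegral_congr fun x => ?_
  rw [Set.indicator_of_mem (Set.mem_Ioi.2 (nexp_pos x))]

lemma extendTop_coe (F : ℝ≥0 → ℝ≥0) (t : ℝ≥0) : extendTop F t = F t := by
  simp [extendTop]

/-! ### N-functions and condition (J) -/

lemma lintegral_one_eq_top : ∫⁻ _x : ℝ, (1 : ℝ≥0∞) = ∞ := by simp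

/-- The integral of condition (J) in logarithmic coordinates. A Luxemburg constant `exp γ` with `γ ≤ 0`
is impossible, since the integrand would be at least `1` on the whole line. -/
lemma luxemburg_inv_tilde_lt_top_iff (h : ℝ ≃o ℝ) :
    luxemburg leb (ofIso h) (fun x => ((phiInv (tilde (ofIso h)) x : ℝ≥0) : ℝ≥0∞)⁻¹) < ∞ ↔
      ∃ γ : ℝ, 0 < γ ∧ ∫⁻ x, (nexp (-|h (h.symm x - γ) - x|) : ℝ≥0∞) ≤ 1 := by
  have hint : ∀ γ : ℝ, ∫⁻ x, extendTop (ofIso h)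
      (((phiInv (tilde (ofIso h)) x : ℝ≥0) : ℝ≥0∞)⁻¹ / (nexp γ : ℝ≥0∞)) ∂leb =
      ∫⁻ x, (nexp (h (h.symm x - γ) - x) : ℝ≥0∞) := by
    intro γ
    rw [lintegral_leb_eq, ← lintegral_neg_eq_self]
    refine lintegral_congr fun x => ?_
    rw [tilde_ofIso, phiInv_ofIso, ofIso_nexp, negConj_symm_apply, ← ENNReal.coe_inv (by simp),
      ← nexp_neg, ← ENNReal.coe_div (by simp), ← nexp_sub, extendTop_coe, ofIso_nexp,
      ← ENNReal.coe_mul, ← nexp_add]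
    simp [sub_eq_add_neg]
  unfold luxemburg
  simp only [iInf_lt_iff]
  constructor
  · rintro ⟨c, ⟨hc, hle⟩, _⟩
    obtain ⟨γ, rfl⟩ := exists_nexp hc
    rw [hint] at hle
    have hγ : 0 < γ := by
      by_contra! hγ
      have : ∫⁻ _x : ℝ, (1 : ℝ≥0∞) ≤ 1 := by
        refine le_trans (lintegral_mono fun x => ?_) hle
        rw [← ENNReal.coe_one, ← nexp_zero, ENNReal.coe_le_coe, nexp_le_nexp]
        have := h.monotone (show h.symm x ≤ h.symm x - γ by linarith)
        rw [OrderIso.apply_symm_apply] at this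
        linarith
      rw [lintegral_one_eq_top] at this
      exact absurd this (by simp)
    refine ⟨γ, hγ, le_trans (lintegral_mono fun x => ?_) hle⟩
    rw [ENNReal.coe_le_coe, nexp_le_nexp]
    linarith [neg_abs_le (h (h.symm x - γ) - x)]
  · rintro ⟨γ, hγ, hle⟩
    refine ⟨nexp γ, ⟨nexp_pos γ, ?_⟩, ENNReal.coe_lt_top⟩
    rw [hint]
    convert hle using 4 with x
    have := h.monotone (show h.symm x - γ ≤ h.symm x by linarith)
    rw [OrderIso.apply_symm_apply] at this
    rw [abs_of_nonpos (by linarith), neg_neg]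

/-- In logarithmic coordinates the inverse of the complementary function of `η` is `z - η⁻¹ z` up to a
bounded error, and condition (J) says that it is slow. -/
lemma slow_of_conditionJ {η : ℝ ≃o ℝ} (h : ConditionJ (ofIso η)) : Slow (fun x => η x - x) := by
  obtain ⟨Hs, hHs, ⟨c, hc, hcomp⟩, hlux⟩ := h
  obtain ⟨h, rfl⟩ := hHs.exists_eq_ofIso
  obtain ⟨γ, hγ, hle⟩ := (luxemburg_inv_tilde_lt_top_iff h).1 hlux
  have hnear : ∀ z, |h.symm z + η.symm z - z| ≤ Real.log c := fun z => by
    have := hcomp (nexp z)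
    rwa [phiInv_ofIso, phiInv_ofIso, ofIso_nexp, ofIso_nexp, ← nexp_add,
      nexp_log_sandwich hc] at this
  have hslow : Slow h.symm :=
    slow_of_lintegral_backward_gap hγ (by simpa using ne_top_of_le_ne_top ENNReal.one_ne_top hle)
  have hη : QuasiIsometry η := by
    have h1 : QuasiIsometry η.symm := by
      refine (quasiIsometry_id.add_slow hslow.neg).of_near (C := Real.log c) fun z => ?_
      rw [show η.symm z - (z + -h.symm z) = h.symm z + η.symm z - z by ring]
      exact hnear z
    simpa using h1.symm
  refine (hslow.comp hη).of_near (C := Real.log c) fun x => ?_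
  have := hnear (η x)
  rw [OrderIso.symm_apply_apply] at this
  rw [abs_sub_comm, show h.symm (η x) - (η x - x) = h.symm (η x) + x - η x by ring]
  exact this

/-- If `η` is the identity plus a slow automorphism `ρ`, up to a bounded error, then it gives an
N-function satisfying (J): the quotient `F₀ t / t` for `F₀` given by `id + ρ` is the φ-function of `ρ`. -/
lemma isNFunction_and_conditionJ {η ρ : ℝ ≃o ℝ} {D : ℝ} (hnear : ∀ x, |η x - (x + ρ x)| ≤ D)
    (hρ : Slow ρ) : IsNFunction (ofIso η) ∧ ConditionJ (ofIso η) := by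
  constructor
  · obtain ⟨η₀, hη₀⟩ := exists_orderIso_id_add ρ
    have hD : 0 ≤ D := (abs_nonneg _).trans (hnear 0)
    have hquot : Set.EqOn (fun t => ofIso η₀ t / t) (ofIso ρ) (Set.Ioi 0) := by
      intro t ht
      obtain ⟨x, rfl⟩ := exists_nexp ht
      simp only [ofIso_nexp]
      rw [← nexp_sub, hη₀, add_sub_cancel_left]
    refine ⟨isPhi_ofIso η, ofIso η₀, isPhi_ofIso η₀, ?_, ?_, ?_, ?_⟩
    · refine phiEquiv_ofIso_of_near (C := D) fun x => ?_
      have h1 := abs_le.1 (hnear (x - D))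
      have h2 := abs_le.1 (hnear (x + D))
      have h3 := ρ.monotone (show x - D ≤ x by linarith)
      have h4 := ρ.monotone (show x ≤ x + D by linarith)
      rw [hη₀]
      constructor <;> linarith
    · exact ((ofIso_strictMono ρ).strictMonoOn _).congr hquot.symm
    · refine (isPhi_ofIso ρ).tendsto_atTop.congr' ?_
      filter_upwards [eventually_gt_atTop 0] with t ht using (hquot ht).symm
    · have h1 : Tendsto (ofIso ρ) (𝓝[>] 0) (𝓝 0) := by
        have := (continuous_ofIso ρ).tendsto 0
        rw [ofIso_zero] at this
        exact this.mono_left nhdsWithin_le_nhds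
      refine h1.congr' ?_
      filter_upwards [self_mem_nhdsWithin] with t ht using (hquot ht).symm
  · -- the complementary function is the inverse of `ρ ∘ η⁻¹`
    have hη : QuasiIsometry η := (quasiIsometry_id.add_slow hρ).of_near hnear
    have hψ : Slow (fun z => ρ (η.symm z)) := hρ.comp hη.symm
    refine ⟨ofIso (ρ.symm.trans η), isPhi_ofIso _, ⟨nexp D, nexp_pos D, fun t => ?_⟩, ?_⟩
    · rcases eq_zero_or_nexp t with rfl | ⟨z, rfl⟩
      · simp [phiInv_ofIso]
      · rw [phiInv_ofIso, phiInv_ofIso, ofIso_nexp, ofIso_nexp, ← nexp_add,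
          nexp_log_sandwich (nexp_pos D), coe_nexp, Real.log_exp]
        have := hnear (η.symm z)
        rw [OrderIso.apply_symm_apply, abs_sub_comm] at this
        simpa [add_comm] using this
    · rw [luxemburg_inv_tilde_lt_top_iff]
      obtain ⟨γ, hγ, hle⟩ := hψ.lintegral_gap_le
      refine ⟨γ, hγ, hle _ fun x => ?_⟩
      simp [abs_of_pos hγ]

/-! ### Weights and condition (L) -/

/-- Condition (L) in logarithmic coordinates, for increasing (`s = 1`) and decreasing (`s = -1`)
weights. -/
lemma conditionL_iff {w : ℝ≥0 → ℝ≥0} {ρ : ℝ ≃o ℝ} {s : ℝ} (hs : s * s = 1)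
    (hw : ∀ x, w (nexp x) = nexp (s * ρ x)) :
    ConditionL w ↔ ∃ γ : ℝ, 0 < γ ∧ ∫⁻ x, (nexp (-|ρ.symm (ρ x + γ) - x|) : ℝ≥0∞) ≠ ∞ := by
  have hsurj : Set.SurjOn w (Set.Ioi 0) (Set.Ioi 0) := by
    intro y hy
    obtain ⟨v, rfl⟩ := exists_nexp hy
    refine ⟨nexp (ρ.symm (s * v)), nexp_pos _, ?_⟩
    rw [hw, OrderIso.apply_symm_apply, ← mul_assoc, hs, one_mul]
  have hinv : ∀ γ x, Function.invFunOn w (Set.Ioi 0) (nexp (s * γ) * w (nexp x)) =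
      nexp (ρ.symm (ρ x + γ)) := by
    intro γ x
    rw [hw, ← nexp_add]
    have hex := hsurj (nexp_pos (s * γ + s * ρ x))
    have h1 := Function.invFunOn_mem hex
    have h2 := Function.invFunOn_eq hex
    obtain ⟨y, hy⟩ := exists_nexp h1
    rw [hy] at h2 ⊢
    rw [hw] at h2
    have h3 := nexp_strictMono.injective h2
    have h4 : ρ y = ρ x + γ := by
      calc ρ y = s * (s * ρ y) := by rw [← mul_assoc, hs, one_mul]
        _ = s * s * (ρ x + γ) := by rw [h3]; ring
        _ = _ := by rw [hs, one_mul]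
    rw [← h4, OrderIso.symm_apply_apply]
  have hint : ∀ γ, ∫⁻ t in Set.Ioi (0 : ℝ≥0),
      ((Function.invFunOn w (Set.Ioi 0) (nexp (s * γ) * w t) : ℝ≥0) : ℝ≥0∞)⁻¹ ∂leb =
      ∫⁻ x, (nexp (x - ρ.symm (ρ x + γ)) : ℝ≥0∞) := by
    intro γ
    rw [setLIntegral_Ioi_leb_eq]
    refine lintegral_congr fun x => ?_
    rw [hinv, ← ENNReal.coe_inv (by simp), ← nexp_neg, ← ENNReal.coe_mul, ← nexp_add, neg_add_eq_sub]
  constructor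
  · rintro ⟨_, c, hc, hlt⟩
    obtain ⟨v, rfl⟩ := exists_nexp hc
    rw [show v = s * (s * v) by rw [← mul_assoc, hs, one_mul], hint] at hlt
    have hγ : 0 < s * v := by
      by_contra! hγ
      refine absurd hlt (not_lt.2 (lintegral_one_eq_top.symm.trans_le (lintegral_mono fun x => ?_)))
      rw [← ENNReal.coe_one, ← nexp_zero, ENNReal.coe_le_coe, nexp_le_nexp]
      have := ρ.symm.monotone (show ρ x + s * v ≤ ρ x by linarith)
      rw [OrderIso.symm_apply_apply] at this
      linarith
    refine ⟨s * v, hγ, ne_top_of_le_ne_top hlt.ne (lintegral_mono fun x => ?_)⟩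
    rw [ENNReal.coe_le_coe, nexp_le_nexp]
    linarith [le_abs_self (ρ.symm (ρ x + s * v) - x)]
  · rintro ⟨γ, hγ, hne⟩
    refine ⟨hsurj, nexp (s * γ), nexp_pos _, ?_⟩
    rw [hint]
    refine lt_of_eq_of_lt (lintegral_congr fun x => ?_) (lt_top_iff_ne_top.2 hne)
    have := ρ.symm.monotone (show ρ x ≤ ρ x + γ by linarith)
    rw [OrderIso.symm_apply_apply] at this
    rw [abs_of_nonneg (by linarith), neg_sub]

/-- The monotone weight is a slow automorphism in logarithmic coordinates, up to the sign. -/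
lemma slow_of_conditionL {w : ℝ≥0 → ℝ≥0} (hw : IsStrictlyMonotoneWeight w) (hL : ConditionL w) :
    Slow (fun x => Real.log (w (nexp x))) := by
  have hpos : ∀ x, 0 < w (nexp x) := fun x => hw.1.pos _ (nexp_pos x)
  have hval : ∀ y, ∃ x, Real.log (w (nexp x)) = y := fun y => by
    obtain ⟨t, ht, hty⟩ := hL.1 (nexp_pos y)
    obtain ⟨x, rfl⟩ := exists_nexp ht
    exact ⟨x, by rw [hty, coe_nexp, Real.log_exp]⟩
  rcases hw.2 with ⟨hmono, -⟩ | ⟨hanti, -⟩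
  · let ρ : ℝ ≃o ℝ := StrictMono.orderIsoOfSurjective (fun x => Real.log (w (nexp x)))
      (fun x y h => Real.log_lt_log (NNReal.coe_pos.2 (hpos x))
        (NNReal.coe_lt_coe.2 (hmono (nexp_pos x) (nexp_pos y) (nexp_strictMono h)))) hval
    obtain ⟨γ, hγ, hne⟩ := (conditionL_iff (ρ := ρ) (s := 1) (by norm_num) (fun x => by
      rw [one_mul]; exact (nexp_log (hpos x)).symm)).1 hL
    exact slow_of_lintegral_forward_gap hγ hne
  · let ρ : ℝ ≃o ℝ := StrictMono.orderIsoOfSurjective (fun x => -Real.log (w (nexp x)))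
      (fun x y h => neg_lt_neg (Real.log_lt_log (NNReal.coe_pos.2 (hpos y))
        (NNReal.coe_lt_coe.2 (hanti (nexp_pos x) (nexp_pos y) (nexp_strictMono h)))))
      (fun y => by obtain ⟨x, hx⟩ := hval (-y); exact ⟨x, by simp [hx]⟩)
    have hρ : ∀ x, ρ x = -Real.log (w (nexp x)) := fun _ => rfl
    obtain ⟨γ, hγ, hne⟩ := (conditionL_iff (ρ := ρ) (s := -1) (by norm_num) (fun x => by
      rw [hρ, neg_one_mul, neg_neg]; exact (nexp_log (hpos x)).symm)).1 hL
    simpa [hρ] using (slow_of_lintegral_forward_gap hγ hne).neg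

lemma Slow.conditionL {ρ : ℝ ≃o ℝ} (hρ : Slow ρ) {w : ℝ≥0 → ℝ≥0} {s : ℝ} (hs : s * s = 1)
    (hw : ∀ x, w (nexp x) = nexp (s * ρ x)) : ConditionL w := by
  obtain ⟨γ, hγ, hle⟩ := hρ.lintegral_gap_le
  refine (conditionL_iff hs hw).2 ⟨γ, hγ, ne_top_of_le_ne_top ENNReal.one_ne_top (hle _ fun x => ?_)⟩
  simp [abs_of_pos hγ]

/-- A function squeezed between multiples of `min (√t) (1/√t)` and `√t + 1/√t` is a weight. -/
lemma isWeight_of_log_bound {w : ℝ≥0 → ℝ≥0} (hm : Measurable w) {f : ℝ → ℝ}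
    (hw : ∀ x, w (nexp x) = nexp (f x)) {C : ℝ} (hf : ∀ x, |f x| ≤ 1 / 2 * |x| + C) :
    IsWeight w := by
  refine ⟨hm, fun t ht => ?_, ?_⟩
  · obtain ⟨x, rfl⟩ := exists_nexp ht
    rw [hw]; exact nexp_pos _
  set g : ℝ → ℝ := (Set.Ioi 0).indicator fun r => (w r.toNNReal : ℝ) with hg
  have hgm : Measurable g :=
    (measurable_coe_nnreal_real.comp (hm.comp measurable_real_toNNReal)).indicator measurableSet_Ioi
  have hg0 : ∀ r, 0 ≤ g r := fun r => Set.indicator_nonneg (fun _ _ => NNReal.coe_nonneg _) r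
  have hgexp : ∀ x, g (Real.exp x) = Real.exp (f x) := fun x => by
    rw [hg, Set.indicator_of_mem (Set.mem_Ioi.2 (Real.exp_pos x))]
    have : (Real.exp x).toNNReal = nexp x := by
      ext; simp [(Real.exp_pos x).le]
    rw [this, hw, coe_nexp]
  have hgpos : ∀ r, 0 < r → 0 < g r := fun r hr => by
    rw [← Real.exp_log hr, hgexp]; exact Real.exp_pos _
  have hupper : ∀ r, ‖g r‖ ≤ Real.exp C * (‖r ^ (1 / 2 : ℝ)‖ + ‖r ^ (-(1 / 2) : ℝ)‖) := by
    intro r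
    rw [Real.norm_of_nonneg (hg0 r)]
    rcases le_or_gt r 0 with hr | hr
    · rw [hg, Set.indicator_of_notMem (by simpa using hr)]; positivity
    · obtain ⟨x, rfl⟩ : ∃ x, r = Real.exp x := ⟨_, (Real.exp_log hr).symm⟩
      rw [hgexp, ← Real.exp_mul, ← Real.exp_mul, Real.norm_of_nonneg (Real.exp_pos _).le,
        Real.norm_of_nonneg (Real.exp_pos _).le, mul_add, ← Real.exp_add, ← Real.exp_add]
      have h1 := (abs_le.1 (hf x)).2
      rcases abs_cases x with ⟨e, _⟩ | ⟨e, _⟩ <;> rw [e] at h1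
      · have := Real.exp_le_exp.2 (show f x ≤ C + x * (1 / 2) by linarith)
        linarith [Real.exp_pos (C + x * (-(1 / 2)))]
      · have := Real.exp_le_exp.2 (show f x ≤ C + x * (-(1 / 2)) by linarith)
        linarith [Real.exp_pos (C + x * (1 / 2))]
  have hint : ∀ a b, IntervalIntegrable g volume a b := fun a b =>
    (((intervalIntegral.intervalIntegrable_rpow' (by norm_num)).norm.add
      (intervalIntegral.intervalIntegrable_rpow' (by norm_num)).norm).const_mul
        (Real.exp C)).mono_fun' hgm.aestronglyMeasurable (Eventually.of_forall hupper)
  set W : ℝ → ℝ := fun t => ∫ r in (0 : ℝ)..t, g r with hW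
  have hWsub : ∀ a b, W b - W a = ∫ r in a..b, g r := fun a b =>
    intervalIntegral.integral_interval_sub_left (hint _ _) (hint _ _)
  have hW0 : ∀ t : ℝ≥0, 0 ≤ W t := fun t =>
    intervalIntegral.integral_nonneg t.coe_nonneg fun r _ => hg0 r
  have hWc : Continuous W := intervalIntegral.continuous_primitive hint 0
  have hWm : StrictMono (fun t : ℝ≥0 => W t) := by
    intro s t hst
    have hst' : (s : ℝ) < t := NNReal.coe_lt_coe.2 hst
    have := intervalIntegral.intervalIntegral_pos_of_pos_on (hint s t)
      (fun r hr => hgpos r (s.coe_nonneg.trans_lt hr.1)) hst'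
    rw [← hWsub] at this
    exact sub_pos.1 this
  have hWtop : ∀ M, ∃ t : ℝ≥0, M ≤ W t := by
    intro M
    -- on `[1, e^(2y)]` the weight is at least `e^(-C-y)`
    obtain ⟨y, hy⟩ : ∃ y : ℝ, 0 ≤ y ∧ M * Real.exp C + 1 ≤ Real.exp y := by
      refine ⟨|M * Real.exp C|, abs_nonneg _, ?_⟩
      linarith [Real.add_one_le_exp |M * Real.exp C|, le_abs_self (M * Real.exp C)]
    refine ⟨nexp (2 * y), ?_⟩
    have h1 : (1 : ℝ) ≤ Real.exp (2 * y) := Real.one_le_exp (by linarith [hy.1])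
    have h2 := intervalIntegral.integral_mono_on h1
      (intervalIntegrable_const (c := Real.exp (-C - y)) (μ := volume)) (hint 1 (Real.exp (2 * y)))
      (fun r hr => by
        obtain ⟨x, rfl⟩ : ∃ x, r = Real.exp x :=
          ⟨_, (Real.exp_log (one_pos.trans_le hr.1)).symm⟩
        rw [hgexp, Real.exp_le_exp]
        have h3 := (abs_le.1 (hf x)).1
        have h4 : x ≤ 2 * y := Real.exp_le_exp.1 hr.2
        have h5 : 0 ≤ x := by rw [← Real.one_le_exp_iff]; exact hr.1
        rw [abs_of_nonneg h5] at h3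
        linarith)
    rw [← hWsub, intervalIntegral.integral_const, smul_eq_mul, sub_mul, ← Real.exp_add, one_mul,
      show 2 * y + (-C - y) = y - C by ring] at h2
    have h6 := hW0 1
    rw [NNReal.coe_one] at h6
    have h7 : Real.exp (-C - y) ≤ Real.exp (-C) := Real.exp_le_exp.2 (by linarith [hy.1])
    have h8 : (M * Real.exp C + 1) * Real.exp (-C) ≤ Real.exp y * Real.exp (-C) := by
      gcongr; exact hy.2
    rw [add_mul, mul_assoc, ← Real.exp_add, add_neg_cancel, Real.exp_zero, mul_one, one_mul,
      ← Real.exp_add, ← sub_eq_add_neg] at h8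
    rw [coe_nexp]
    linarith
  have hcoe : ∀ t : ℝ≥0, ((W t).toNNReal : ℝ) = W t := fun t => Real.coe_toNNReal _ (hW0 t)
  have hsm : StrictMono (fun t : ℝ≥0 => (W t).toNNReal) := fun s t h => by
    rw [← NNReal.coe_lt_coe, hcoe, hcoe]; exact hWm h
  refine ⟨fun t => (W t).toNNReal, ⟨?_, ?_, hsm, ?_⟩, fun t => ?_⟩
  · simp [hW]
  · refine tendsto_atTop_atTop_of_monotone hsm.monotone fun b => ?_
    obtain ⟨t, ht⟩ := hWtop b
    exact ⟨t, by rwa [← NNReal.coe_le_coe, hcoe]⟩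
  · exact continuous_real_toNNReal.comp (hWc.comp NNReal.continuous_coe)
  · rw [← lintegral_indicator measurableSet_Ioc, lintegral_leb_eq_setLIntegral,
      setLIntegral_congr Ioi_ae_eq_Ici.symm]
    change ENNReal.ofReal (∫ r in (0 : ℝ)..t, g r) = _
    rw [intervalIntegral.integral_of_le t.coe_nonneg,
      ofReal_integral_eq_lintegral_ofReal ((hint 0 t).1) (Eventually.of_forall hg0),
      ← lintegral_indicator measurableSet_Ioc, ← lintegral_indicator measurableSet_Ioi]
    refine lintegral_congr fun r => ?_
    by_cases hr : 0 < r
    · rw [Set.indicator_of_mem (Set.mem_Ioi.2 hr)]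
      by_cases hrt : r ≤ t
      · rw [Set.indicator_of_mem (show r ∈ Set.Ioc (0 : ℝ) t from ⟨hr, hrt⟩),
          Set.indicator_of_mem (show r.toNNReal ∈ Set.Ioc 0 t from
            ⟨Real.toNNReal_pos.2 hr, Real.toNNReal_le_iff_le_coe.2 hrt⟩), hg,
          Set.indicator_of_mem (Set.mem_Ioi.2 hr), ENNReal.ofReal_coe_nnreal]
      · rw [Set.indicator_of_notMem (fun h => hrt h.2), Set.indicator_of_notMem
          (fun h => hrt (Real.toNNReal_le_iff_le_coe.1 h.2))]
    · rw [Set.indicator_of_notMem (fun h => hr h.1),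
        Set.indicator_of_notMem (show r ∉ Set.Ioi (0 : ℝ) from hr)]

lemma Slow.log_bound {f : ℝ → ℝ} (hf : Slow f) : ∃ C, ∀ x, |f x| ≤ 1 / 2 * |x| + C := by
  obtain ⟨C, hC, h⟩ := hf.sublinear (show (0 : ℝ) < 1 / 2 by norm_num)
  refine ⟨C + |f 0|, fun x => ?_⟩
  have h1 := h x 0
  have h2 := abs_add_le (f x - f 0) (f 0)
  rw [sub_add_cancel] at h2
  rw [sub_zero] at h1
  linarith

lemma tendsto_ofIso_nhdsGT (ρ : ℝ ≃o ℝ) : Tendsto (ofIso ρ) (𝓝[>] 0) (𝓝[>] 0) := by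
  refine tendsto_nhdsWithin_iff.2 ⟨?_, ?_⟩
  · have := (continuous_ofIso ρ).tendsto 0
    rw [ofIso_zero] at this
    exact this.mono_left nhdsWithin_le_nhds
  · filter_upwards [self_mem_nhdsWithin] with t ht
    simpa using ofIso_strictMono ρ ht

lemma Slow.isStrictlyMonotoneWeight {ρ : ℝ ≃o ℝ} (hρ : Slow ρ) :
    IsStrictlyMonotoneWeight (ofIso ρ) := by
  obtain ⟨C, hC⟩ := hρ.log_bound
  exact ⟨isWeight_of_log_bound (continuous_ofIso ρ).measurable (ofIso_nexp ρ) hC,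
    Or.inl ⟨(ofIso_strictMono ρ).strictMonoOn _,
      (tendsto_ofIso_nhdsGT ρ).mono_right nhdsWithin_le_nhds, (isPhi_ofIso ρ).tendsto_atTop⟩⟩

lemma Slow.isStrictlyMonotoneWeight_inv {ρ : ℝ ≃o ℝ} (hρ : Slow ρ) :
    IsStrictlyMonotoneWeight (fun t => (ofIso ρ t)⁻¹) := by
  obtain ⟨C, hC⟩ := hρ.log_bound
  refine ⟨isWeight_of_log_bound (f := fun x => -ρ x) (C := C)
    (continuous_ofIso ρ).measurable.inv (fun x => ?_) (fun x => ?_), Or.inr ⟨?_, ?_, ?_⟩⟩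
  · rw [ofIso_nexp, nexp_neg]
  · rw [abs_neg]; exact hC x
  · intro s hs t ht hst
    have h1 := ofIso_strictMono ρ hs
    rw [ofIso_zero] at h1
    exact inv_strictAnti₀ h1 (ofIso_strictMono ρ hst)
  · exact tendsto_inv_nhdsGT_zero.comp (tendsto_ofIso_nhdsGT ρ)
  · exact tendsto_inv_atTop_zero.comp (isPhi_ofIso ρ).tendsto_atTop

/-! ### Orlicz–Lorentz functionals in logarithmic coordinates -/

lemma extendTop_mono (g : ℝ ≃o ℝ) : Monotone (extendTop (ofIso g)) := by
  intro s t hst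
  unfold extendTop
  split_ifs with h1 h2 h2
  · exact le_rfl
  · exact absurd (top_unique (h1 ▸ hst)) h2
  · exact le_top
  · exact ENNReal.coe_le_coe.2 ((ofIso_strictMono g).monotone (ENNReal.toNNReal_mono h2 hst))

lemma rearrangement_antitone {u : ℝ≥0 → ℂ} : Antitone (rearrangement leb u) := fun _ _ hxy =>
  iSup₂_le fun t ht => le_iSup₂_of_le t ((ENNReal.coe_le_coe.2 hxy).trans ht) le_rfl

/-- The Orlicz modular of the function on `[0,∞)` whose value at `exp (-g y)` is `k y`, written as an
integral over `z = g y`. -/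
noncomputable def modular (g : ℝ ≃o ℝ) (k : ℝ → ℝ≥0∞) : ℝ≥0∞ :=
  ∫⁻ z, extendTop (ofIso g) (k (g.symm z)) * nexp (-z)

lemma modular_mono (g : ℝ ≃o ℝ) {k l : ℝ → ℝ≥0∞} (h : ∀ y, k y ≤ l y) :
    modular g k ≤ modular g l :=
  lintegral_mono fun z => by gcongr; exact extendTop_mono g (h _)

lemma orliczLorentz_eq (f g : ℝ ≃o ℝ) (u : ℝ≥0 → ℂ) :
    orliczLorentz leb (ofIso f) (ofIso g) u =
      ⨅ (c : ℝ≥0) (_ : 0 < c ∧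
        modular g (fun y => rearrangement leb u (nexp (-f y)) / (c : ℝ≥0∞)) ≤ 1), (c : ℝ≥0∞) := by
  have hint : ∀ c : ℝ≥0, ∫⁻ x, extendTop (ofIso g) (rearrangement leb u
      (tilde (ofIso f) (phiInv (tilde (ofIso g)) x)) / (c : ℝ≥0∞)) ∂leb =
      modular g (fun y => rearrangement leb u (nexp (-f y)) / (c : ℝ≥0∞)) := by
    intro c
    rw [lintegral_leb_eq, ← lintegral_neg_eq_self, modular]
    refine lintegral_congr fun z => ?_
    rw [tilde_ofIso, tilde_ofIso, phiInv_ofIso, ofIso_nexp, ofIso_nexp]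
    simp
  unfold orliczLorentz luxemburg
  simp only [hint]

lemma lintegral_Ici_nexp_neg (p : ℝ) : ∫⁻ z in Set.Ici p, (nexp (-z) : ℝ≥0∞) = nexp (-p) := by
  have h : ∀ z : ℝ, (nexp (-z) : ℝ≥0∞) = ENNReal.ofReal (Real.exp (-z)) := fun z => by
    rw [← coe_nexp, ENNReal.ofReal_coe_nnreal]
  simp only [h]
  rw [setLIntegral_congr Ioi_ae_eq_Ici.symm, ← ofReal_integral_eq_lintegral_ofReal
    (integrableOn_exp_neg_Ioi p) (Eventually.of_forall fun z => (Real.exp_pos _).le),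
    integral_exp_neg_Ioi]

lemma measurable_nexp_neg : Measurable fun z : ℝ => (nexp (-z) : ℝ≥0∞) :=
  (continuous_nexp.comp continuous_neg).measurable.coe_nnreal_ennreal

lemma le_setLIntegral_unit {F : ℝ → ℝ≥0∞} {A : ℝ≥0∞} {p : ℝ}
    (h : ∀ z ∈ Set.Ico p (p + 1), A ≤ F z) :
    A * nexp (-(p + 1)) ≤ ∫⁻ z in Set.Ico p (p + 1), F z * nexp (-z) := by
  calc A * nexp (-(p + 1)) = ∫⁻ _z in Set.Ico p (p + 1), A * nexp (-(p + 1)) := by simp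
    _ ≤ _ := by
      refine setLIntegral_mono' measurableSet_Ico fun z hz => ?_
      gcongr
      · exact h z hz
      · exact nexp_le_nexp.2 (neg_le_neg hz.2.le)

/-! ### Test functions -/

lemma leb_Iic (s : ℝ≥0) : leb (Set.Iic s) = s := by
  rw [leb, measurableEmbedding_coe.comap_apply]
  have : (fun x : ℝ≥0 => (x : ℝ)) '' Set.Iic s = Set.Icc 0 (s : ℝ) := by
    ext r
    constructor
    · rintro ⟨t, ht, rfl⟩; exact ⟨t.coe_nonneg, NNReal.coe_le_coe.2 ht⟩
    · rintro ⟨h0, h1⟩; exact ⟨⟨r, h0⟩, h1, rfl⟩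
  rw [this, Real.volume_Icc, sub_zero, ENNReal.ofReal_coe_nnreal]

/-- The decreasing step function `max_i exp (a i) 1_[0, s i]`. -/
noncomputable def stepFun {ι : Type*} (S : Finset ι) (a : ι → ℝ) (s : ι → ℝ≥0) (x : ℝ≥0) : ℝ≥0 :=
  S.sup fun i => if x ≤ s i then nexp (a i) else 0

lemma measurable_stepFun {ι : Type*} (S : Finset ι) (a : ι → ℝ) (s : ι → ℝ≥0) :
    Measurable (fun x => ((stepFun S a s x : ℝ) : ℂ)) := by
  refine Complex.measurable_ofReal.comp (measurable_coe_nnreal_real.comp ?_)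
  refine Antitone.measurable fun x y hxy => Finset.sup_mono_fun fun i _ => ?_
  split_ifs with h1 h2
  · exact le_rfl
  · exact absurd (hxy.trans h1) h2
  · exact zero_le
  · exact le_rfl

lemma nnnorm_stepFun {ι : Type*} (S : Finset ι) (a : ι → ℝ) (s : ι → ℝ≥0) (x : ℝ≥0) :
    ‖((stepFun S a s x : ℝ) : ℂ)‖₊ = stepFun S a s x := by
  ext; simp

lemma le_rearrangement_stepFun {ι : Type*} {S : Finset ι} {a : ι → ℝ} {s : ι → ℝ≥0} {i : ι}
    (hi : i ∈ S) {x : ℝ≥0} (hx : x ≤ s i) :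
    (nexp (a i) : ℝ≥0∞) ≤ rearrangement leb (fun x => ((stepFun S a s x : ℝ) : ℂ)) x := by
  refine le_iSup₂_of_le (nexp (a i)) ?_ le_rfl
  calc (x : ℝ≥0∞) ≤ s i := ENNReal.coe_le_coe.2 hx
    _ = leb (Set.Iic (s i)) := (leb_Iic _).symm
    _ ≤ _ := by
      refine measure_mono fun y hy => ?_
      rw [Set.mem_ofPred_eq, nnnorm_stepFun]
      have := Finset.le_sup (f := fun i => if y ≤ s i then nexp (a i) else 0) hi
      rwa [if_pos (Set.mem_Iic.1 hy)] at this

lemma rearrangement_stepFun_le {ι : Type*} {S : Finset ι} {a : ι → ℝ} {s : ι → ℝ≥0} {x : ℝ≥0}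
    (hx : 0 < x) :
    rearrangement leb (fun x => ((stepFun S a s x : ℝ) : ℂ)) x ≤ stepFun S a s x := by
  classical
  refine iSup₂_le fun t ht => ?_
  by_contra! hlt
  rw [ENNReal.coe_lt_coe] at hlt
  -- the set where the step function is at least `t` only involves steps that end before `x`
  set m := (S.filter fun i => s i < x).sup s with hm
  have hmx : m < x := (Finset.sup_lt_iff (by simpa using hx)).2 fun i hi => (Finset.mem_filter.1 hi).2
  refine absurd ht (not_le.2 (lt_of_le_of_lt ?_ (ENNReal.coe_lt_coe.2 hmx)))
  rw [← leb_Iic m]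
  refine measure_mono fun y hy => ?_
  rw [Set.mem_ofPred_eq, nnnorm_stepFun] at hy
  by_contra hym
  rw [Set.mem_Iic, not_le] at hym
  refine absurd (hlt.trans_le hy) (not_lt.2 (Finset.sup_le fun i hi => ?_))
  split_ifs with hys
  · have hxs : x ≤ s i := by
      by_contra! hc
      have := Finset.le_sup (f := s) (Finset.mem_filter (p := fun i => s i < x).2 ⟨hi, hc⟩)
      exact absurd (hys.trans this) (not_le.2 hym)
    have := Finset.le_sup (f := fun i => if x ≤ s i then nexp (a i) else 0) hi
    rwa [if_pos hxs] at this
  · exact zero_le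

/-- A step function with values `exp (a i)` at the positions `v i` has modular at most
`∑ exp (g (a i) - g (v i))`, since the maximum of its steps is at most their sum. -/
lemma modular_stepFun_le {ι : Type*} (g : ℝ ≃o ℝ) (S : Finset ι) (a v : ι → ℝ) {k : ℝ → ℝ≥0∞}
    (hk : ∀ y, k y ≤ (S.sup fun i => if v i ≤ y then nexp (a i) else 0 : ℝ≥0)) :
    modular g k ≤ ∑ i ∈ S, (nexp (g (a i) - g (v i)) : ℝ≥0∞) := by
  have hpt : ∀ z, extendTop (ofIso g) (k (g.symm z)) * nexp (-z) ≤
      ∑ i ∈ S, (Set.Ici (g (v i))).indicator (fun z => (nexp (g (a i)) * nexp (-z) : ℝ≥0∞)) z := by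
    intro z
    have h1 := extendTop_mono g (hk (g.symm z))
    rw [extendTop_coe, Finset.apply_sup_eq_sup_comp_of_linearOrder (ofIso g)
      (ofIso_strictMono g).monotone (by simp)] at h1
    have h2 : (S.sup (ofIso g ∘ fun i => if v i ≤ g.symm z then nexp (a i) else 0) : ℝ≥0) ≤
        ∑ i ∈ S, if v i ≤ g.symm z then nexp (g (a i)) else 0 := by
      refine Finset.sup_le fun i hi => ?_
      refine le_trans (le_of_eq ?_) (Finset.single_le_sum
        (f := fun i => if v i ≤ g.symm z then nexp (g (a i)) else 0) (fun _ _ => zero_le) hi)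
      by_cases h : v i ≤ g.symm z <;> simp [h]
    refine (mul_le_mul_left (h1.trans (ENNReal.coe_le_coe.2 h2)) _).trans ?_
    push_cast
    rw [Finset.sum_mul]
    refine Finset.sum_le_sum fun i _ => ?_
    by_cases h : v i ≤ g.symm z
    · rw [if_pos h, Set.indicator_of_mem (Set.mem_Ici.2 ((OrderIso.le_symm_apply g).1 h))]
    · rw [if_neg h]; simp
  refine (lintegral_mono hpt).trans ?_
  rw [lintegral_finsetSum _ fun i _ => (measurable_nexp_neg.const_mul _).indicator measurableSet_Ici]
  refine Finset.sum_le_sum fun i _ => ?_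
  rw [lintegral_indicator measurableSet_Ici, lintegral_const_mul _ measurable_nexp_neg,
    lintegral_Ici_nexp_neg, ← ENNReal.coe_mul, ← nexp_add, sub_eq_add_neg]

/-- The consequence of a norm inequality for the step functions with values `exp (a i)` at the
positions `v i`; here `k` is the rearrangement of such a function, divided by its norm bound. -/
lemma exists_modular_test {f₁ f₂ g₁ g₂ : ℝ ≃o ℝ} {c : ℝ≥0}
    (hle : ∀ u : ℝ≥0 → ℂ, Measurable u → orliczLorentz leb (ofIso f₂) (ofIso g₂) u ≤
      c * orliczLorentz leb (ofIso f₁) (ofIso g₁) u) :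
    ∃ C : ℝ, 0 ≤ C ∧ ∀ (S : Finset ℤ) (a v : ℤ → ℝ),
      ∑ i ∈ S, nexp (g₁ (a i) - g₁ (v i)) ≤ 1 →
      ∃ k : ℝ → ℝ≥0∞, (∀ i ∈ S, ∀ y, f₁ (v i) ≤ f₂ y → (nexp (a i - C) : ℝ≥0∞) ≤ k y) ∧
        modular g₂ k ≤ 1 := by
  refine ⟨Real.log (c + 1), Real.log_nonneg (by simp), fun S a v hS => ?_⟩
  set u : ℝ≥0 → ℂ := fun x => ((stepFun S a (fun i => nexp (-f₁ (v i))) x : ℝ) : ℂ) with hu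
  have h1 : orliczLorentz leb (ofIso f₁) (ofIso g₁) u ≤ 1 := by
    rw [orliczLorentz_eq]
    refine iInf₂_le_of_le 1 ⟨one_pos, ?_⟩ (by simp)
    refine (modular_stepFun_le g₁ S a v fun y => ?_).trans (by exact_mod_cast hS)
    rw [ENNReal.coe_one, div_one]
    refine (rearrangement_stepFun_le (nexp_pos _)).trans (le_of_eq ?_)
    simp [stepFun]
  have h2 : orliczLorentz leb (ofIso f₂) (ofIso g₂) u < (c + 1 : ℝ≥0) := by
    refine (hle u (measurable_stepFun _ _ _)).trans_lt ?_
    calc (c : ℝ≥0∞) * orliczLorentz leb (ofIso f₁) (ofIso g₁) u ≤ c * 1 := by gcongr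
      _ < _ := by rw [mul_one]; exact_mod_cast lt_add_one c
  rw [orliczLorentz_eq] at h2
  simp only [iInf_lt_iff] at h2
  obtain ⟨c', ⟨hc', hmod⟩, hlt⟩ := h2
  refine ⟨_, fun i hi y hy => ?_, hmod⟩
  have h3 := le_rearrangement_stepFun (a := a) (s := fun i => nexp (-f₁ (v i))) hi
    (x := nexp (-f₂ y)) (by simpa using hy)
  have h4 : c' ≤ c + 1 := (ENNReal.coe_lt_coe.1 hlt).le
  have h5 : nexp (a i - Real.log (c + 1)) = nexp (a i) / (c + 1) := by
    rw [nexp_sub]; congr 1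
    have := nexp_log (show 0 < c + 1 by positivity)
    rwa [NNReal.coe_add, NNReal.coe_one] at this
  rw [h5, ENNReal.coe_div (by positivity)]
  exact ENNReal.div_le_div h3 (ENNReal.coe_le_coe.2 h4)

/-- Indicator functions recover `F` from the functional up to equivalence. -/
lemma exists_shift_le {f₁ f₂ g₁ g₂ : ℝ ≃o ℝ} {c : ℝ≥0}
    (hle : ∀ u : ℝ≥0 → ℂ, Measurable u → orliczLorentz leb (ofIso f₂) (ofIso g₂) u ≤
      c * orliczLorentz leb (ofIso f₁) (ofIso g₁) u) :
    ∃ C : ℝ, 0 ≤ C ∧ ∀ y, f₂ (y - C) ≤ f₁ y := by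
  obtain ⟨C, hC, h⟩ := exists_modular_test hle
  refine ⟨C, hC, fun y => ?_⟩
  obtain ⟨k, hk, hmod⟩ := h {0} (fun _ => y) (fun _ => y) (by simp)
  set θ := f₂.symm (f₁ y) with hθ
  have h1 : (nexp (g₂ (y - C) - g₂ θ) : ℝ≥0∞) ≤ 1 := by
    refine le_trans ?_ hmod
    calc (nexp (g₂ (y - C) - g₂ θ) : ℝ≥0∞)
        = ∫⁻ z in Set.Ici (g₂ θ), (nexp (g₂ (y - C)) : ℝ≥0∞) * nexp (-z) := by
          rw [lintegral_const_mul _ measurable_nexp_neg, lintegral_Ici_nexp_neg, ← ENNReal.coe_mul,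
            ← nexp_add, sub_eq_add_neg]
      _ ≤ ∫⁻ z in Set.Ici (g₂ θ), extendTop (ofIso g₂) (k (g₂.symm z)) * nexp (-z) := by
          refine setLIntegral_mono' measurableSet_Ici fun z hz => ?_
          gcongr
          have := extendTop_mono g₂ (hk 0 (by simp) (g₂.symm z) (by
            rw [← OrderIso.symm_apply_le, ← hθ, OrderIso.le_symm_apply]; exact hz))
          rwa [extendTop_coe, ofIso_nexp] at this
      _ ≤ _ := setLIntegral_le_lintegral _ _
  rw [← ENNReal.coe_one, ENNReal.coe_le_coe, ← nexp_zero, nexp_le_nexp, sub_nonpos,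
    g₂.le_iff_le, hθ, OrderIso.le_symm_apply] at h1
  exact h1

/-- The consequence of a norm inequality that the comparison of `g₁` with `g₂` rests on: it bounds
sums of `exp (g₂ a - g₂ v)` in terms of sums of `exp (g₁ a - g₁ v)`, for families `v` that are
separated with respect to `g₂`. -/
def TestBound (g₁ g₂ : ℝ ≃o ℝ) (C : ℝ) : Prop :=
  ∀ (S : Finset ℤ) (a v : ℤ → ℝ), ∑ i ∈ S, nexp (g₁ (a i) - g₁ (v i)) ≤ 1 →
    (∀ i ∈ S, ∀ j ∈ S, i ≠ j → 1 ≤ |g₂ (v i + C) - g₂ (v j + C)|) →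
    ∑ i ∈ S, nexp (g₂ (a i - C) - g₂ (v i + C)) ≤ nexp 1

lemma exists_testBound {f₁ f₂ g₁ g₂ : ℝ ≃o ℝ} {c : ℝ≥0} {D : ℝ} (hD : ∀ y, f₁ y ≤ f₂ (y + D))
    (hle : ∀ u : ℝ≥0 → ℂ, Measurable u → orliczLorentz leb (ofIso f₂) (ofIso g₂) u ≤
      c * orliczLorentz leb (ofIso f₁) (ofIso g₁) u) :
    ∃ C : ℝ, 0 ≤ C ∧ TestBound g₁ g₂ C := by
  obtain ⟨C, hC, h⟩ := exists_modular_test hle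
  refine ⟨max C D, le_max_of_le_left hC, fun S a v hS hsep => ?_⟩
  obtain ⟨k, hk, hmod⟩ := h S a v hS
  set p : ℤ → ℝ := fun i => g₂ (v i + max C D) with hp
  have hdisj : Set.PairwiseDisjoint ↑S fun i => Set.Ico (p i) (p i + 1) := by
    intro i hi j hj hij
    refine Set.disjoint_left.2 fun z hzi hzj => ?_
    have := hsep i hi j hj hij
    have : |p i - p j| < 1 := by
      rw [abs_lt]; constructor <;> linarith [hzi.1, hzi.2, hzj.1, hzj.2]
    linarith
  have hterm : ∀ i ∈ S, (nexp (g₂ (a i - max C D)) : ℝ≥0∞) * nexp (-(p i + 1)) ≤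
      ∫⁻ z in Set.Ico (p i) (p i + 1), extendTop (ofIso g₂) (k (g₂.symm z)) * nexp (-z) := by
    intro i hi
    refine le_setLIntegral_unit fun z hz => ?_
    have h1 : v i + max C D ≤ g₂.symm z := by rw [OrderIso.le_symm_apply]; exact hz.1
    have h2 : f₁ (v i) ≤ f₂ (g₂.symm z) :=
      (hD _).trans (f₂.monotone (by linarith [le_max_right C D]))
    have h3 := extendTop_mono g₂ (hk i hi _ h2)
    rw [extendTop_coe, ofIso_nexp] at h3
    refine le_trans (ENNReal.coe_le_coe.2 (nexp_le_nexp.2 (g₂.monotone ?_))) h3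
    linarith [le_max_left C D]
  have hsum : (∑ i ∈ S, nexp (g₂ (a i - max C D) - (p i + 1)) : ℝ≥0) ≤ (1 : ℝ≥0∞) := by
    push_cast
    calc ∑ i ∈ S, (nexp (g₂ (a i - max C D) - (p i + 1)) : ℝ≥0∞)
        ≤ ∑ i ∈ S, ∫⁻ z in Set.Ico (p i) (p i + 1),
            extendTop (ofIso g₂) (k (g₂.symm z)) * nexp (-z) := by
          refine Finset.sum_le_sum fun i hi => le_trans (le_of_eq ?_) (hterm i hi)
          rw [← ENNReal.coe_mul, ← nexp_add, sub_eq_add_neg]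
      _ = ∫⁻ z in ⋃ i ∈ S, Set.Ico (p i) (p i + 1),
            extendTop (ofIso g₂) (k (g₂.symm z)) * nexp (-z) :=
          (lintegral_biUnion_finset hdisj (fun _ _ => measurableSet_Ico) _).symm
      _ ≤ 1 := (setLIntegral_le_lintegral _ _).trans hmod
  have hsum' : ∑ i ∈ S, nexp (g₂ (a i - max C D) - (p i + 1)) ≤ 1 := by exact_mod_cast hsum
  calc ∑ i ∈ S, nexp (g₂ (a i - max C D) - g₂ (v i + max C D))
      = nexp 1 * ∑ i ∈ S, nexp (g₂ (a i - max C D) - (p i + 1)) := by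
        rw [Finset.mul_sum]
        refine Finset.sum_congr rfl fun i _ => ?_
        rw [← nexp_add]; congr 1; ring
    _ ≤ nexp 1 * 1 := by gcongr
    _ = nexp 1 := mul_one _

/-! ### Necessity: equivalent spaces have a slow difference -/

lemma finite_close (g : ℝ ≃o ℝ) (d : ℝ) (m : ℤ) :
    {n : ℤ | |g ((n : ℝ) + d) - g (m + d)| < 1}.Finite := by
  refine (Set.finite_Icc ⌊g.symm (g (m + d) - 1) - d⌋ ⌈g.symm (g (m + d) + 1) - d⌉).subset ?_
  intro n hn
  rw [Set.mem_ofPred_eq] at hn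
  obtain ⟨h1, h2⟩ := abs_lt.1 hn
  have h3 : g.symm (g (m + d) - 1) < n + d := by rw [OrderIso.symm_apply_lt]; linarith
  have h4 : (n : ℝ) + d < g.symm (g (m + d) + 1) := by rw [OrderIso.lt_symm_apply]; linarith
  constructor
  · have := Int.floor_le (g.symm (g (m + d) - 1) - d)
    exact_mod_cast (show ((⌊g.symm (g (m + d) - 1) - d⌋ : ℤ) : ℝ) ≤ n by linarith)
  · have := Int.le_ceil (g.symm (g (m + d) + 1) - d)
    exact_mod_cast (show (n : ℝ) ≤ (⌈g.symm (g (m + d) + 1) - d⌉ : ℤ) by linarith)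

/-- An infinite set of integers contains arbitrarily large finite subsets that are separated with
respect to `g`, as needed for `TestBound`. -/
lemma exists_sparse_subset (g : ℝ ≃o ℝ) (d : ℝ) {E : Set ℤ} (hE : E.Infinite) (J : ℕ) :
    ∃ S : Finset ℤ, ↑S ⊆ E ∧ S.card = J ∧
      ∀ i ∈ S, ∀ j ∈ S, i ≠ j → 1 ≤ |g ((i : ℝ) + d) - g (j + d)| := by
  classical
  induction J with
  | zero => exact ⟨∅, by simp, rfl, by simp⟩
  | succ J ih =>
    obtain ⟨S, hS, hcard, hsep⟩ := ih
    have hfin : (⋃ m ∈ S, {n : ℤ | |g ((n : ℝ) + d) - g (m + d)| < 1}).Finite :=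
      S.finite_toSet.biUnion fun m _ => finite_close g d m
    obtain ⟨n, hnE, hn⟩ := (hE.sdiff hfin).nonempty
    have hfar : ∀ m ∈ S, 1 ≤ |g ((n : ℝ) + d) - g (m + d)| := by
      intro m hm
      by_contra! hc
      exact hn (Set.mem_biUnion (x := m) hm hc)
    have hnS : n ∉ S := fun h => by
      have := hfar n h
      simp at this
      linarith
    refine ⟨insert n S, ?_, by rw [Finset.card_insert_of_notMem hnS, hcard], ?_⟩
    · rw [Finset.coe_insert]; exact Set.insert_subset hnE hS
    · intro i hi j hj hij
      rcases Finset.mem_insert.1 hi with hi' | hi' <;>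
        rcases Finset.mem_insert.1 hj with hj' | hj'
      · exact absurd (hi'.trans hj'.symm) hij
      · rw [hi']; exact hfar j hj'
      · rw [hj', abs_sub_comm]; exact hfar i hi'
      · exact hsep i hi' j hj' hij

lemma coarseLipschitz_of_steps {g : ℝ ≃o ℝ} {R : ℝ}
    (h : ∀ n : ℤ, g ((n : ℝ) + 1) - g n ≤ R) : CoarseLipschitz g := by
  have hR : 0 ≤ R := by
    have h1 := h 0
    have h2 := g.monotone (show (0 : ℝ) ≤ 0 + 1 by norm_num)
    push_cast at h1
    linarith
  have hmany : ∀ (k : ℕ) (n : ℤ), g ((n : ℝ) + k) - g n ≤ k * R := by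
    intro k
    induction k with
    | zero => simp
    | succ k ih =>
      intro n
      have h1 := ih n
      have h2 := h (n + k)
      push_cast at h2 ⊢
      rw [← add_assoc]
      linarith
  have hle : ∀ x y, x ≤ y → g y - g x ≤ R * (y - x) + 3 * R := by
    intro x y hxy
    have h1 := Int.floor_le x
    have h2 := Int.lt_floor_add_one x
    have h0 : 0 ≤ y - ⌊x⌋ := by linarith
    have h3 := Nat.le_ceil (y - ⌊x⌋)
    have h4 := Nat.ceil_lt_add_one h0
    have h5 := hmany ⌈y - ⌊x⌋⌉₊ ⌊x⌋
    have h6 := g.monotone h1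
    have h7 := g.monotone (show y ≤ ⌊x⌋ + ⌈y - ⌊x⌋⌉₊ by linarith)
    nlinarith
  refine ⟨3 * R, by positivity, fun x y => ?_⟩
  rcases le_total x y with hxy | hxy
  · have := hle x y hxy
    rw [abs_sub_comm, abs_of_nonneg (sub_nonneg.2 (g.monotone hxy)), abs_sub_comm x,
      abs_of_nonneg (sub_nonneg.2 hxy)]
    nlinarith [mul_nonneg hR (sub_nonneg.2 hxy)]
  · have := hle y x hxy
    rw [abs_of_nonneg (sub_nonneg.2 (g.monotone hxy)), abs_of_nonneg (sub_nonneg.2 hxy)]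
    nlinarith [mul_nonneg hR (sub_nonneg.2 hxy)]

/-- If `g₁` had infinitely many large jumps, these would give step functions that are small for
`g₁` but, as `g₂` has no such jumps, large for `g₂`. -/
lemma TestBound.coarseLipschitz {g₁ g₂ : ℝ ≃o ℝ} {C : ℝ} (h : TestBound g₁ g₂ C) (hC : 0 ≤ C)
    (h₂ : CoarseLipschitz g₂) : CoarseLipschitz g₁ := by
  obtain ⟨Q, hQ, hlip⟩ := h₂
  set A := Q * (1 + 2 * C) + Q with hA
  obtain ⟨J, hJ⟩ := exists_nat_gt (nexp (1 + A))
  have hJ0 : (0 : ℝ≥0) < J := (nexp_pos _).trans hJ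
  set r := Real.log (J : ℝ≥0) with hr
  have hJr : nexp r = J := nexp_log hJ0
  have hfin : {n : ℤ | r < g₁ ((n : ℝ) + 1) - g₁ n}.Finite := by
    by_contra hinf
    obtain ⟨S, hS, hcard, hsep⟩ := exists_sparse_subset g₂ (1 + C) hinf J
    have h1 := h S (fun n => n) (fun n => n + 1) (by
      calc ∑ i ∈ S, nexp (g₁ i - g₁ ((i : ℝ) + 1)) ≤ ∑ _i ∈ S, nexp (-r) := by
            refine Finset.sum_le_sum fun i hi => nexp_le_nexp.2 ?_
            have : r < g₁ ((i : ℝ) + 1) - g₁ i := hS hi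
            linarith
        _ = 1 := by
            rw [Finset.sum_const, nsmul_eq_mul, hcard, nexp_neg, hJr, mul_inv_cancel₀ hJ0.ne'])
      (by simpa only [add_assoc] using hsep)
    have h2 : (J : ℝ≥0) * nexp (-A) ≤ nexp 1 := by
      refine le_trans ?_ h1
      calc (J : ℝ≥0) * nexp (-A) = ∑ _i ∈ S, nexp (-A) := by
            rw [Finset.sum_const, nsmul_eq_mul, hcard]
        _ ≤ _ := by
            refine Finset.sum_le_sum fun i _ => nexp_le_nexp.2 ?_
            have := (abs_le.1 (hlip ((i : ℝ) - C) (i + 1 + C))).1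
            rw [show (i : ℝ) - C - (i + 1 + C) = -(1 + 2 * C) by ring, abs_neg,
              abs_of_nonneg (by positivity)] at this
            linarith
    have h3 : (J : ℝ≥0) ≤ nexp (1 + A) := by
      calc (J : ℝ≥0) = J * nexp (-A) * nexp A := by
            rw [mul_assoc, ← nexp_add]; simp
        _ ≤ nexp 1 * nexp A := by gcongr
        _ = _ := (nexp_add _ _).symm
    exact absurd hJ (not_lt.2 h3)
  obtain ⟨R, hR⟩ := (hfin.image fun n : ℤ => g₁ ((n : ℝ) + 1) - g₁ n).bddAbove
  refine coarseLipschitz_of_steps (R := max r R) fun n => ?_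
  by_cases hn : r < g₁ ((n : ℝ) + 1) - g₁ n
  · exact (hR ⟨n, hn, rfl⟩).trans (le_max_right _ _)
  · exact (not_lt.1 hn).trans (le_max_left _ _)

/-- If `g₂` were almost constant on infinitely many intervals of length `p`, these would give step
functions that are large for `g₂` but, as `g₁` grows on such intervals, small for `g₁`. -/
lemma TestBound.coarseExpanding {g₁ g₂ : ℝ ≃o ℝ} {C : ℝ} (h : TestBound g₁ g₂ C) (hC : 0 ≤ C)
    (h₁ : CoarseExpanding g₁) : CoarseExpanding g₂ := by
  obtain ⟨Q, hQ, hexp⟩ := h₁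
  obtain ⟨p, hp⟩ := exists_nat_gt (2 * C + Q * 8 + Q)
  have hp2 : 2 * C ≤ p := by nlinarith
  have he : (9 : ℝ) ≤ Real.exp 8 := by linarith [Real.add_one_le_exp (8 : ℝ)]
  have he2 : Real.exp 2 < 9 := by
    have h1 := Real.exp_one_lt_d9
    have h2 : Real.exp 2 = Real.exp 1 * Real.exp 1 := by rw [← Real.exp_add]; norm_num
    nlinarith [Real.exp_pos 1]
  have hfin : {n : ℤ | g₂ ((n : ℝ) + p) - g₂ n < 1}.Finite := by
    by_contra hinf
    -- `9` terms suffice because `exp 2 < 9`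
    obtain ⟨S, hS, hcard, hsep⟩ := exists_sparse_subset g₂ p hinf 9
    have h1 := h S (fun n => n + C) (fun n => n + p - C) (by
      calc ∑ i ∈ S, nexp (g₁ (i + C) - g₁ ((i : ℝ) + p - C)) ≤ ∑ _i ∈ S, nexp (-8) := by
            refine Finset.sum_le_sum fun i hi => nexp_le_nexp.2 ?_
            have h2 := hexp ((i : ℝ) + p - C) (i + C)
            have h3 := g₁.monotone (show (i : ℝ) + C ≤ i + p - C by linarith)
            rw [show (i : ℝ) + p - C - (i + C) = p - 2 * C by ring, abs_of_nonneg (by linarith),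
              abs_of_nonneg (by linarith)] at h2
            by_contra! hc
            nlinarith
        _ ≤ 1 := by
            rw [Finset.sum_const, nsmul_eq_mul, hcard, nexp_neg]
            rw [← div_eq_mul_inv, div_le_one (nexp_pos _)]
            exact_mod_cast he)
      (by simpa only [sub_add_cancel] using hsep)
    simp only [add_sub_cancel_right, sub_add_cancel] at h1
    have h2 : (9 : ℝ≥0) * nexp (-1) ≤ nexp 1 := by
      refine le_trans ?_ h1
      calc (9 : ℝ≥0) * nexp (-1) = ∑ _i ∈ S, nexp (-1) := by
            rw [Finset.sum_const, nsmul_eq_mul, hcard]; norm_num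
        _ ≤ _ := by
            refine Finset.sum_le_sum fun i hi => nexp_le_nexp.2 ?_
            have : g₂ ((i : ℝ) + p) - g₂ i < 1 := hS hi
            linarith
    have h3 : (9 : ℝ≥0) ≤ nexp 2 := by
      calc (9 : ℝ≥0) = 9 * nexp (-1) * nexp 1 := by rw [mul_assoc, ← nexp_add]; simp
        _ ≤ nexp 1 * nexp 1 := by gcongr
        _ = nexp 2 := by rw [← nexp_add]; norm_num
    exact absurd (show (9 : ℝ) ≤ Real.exp 2 by exact_mod_cast h3) (not_le.2 he2)
  have hp0 : (0 : ℝ) < p := by nlinarith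
  obtain ⟨s, hs, hstep⟩ : ∃ s : ℝ, 0 < s ∧ ∀ n : ℤ, s ≤ g₂ ((n : ℝ) + p) - g₂ n := by
    have hpos : ∀ n : ℤ, 0 < g₂ ((n : ℝ) + p) - g₂ n := fun n =>
      sub_pos.2 (g₂.strictMono (by linarith))
    rcases hfin.toFinset.eq_empty_or_nonempty with hemp | hne
    · refine ⟨1, one_pos, fun n => ?_⟩
      by_contra! hc
      have : n ∈ hfin.toFinset := hfin.mem_toFinset.2 hc
      rw [hemp] at this
      simp at this
    · obtain ⟨n₀, _, hn₀⟩ := hfin.toFinset.exists_min_image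
        (fun n : ℤ => g₂ ((n : ℝ) + p) - g₂ n) hne
      refine ⟨min 1 (g₂ ((n₀ : ℝ) + p) - g₂ n₀), lt_min one_pos (hpos n₀), fun n => ?_⟩
      by_cases hn : g₂ ((n : ℝ) + p) - g₂ n < 1
      · exact (min_le_right _ _).trans (hn₀ n (hfin.mem_toFinset.2 hn))
      · exact (min_le_left _ _).trans (not_lt.1 hn)
  refine coarseExpanding_of_isDilatory ⟨nexp (p + 1), nexp s, ?_, ?_, fun t => ?_⟩
  · rw [← nexp_zero, nexp_lt_nexp]; linarith
  · rwa [← nexp_zero, nexp_lt_nexp]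
  · rcases eq_zero_or_nexp t with rfl | ⟨x, rfl⟩
    · simp
    · rw [← nexp_add, ofIso_nexp, ofIso_nexp, ← nexp_add, nexp_le_nexp]
      have h1 := Int.le_ceil x
      have h2 := Int.ceil_lt_add_one x
      have h3 := hstep ⌈x⌉
      have h4 := g₂.monotone h1
      have h5 := g₂.monotone (show (⌈x⌉ : ℝ) + p ≤ p + 1 + x by linarith)
      linarith

lemma exists_step_one_le {g : ℝ ≃o ℝ} (h : CoarseExpanding g) :
    ∃ s : ℝ, 0 < s ∧ ∀ x y, s ≤ |x - y| → 1 ≤ |g x - g y| := by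
  obtain ⟨Q, hQ, h⟩ := h
  refine ⟨2 * Q + 1, by positivity, fun x y hxy => ?_⟩
  have := h x y
  by_contra! hc
  nlinarith

/-- The bootstrapping step: on the set where `g₁` grows by more than `N` in excess of `g₂`, the sums for
`g₁` are small multiples of those for `g₂`. So if the sum for `g₂` over a subset is bounded, adding one
term keeps the sum for `g₁` at most `1`, and `TestBound` returns the same bound for `g₂`. Since each term
for `g₂` is at least exponentially small in `m`, the number of terms is at most exponential. -/
lemma TestBound.exists_count {g₁ g₂ : ℝ ≃o ℝ} {C : ℝ} (h : TestBound g₁ g₂ C) (hC : 0 ≤ C)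
    (h₂ : QuasiIsometry g₂) : ∃ (N : ℝ) (b : ℝ≥0), 0 ≤ N ∧ 1 < b ∧ ∀ m : ℕ, 1 ≤ m →
      CardLT {n : ℤ | N < (g₁ ((n : ℝ) + m) - g₂ ((n : ℝ) + m)) - (g₁ n - g₂ n)} (b ^ m) := by
  classical
  obtain ⟨Q, hQ, hlip⟩ := h₂.lipschitz
  obtain ⟨s₀, hs₀, hstep⟩ := exists_step_one_le h₂.expanding
  obtain ⟨s, hs⟩ := exists_nat_gt s₀
  have hs0 : 0 < s := by exact_mod_cast hs₀.trans hs
  set L := Q * C + Q with hL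
  set A := 1 + 2 * L with hA
  have hL0 : 0 ≤ L := by positivity
  have hA0 : 0 ≤ A := by positivity
  have hQC : ∀ x, g₂ x - L ≤ g₂ (x - C) ∧ g₂ (x + C) ≤ g₂ x + L := fun x => by
    have h1 := (abs_le.1 (hlip (x - C) x)).1
    have h2 := (abs_le.1 (hlip (x + C) x)).2
    rw [sub_sub_cancel_left, abs_neg, abs_of_nonneg hC] at h1
    rw [add_sub_cancel_left, abs_of_nonneg hC] at h2
    constructor <;> linarith
  have hA1 : nexp (-(A + 1)) * (nexp A + 1) ≤ 1 := by
    have h1 : (Real.exp A + 1) ≤ Real.exp (A + 1) := by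
      have h2 := Real.add_one_le_exp (1 : ℝ)
      have h3 := Real.one_le_exp hA0
      have h4 := mul_le_mul_of_nonneg_left h2 (Real.exp_pos A).le
      rw [Real.exp_add A 1]
      linarith
    have h2 : nexp A + 1 ≤ nexp (A + 1) := by exact_mod_cast h1
    rw [nexp_neg, inv_mul_le_one₀ (nexp_pos _)]
    exact h2
  have hb1 : (1 : ℝ≥0) < nexp Q * (s * nexp (A + Q) + 2) := by
    have h1 : (1 : ℝ≥0) ≤ nexp Q := by rw [← nexp_zero, nexp_le_nexp]; exact hQ
    calc (1 : ℝ≥0) < 2 := one_lt_two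
      _ ≤ 1 * (s * nexp (A + Q) + 2) := by rw [one_mul]; exact le_add_self
      _ ≤ _ := by gcongr
  refine ⟨A + 1, nexp Q * (s * nexp (A + Q) + 2), by positivity, hb1, fun m hm => ?_⟩
  set E := {n : ℤ | A + 1 < (g₁ ((n : ℝ) + m) - g₂ ((n : ℝ) + m)) - (g₁ n - g₂ n)} with hE
  have hboot : ∀ S : Finset ℤ, ↑S ⊆ E → (∀ i ∈ S, ∀ j ∈ S, i ≠ j → (s : ℝ) ≤ |(i : ℝ) - j|) →
      ∑ i ∈ S, nexp (g₂ i - g₂ ((i : ℝ) + m)) ≤ nexp A := by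
    intro S
    induction S using Finset.induction_on with
    | empty => simp
    | insert n S hn ih =>
      intro hSE hsep
      have ih' := ih (fun i hi => hSE (by simp [Finset.mem_coe.1 hi])) fun i hi j hj =>
        hsep i (Finset.mem_insert_of_mem hi) j (Finset.mem_insert_of_mem hj)
      have hsmall : ∑ i ∈ insert n S, nexp (g₁ i - g₁ ((i : ℝ) + m)) ≤ 1 := by
        refine le_trans ?_ hA1
        calc ∑ i ∈ insert n S, nexp (g₁ i - g₁ ((i : ℝ) + m))
            ≤ ∑ i ∈ insert n S, nexp (-(A + 1)) * nexp (g₂ i - g₂ ((i : ℝ) + m)) := by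
              refine Finset.sum_le_sum fun i hi => ?_
              rw [← nexp_add, nexp_le_nexp]
              have : A + 1 < (g₁ ((i : ℝ) + m) - g₂ ((i : ℝ) + m)) - (g₁ i - g₂ i) := hSE hi
              linarith
          _ ≤ _ := by
              rw [← Finset.mul_sum, Finset.sum_insert hn, add_comm (nexp _)]
              refine mul_le_mul_right (add_le_add ih' ?_) _
              rw [← nexp_zero, nexp_le_nexp, sub_nonpos]
              exact g₂.monotone (by simp)
      have h1 := h (insert n S) (fun i => i) (fun i => i + m) hsmall (fun i hi j hj hij => by
        refine hstep _ _ ?_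
        rw [show (i : ℝ) + m + C - (j + m + C) = i - j by ring]
        exact hs.le.trans (hsep i hi j hj hij))
      calc ∑ i ∈ insert n S, nexp (g₂ i - g₂ ((i : ℝ) + m))
          ≤ ∑ i ∈ insert n S, nexp (2 * L) * nexp (g₂ (i - C) - g₂ ((i : ℝ) + m + C)) := by
            refine Finset.sum_le_sum fun i _ => ?_
            rw [← nexp_add, nexp_le_nexp]
            linarith [(hQC i).1, (hQC (i + m)).2]
        _ ≤ nexp (2 * L) * nexp 1 := by rw [← Finset.mul_sum]; gcongr
        _ = nexp A := by rw [← nexp_add, hA, add_comm]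
  -- splitting into residue classes modulo `s` makes the elements `s`-separated
  have hcard : ∀ S : Finset ℤ, ↑S ⊆ E → (S.card : ℝ≥0) ≤ nexp (Q * m) * (s * nexp (A + Q)) := by
    intro S hSE
    have hclass : ∀ r ∈ Finset.range s, ((S.filter fun n => (n % (s : ℤ)).toNat = r).card : ℝ≥0) ≤
        nexp (Q * m) * nexp (A + Q) := by
      intro r _
      set T := S.filter fun n => (n % (s : ℤ)).toNat = r with hT
      have h1 := hboot T (fun i hi => hSE (Finset.mem_filter.1 hi).1) (by
        intro i hi j hj hij
        have hi' := (Finset.mem_filter.1 hi).2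
        have hj' := (Finset.mem_filter.1 hj).2
        have hsz : (s : ℤ) ≠ 0 := by exact_mod_cast hs0.ne'
        have hmod : i % s = j % s := by
          have h1 := Int.emod_nonneg i hsz
          have h2 := Int.emod_nonneg j hsz
          omega
        have hdvd : (s : ℤ) ∣ i - j := Int.ModEq.dvd (Int.ModEq.symm hmod)
        have := Int.le_of_dvd (abs_pos.2 (sub_ne_zero.2 hij)) ((dvd_abs _ _).2 hdvd)
        exact_mod_cast this)
      have h2 : (T.card : ℝ≥0) * nexp (-(Q * m + Q)) ≤ nexp A := by
        refine le_trans ?_ h1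
        rw [← nsmul_eq_mul]
        refine Finset.card_nsmul_le_sum _ _ _ fun i _ => nexp_le_nexp.2 ?_
        have := (abs_le.1 (hlip (i : ℝ) (i + m))).1
        rw [sub_add_cancel_left, abs_neg, Nat.abs_cast] at this
        exact this
      calc (T.card : ℝ≥0) = T.card * nexp (-(Q * m + Q)) * nexp (Q * m + Q) := by
            rw [mul_assoc, ← nexp_add]; simp
        _ ≤ nexp A * nexp (Q * m + Q) := by gcongr
        _ = _ := by rw [← nexp_add, ← nexp_add]; congr 1; ring
    have hsum : S.card = ∑ r ∈ Finset.range s, (S.filter fun n => (n % (s : ℤ)).toNat = r).card :=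
      Finset.card_eq_sum_card_fiberwise fun n _ => by
        have h1 := Int.emod_nonneg n (show (s : ℤ) ≠ 0 by exact_mod_cast hs0.ne')
        have h2 := Int.emod_lt_of_pos n (show (0 : ℤ) < s by exact_mod_cast hs0)
        rw [Finset.coe_range, Set.mem_Iio]
        omega
    rw [hsum]
    push_cast
    refine (Finset.sum_le_sum hclass).trans (le_of_eq ?_)
    rw [Finset.sum_const, Finset.card_range, nsmul_eq_mul]; ring
  have hfin : E.Finite := by
    by_contra hinf
    obtain ⟨J, hJ⟩ := exists_nat_gt (nexp (Q * m) * (s * nexp (A + Q)))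
    obtain ⟨S, hS, hSc⟩ := Set.Infinite.exists_subset_card_eq hinf J
    have := hcard S hS
    rw [hSc] at this
    exact absurd hJ (not_lt.2 this)
  refine ⟨hfin, ?_⟩
  have h1 := hcard hfin.toFinset (by simp)
  rw [← Set.ncard_eq_toFinset_card _ hfin] at h1
  refine h1.trans_lt ?_
  rw [mul_pow, nexp_pow]
  refine mul_lt_mul_of_pos_left ?_ (nexp_pos _)
  calc (s : ℝ≥0) * nexp (A + Q) < s * nexp (A + Q) + 2 := by simp
    _ = (s * nexp (A + Q) + 2) ^ 1 := (pow_one _).symm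
    _ ≤ _ := pow_le_pow_right₀ (le_add_self.trans' one_le_two) hm

lemma slow_of_testBound {g₁ g₂ : ℝ ≃o ℝ} {C C' : ℝ} (h : TestBound g₁ g₂ C) (hC : 0 ≤ C)
    (h' : TestBound g₂ g₁ C') (hC' : 0 ≤ C') (h₁ : QuasiIsometry g₁) (h₂ : QuasiIsometry g₂) :
    Slow (fun x => g₁ x - g₂ x) := by
  obtain ⟨N, b, hN, hb, hcount⟩ := h.exists_count hC h₂
  obtain ⟨N', b', hN', hb', hcount'⟩ := h'.exists_count hC' h₁
  obtain ⟨Q, hQ, hlip⟩ := h₁.lipschitz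
  obtain ⟨Q', hQ', hlip'⟩ := h₂.lipschitz
  refine slow_of_count (bdd_of_continuous (by fun_prop)) (N := max N N') (b := b + b')
    (M := 2 * Q + 2 * Q') (le_max_of_le_left hN) (hb.trans_le le_self_add) (fun m hm => ?_) ?_
  · obtain ⟨hfin, hlt⟩ := hcount m hm
    obtain ⟨hfin', hlt'⟩ := hcount' m hm
    have hsub : {n : ℤ | max N N' < |(g₁ ((n : ℝ) + m) - g₂ ((n : ℝ) + m)) - (g₁ n - g₂ n)|} ⊆
        {n : ℤ | N < (g₁ ((n : ℝ) + m) - g₂ ((n : ℝ) + m)) - (g₁ n - g₂ n)} ∪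
        {n : ℤ | N' < (g₂ ((n : ℝ) + m) - g₁ ((n : ℝ) + m)) - (g₂ n - g₁ n)} := by
      intro n hn
      rw [Set.mem_ofPred_eq] at hn
      rcases lt_abs.1 hn with hn | hn
      · exact Or.inl ((le_max_left _ _).trans_lt hn)
      · refine Or.inr ((le_max_right _ _).trans_lt (hn.trans_eq ?_))
        ring
    refine ⟨(hfin.union hfin').subset hsub, ?_⟩
    have h1 := (Set.ncard_le_ncard hsub (hfin.union hfin')).trans (Set.ncard_union_le _ _)
    have h2 : b ^ m + b' ^ m ≤ (b + b') ^ m := pow_add_pow_le zero_le zero_le (by omega)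
    refine lt_of_lt_of_le (lt_of_le_of_lt ?_ (add_lt_add hlt hlt')) h2
    exact_mod_cast h1
  · convert Set.finite_empty
    refine Set.eq_empty_of_forall_notMem ?_
    rintro n ⟨x, hx, hlt⟩
    have hxn : |x - n| ≤ 1 := by rw [abs_le]; constructor <;> linarith [hx.1, hx.2]
    have h1 := abs_le.1 ((hlip x n).trans (add_le_add_left (mul_le_mul_of_nonneg_left hxn hQ) _))
    have h2 := abs_le.1 ((hlip' x n).trans (add_le_add_left (mul_le_mul_of_nonneg_left hxn hQ') _))
    refine absurd hlt (not_lt.2 (abs_le.2 ⟨?_, ?_⟩)) <;> linarith [h1.1, h1.2, h2.1, h2.2]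

/-! ### Sufficiency: a slow difference makes the spaces equivalent -/

lemma lintegral_le_tsum_lattice (g : ℝ ≃o ℝ) {P : ℝ} (hP : 0 < P) (F : ℝ → ℝ≥0∞) :
    ∫⁻ z, F z ≤ ∑' j : ℤ, ∫⁻ z in Set.Ico (g (P * j)) (g (P * (j + 1))), F z := by
  have hcov : (⋃ j : ℤ, Set.Ico (g (P * j)) (g (P * (j + 1)))) = Set.univ := by
    refine Set.eq_univ_of_forall fun z => Set.mem_iUnion.2 ⟨⌊g.symm z / P⌋, ?_, ?_⟩
    · rw [← OrderIso.le_symm_apply]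
      have := Int.floor_le (g.symm z / P)
      rw [le_div_iff₀ hP] at this
      linarith
    · rw [← OrderIso.symm_apply_lt]
      have := Int.lt_floor_add_one (g.symm z / P)
      rw [div_lt_iff₀ hP] at this
      linarith
  calc ∫⁻ z, F z = ∫⁻ z in ⋃ j : ℤ, Set.Ico (g (P * j)) (g (P * (j + 1))), F z := by
        rw [hcov, setLIntegral_univ]
    _ ≤ _ := lintegral_iUnion_le _ _

/-- A modular bound for `g₂` implies one for `g₁`, up to a dilation and a shift. Both modulars are
compared with sums over a lattice. The terms of the two sums are comparable where `g₁ - g₂` varies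
little; where it does not, slowness bounds the terms by a summable sequence. -/
lemma exists_modular_bound {g₁ g₂ : ℝ ≃o ℝ} (h₁ : QuasiIsometry g₁) (h₂ : QuasiIsometry g₂)
    (he : Slow (fun x => g₁ x - g₂ x)) (D : ℝ) :
    ∃ C : ℝ, ∀ k : ℝ → ℝ≥0∞, Monotone k → modular g₂ k ≤ 1 →
      modular g₁ (fun y => k (y + D) / (nexp C : ℝ≥0∞)) ≤ 1 := by
  obtain ⟨s, hs, hstep⟩ := exists_step_one_le h₂.expanding
  obtain ⟨Q₁, hQ₁, hlip₁⟩ := h₁.lipschitz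
  obtain ⟨Q₂, hQ₂, hexp₁⟩ := h₁.expanding
  obtain ⟨Q₃', hQ₃', hexp₂'⟩ := h₂.expanding
  obtain ⟨Q₃, hQ₃, hexp₂⟩ : ∃ Q₃ : ℝ, 0 < Q₃ ∧ ∀ x y, |x - y| ≤ Q₃ * |g₂ x - g₂ y| + Q₃ :=
    ⟨Q₃' + 1, by positivity, fun x y =>
      (hexp₂' x y).trans (by nlinarith [abs_nonneg (g₂ x - g₂ y)])⟩
  -- the lattice of mesh `P` is `1`-separated by `g₂`, and the shift by `D` stays within one step
  set P := s + |D| with hPdef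
  have hP : 0 < P := by positivity
  have hDP : D ≤ P := by linarith [le_abs_self D]
  obtain ⟨C₄, hC₄, hsub⟩ := he.sublinear (show 0 < 1 / (2 * Q₃) by positivity)
  obtain ⟨N, q, hN, hq, hslow⟩ := (he.comp (quasiIsometry_mul hP)).exists_small
    (show 0 < P / (2 * Q₃) by positivity)
  obtain ⟨κ, hκ⟩ : ∃ κ : ℝ, nexp 1 + ∑' n, q n ≤ nexp κ := by
    refine ⟨(nexp 1 + ∑' n, q n).toReal, ?_⟩
    have hne : nexp 1 + ∑' n, q n ≠ ∞ := ENNReal.add_ne_top.2 ⟨ENNReal.coe_ne_top, hq⟩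
    rw [← ENNReal.toReal_le_toReal hne ENNReal.coe_ne_top, ENNReal.coe_toReal, coe_nexp]
    linarith [Real.add_one_le_exp (nexp 1 + ∑' n, q n).toReal]
  set L := Q₁ * (2 * P) + Q₁ with hL
  set M := N + (3 + C₄) + L with hM
  -- a shift by `C` lowers `g₁` by at least `M + κ`
  set C := (Q₂ + 1) * (|M + κ| + 1) with hC
  have hC0 : 0 ≤ C := by positivity
  have hdrop : ∀ x, g₁ (x - C) ≤ g₁ x - (M + κ) := by
    intro x
    have h3 := hexp₁ x (x - C)
    have h4 := g₁.monotone (show x - C ≤ x by linarith)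
    rw [sub_sub_cancel, abs_of_nonneg hC0, abs_of_nonneg (by linarith)] at h3
    by_contra! hc
    have h5 := le_abs_self (M + κ)
    have h6 := abs_nonneg (M + κ)
    nlinarith
  refine ⟨C, fun k hk hmod => ?_⟩
  set A : ℤ → ℝ≥0∞ := fun j => extendTop (ofIso g₂) (k (P * j)) * nexp (-g₂ (P * j)) with hA
  have hgap : ∀ i j : ℤ, i < j → g₂ (P * i) + 1 ≤ g₂ (P * j) := by
    intro i j hij
    have hij' : (i : ℝ) + 1 ≤ j := by exact_mod_cast hij
    have h3 : P ≤ P * j - P * i := by nlinarith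
    have h4 := hstep (P * j) (P * i) (by
      rw [abs_of_nonneg (by linarith)]; linarith [abs_nonneg D])
    rw [abs_of_nonneg (sub_nonneg.2 (g₂.monotone (by linarith)))] at h4
    linarith
  have hAsum : ∑' j, A j ≤ nexp 1 := by
    have hdisj : Pairwise (Function.onFun Disjoint fun j : ℤ =>
        Set.Ico (g₂ (P * j)) (g₂ (P * j) + 1)) := by
      intro i j hij
      refine Set.disjoint_left.2 fun z hzi hzj => ?_
      rcases lt_or_gt_of_ne hij with h | h
      · linarith [hgap i j h, hzi.2, hzj.1]
      · linarith [hgap j i h, hzj.2, hzi.1]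
    calc ∑' j, A j = ∑' j : ℤ, nexp 1 *
          (extendTop (ofIso g₂) (k (P * j)) * nexp (-(g₂ (P * j) + 1))) := by
          refine tsum_congr fun j => ?_
          rw [mul_left_comm, ← ENNReal.coe_mul, ← nexp_add]
          simp [hA]
      _ ≤ nexp 1 * ∑' j : ℤ, ∫⁻ z in Set.Ico (g₂ (P * j)) (g₂ (P * j) + 1),
            extendTop (ofIso g₂) (k (g₂.symm z)) * nexp (-z) := by
          rw [ENNReal.tsum_mul_left]
          refine mul_le_mul_right (ENNReal.tsum_le_tsum fun j => ?_) _
          refine le_setLIntegral_unit fun z hz => extendTop_mono g₂ (hk ?_)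
          rw [OrderIso.le_symm_apply]; exact hz.1
      _ ≤ nexp 1 * modular g₂ k := by
          rw [← lintegral_iUnion (fun _ => measurableSet_Ico) hdisj]
          exact mul_le_mul_right (setLIntegral_le_lintegral _ _) _
      _ ≤ nexp 1 * 1 := by gcongr
      _ = nexp 1 := mul_one _
  have hterm : ∀ j : ℤ, extendTop (ofIso g₁) (k (P * j) / (nexp C : ℝ≥0∞)) *
      nexp (-g₁ (P * (j - 2))) ≤ nexp (-κ) * (A j + q j) := by
    intro j
    have hAj : A j ≤ nexp 1 := (ENNReal.le_tsum j).trans hAsum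
    have htop : k (P * j) ≠ ∞ := by
      intro h
      simp [hA, h, extendTop] at hAj
    lift k (P * j) to ℝ≥0 using htop with κj hκj
    rcases eq_zero_or_nexp κj with h0 | ⟨α, hα⟩
    · rw [h0, ENNReal.coe_zero, ENNReal.zero_div, ← ENNReal.coe_zero, extendTop_coe]
      simp
    have hA' : A j = nexp (g₂ α - g₂ (P * j)) := by
      rw [hA]
      simp only
      rw [← hκj, hα, extendTop_coe, ofIso_nexp, ← ENNReal.coe_mul, ← nexp_add, sub_eq_add_neg]
    rw [hA', ENNReal.coe_le_coe, nexp_le_nexp] at hAj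
    rw [hα, ← ENNReal.coe_div (by simp), ← nexp_sub, extendTop_coe, ofIso_nexp, ← ENNReal.coe_mul,
      ← nexp_add]
    have h3 := hdrop α
    have h4 := (abs_le.1 (hlip₁ (P * (j - 2)) (P * j))).1
    rw [show P * ((j : ℝ) - 2) - P * j = -(2 * P) by ring, abs_neg,
      abs_of_nonneg (by positivity)] at h4
    set T := |α - P * j| with hT
    rcases le_or_gt |(g₁ α - g₂ α) - (g₁ (P * j) - g₂ (P * j))| N with hgood | hbad
    · refine le_trans ?_ (mul_le_mul_right le_self_add _)
      rw [hA']
      refine nexp_le_mul le_rfl ?_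
      have := (abs_le.1 hgood).2
      linarith
    · refine le_trans ?_ (mul_le_mul_right le_add_self _)
      -- `A j ≤ exp 1` forces `α`, if far from `P j`, to lie to its left, so that `g₂ α - g₂ (P j)` is
      -- at most `-T / Q₃` up to a constant; half of this absorbs the variation of `g₁ - g₂`, and the
      -- other half matches the bound by `q j`
      have h5 := hslow j (α / P) (by simpa only [mul_div_cancel₀ α hP.ne'] using hbad)
      refine nexp_le_mul h5 ?_
      have hTP : P / (2 * Q₃) * |α / P - j| = T / (2 * Q₃) := by
        have : |α / P - j| = T / P := by
          rw [hT, ← abs_of_pos hP, ← abs_div, abs_of_pos hP, sub_div,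
            mul_div_cancel_left₀ _ hP.ne']
        rw [this]; field_simp
      rw [hTP]
      have h6 := (abs_le.1 (hsub α (P * j))).2
      have h7 := hexp₂ α (P * j)
      have h8 : g₂ α - g₂ (P * j) ≤ -(T / Q₃) + 3 := by
        rw [← hT] at h7
        rcases le_total (g₂ α) (g₂ (P * j)) with hle | hle
        · rw [abs_of_nonpos (by linarith)] at h7
          have : T / Q₃ ≤ -(g₂ α - g₂ (P * j)) + 1 := by
            rw [div_le_iff₀ hQ₃]; linarith
          linarith
        · rw [abs_of_nonneg (by linarith)] at h7
          have : T / Q₃ ≤ 2 := by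
            rw [div_le_iff₀ hQ₃]; nlinarith
          linarith
      have h9 : 1 / (2 * Q₃) * T = T / (2 * Q₃) := by ring
      have h10 : T / Q₃ = 2 * (T / (2 * Q₃)) := by field_simp
      rw [h9] at h6
      linarith
  calc modular g₁ (fun y => k (y + D) / (nexp C : ℝ≥0∞))
      ≤ ∑' j : ℤ, ∫⁻ z in Set.Ico (g₁ (P * j)) (g₁ (P * (j + 1))),
          extendTop (ofIso g₁) (k (g₁.symm z + D) / (nexp C : ℝ≥0∞)) * nexp (-z) :=
        lintegral_le_tsum_lattice g₁ hP _
    _ ≤ ∑' j : ℤ, extendTop (ofIso g₁) (k (P * ((j + 2 : ℤ) : ℝ)) / (nexp C : ℝ≥0∞)) *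
          nexp (-g₁ (P * (((j + 2 : ℤ) : ℝ) - 2))) := by
        refine ENNReal.tsum_le_tsum fun j => ?_
        push_cast
        rw [add_sub_cancel_right, ← lintegral_Ici_nexp_neg,
          ← lintegral_const_mul _ measurable_nexp_neg]
        refine (setLIntegral_mono' measurableSet_Ico fun z hz => ?_).trans
          (lintegral_mono_set Set.Ico_subset_Ici_self)
        refine mul_le_mul_left (extendTop_mono g₁ (ENNReal.div_le_div_right (hk ?_) _)) _
        have : g₁.symm z < P * (j + 1) := by rw [OrderIso.symm_apply_lt]; exact hz.2
        linarith
    _ = ∑' j : ℤ, extendTop (ofIso g₁) (k (P * j) / (nexp C : ℝ≥0∞)) *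
          nexp (-g₁ (P * ((j : ℝ) - 2))) :=
        (Equiv.addRight (2 : ℤ)).tsum_eq (fun j : ℤ =>
          extendTop (ofIso g₁) (k (P * j) / (nexp C : ℝ≥0∞)) * nexp (-g₁ (P * ((j : ℝ) - 2))))
    _ ≤ ∑' j : ℤ, nexp (-κ) * (A j + q j) := ENNReal.tsum_le_tsum hterm
    _ ≤ nexp (-κ) * nexp κ := by
        rw [ENNReal.tsum_mul_left, ENNReal.tsum_add]
        exact mul_le_mul_right ((add_le_add_left hAsum _).trans hκ) _
    _ = 1 := by rw [← ENNReal.coe_mul, ← nexp_add]; simp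

lemma exists_orliczLorentz_le {f₁ f₂ g₁ g₂ : ℝ ≃o ℝ} (h₁ : QuasiIsometry g₁)
    (h₂ : QuasiIsometry g₂) (he : Slow (fun x => g₁ x - g₂ x)) {D : ℝ}
    (hD : ∀ y, f₁ y ≤ f₂ (y + D)) :
    ∃ C : ℝ, ∀ u : ℝ≥0 → ℂ, orliczLorentz leb (ofIso f₁) (ofIso g₁) u ≤
      (nexp C : ℝ≥0∞) * orliczLorentz leb (ofIso f₂) (ofIso g₂) u := by
  obtain ⟨C, hC⟩ := exists_modular_bound h₁ h₂ he D
  refine ⟨C, fun u => ?_⟩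
  rw [mul_comm, ← ENNReal.div_le_iff_le_mul (Or.inl (by simp)) (Or.inl (by simp)),
    orliczLorentz_eq f₂]
  refine le_iInf₂ fun c hc => ?_
  rw [ENNReal.div_le_iff_le_mul (Or.inl (by simp)) (Or.inl (by simp)), ← ENNReal.coe_mul,
    orliczLorentz_eq]
  refine iInf₂_le (c * nexp C) ⟨mul_pos hc.1 (nexp_pos C), ?_⟩
  refine le_trans (modular_mono _ fun y => ?_)
    (hC (fun y => rearrangement leb u (nexp (-f₂ y)) / (c : ℝ≥0∞)) (fun y y' hyy' => ?_) hc.2)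
  · rw [ENNReal.coe_mul, ENNReal.div_eq_inv_mul, ENNReal.div_eq_inv_mul, ENNReal.div_eq_inv_mul,
      ENNReal.mul_inv (Or.inr ENNReal.coe_ne_top) (Or.inl ENNReal.coe_ne_top), mul_comm (c : ℝ≥0∞)⁻¹,
      mul_assoc]
    gcongr
    exact rearrangement_antitone (nexp_le_nexp.2 (neg_le_neg (hD y)))
  · exact ENNReal.div_le_div_right (rearrangement_antitone
      (nexp_le_nexp.2 (neg_le_neg (f₂.monotone hyy')))) _

/-! ### The conditions in logarithmic coordinates -/

lemma exists_shift_of_phiEquiv {f g : ℝ ≃o ℝ} (h : PhiEquiv (ofIso f) (ofIso g)) :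
    ∃ C : ℝ, ∀ x, f (x - C) ≤ g x ∧ g x ≤ f (x + C) := by
  obtain ⟨c, hc, h⟩ := h
  obtain ⟨C, rfl⟩ := exists_nexp hc
  refine ⟨C, fun x => ?_⟩
  have := h (nexp x)
  rw [← nexp_neg, ← nexp_add, ← nexp_add, ofIso_nexp, ofIso_nexp, ofIso_nexp, nexp_le_nexp,
    nexp_le_nexp] at this
  exact ⟨by simpa [sub_eq_add_neg, add_comm] using this.1, by simpa [add_comm] using this.2⟩

/-- If `g₁ - g₂` is slow, then the hypotheses that one of `g₁`, `g₂` is coarsely expanding and one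
is coarsely Lipschitz hold for both. -/
lemma quasiIsometry_of_slow_sub {g₁ g₂ : ℝ → ℝ} (hexp : CoarseExpanding g₁ ∨ CoarseExpanding g₂)
    (hlip : CoarseLipschitz g₁ ∨ CoarseLipschitz g₂) (he : Slow (fun x => g₁ x - g₂ x)) :
    QuasiIsometry g₁ ∧ QuasiIsometry g₂ := by
  have h12 : ∀ x, g₁ x = g₂ x + (g₁ x - g₂ x) := fun x => by ring
  have h21 : ∀ x, g₂ x = g₁ x + -(g₁ x - g₂ x) := fun x => by ring
  refine ⟨⟨?_, ?_⟩, ⟨?_, ?_⟩⟩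
  · rcases hlip with h | h
    · exact h
    · rw [funext h12]; exact h.add he.coarseLipschitz
  · rcases hexp with h | h
    · exact h
    · rw [funext h12]; exact h.add_slow he
  · rcases hlip with h | h
    · rw [funext h21]; exact h.add he.neg.coarseLipschitz
    · exact h
  · rcases hexp with h | h
    · rw [funext h21]; exact h.add_slow he.neg
    · exact h

/-- `G₁ ∘ G₂⁻¹` is the identity up to a slow function, in logarithmic coordinates, if and only if
`G₁` and `G₂` differ by a slow function. -/
lemma slow_symm_trans_iff {g₁ g₂ : ℝ ≃o ℝ} (hexp : CoarseExpanding g₁ ∨ CoarseExpanding g₂)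
    (hlip : CoarseLipschitz g₁ ∨ CoarseLipschitz g₂) :
    Slow (fun x => (g₂.symm.trans g₁) x - x) ↔ Slow (fun x => g₁ x - g₂ x) := by
  constructor
  · intro h
    set L := g₂.symm.trans g₁ with hL
    have hLq : QuasiIsometry L := by
      simpa using quasiIsometry_id.add_slow h
    have h1 : ∀ x, L (g₂ x) = g₁ x := fun x => by simp [hL]
    have h2 : ∀ x, L.symm (g₁ x) = g₂ x := fun x => by simp [hL]
    have hq : QuasiIsometry g₂ := by
      constructor
      · rcases hlip with h | h
        · simpa only [h2] using hLq.symm.1.comp h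
        · exact h
      · rcases hexp with h | h
        · simpa only [h2] using hLq.symm.2.comp h
        · exact h
    simpa only [h1] using h.comp hq
  · intro h
    simpa using h.comp (quasiIsometry_of_slow_sub hexp hlip h).2.symm

/-- The equivalence of the spaces in logarithmic coordinates. -/
lemma spacesEquiv_iff {f₁ f₂ g₁ g₂ : ℝ ≃o ℝ} (hexp : CoarseExpanding g₁ ∨ CoarseExpanding g₂)
    (hlip : CoarseLipschitz g₁ ∨ CoarseLipschitz g₂) :
    SpacesEquiv leb (ofIso f₁) (ofIso g₁) (ofIso f₂) (ofIso g₂) ↔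
      PhiEquiv (ofIso f₁) (ofIso f₂) ∧ Slow (fun x => g₁ x - g₂ x) := by
  constructor
  · rintro ⟨c, hc, h⟩
    have hle : ∀ u : ℝ≥0 → ℂ, Measurable u → orliczLorentz leb (ofIso f₂) (ofIso g₂) u ≤
        c * orliczLorentz leb (ofIso f₁) (ofIso g₁) u := fun u hu => (h u hu).2.2
    have hle' : ∀ u : ℝ≥0 → ℂ, Measurable u → orliczLorentz leb (ofIso f₁) (ofIso g₁) u ≤
        c * orliczLorentz leb (ofIso f₂) (ofIso g₂) u := fun u hu =>
      (ENNReal.inv_mul_le_iff (by exact_mod_cast hc.ne') ENNReal.coe_ne_top).1 (h u hu).2.1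
    obtain ⟨D, hD, hf⟩ := exists_shift_le hle
    obtain ⟨D', hD', hf'⟩ := exists_shift_le hle'
    have hsh : ∀ y, f₁ y ≤ f₂ (y + D') := fun y => by simpa using hf' (y + D')
    have hsh' : ∀ y, f₂ y ≤ f₁ (y + D) := fun y => by simpa using hf (y + D)
    obtain ⟨C, hC, ht⟩ := exists_testBound hsh hle
    obtain ⟨C', hC', ht'⟩ := exists_testBound hsh' hle'
    refine ⟨phiEquiv_ofIso_of_near (C := max D D') fun x => ⟨?_, ?_⟩,
      slow_of_testBound ht hC ht' hC' ⟨?_, ?_⟩ ⟨?_, ?_⟩⟩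
    · exact (f₁.monotone (by linarith [le_max_right D D'])).trans (hf' x)
    · exact (hsh' x).trans (f₁.monotone (by linarith [le_max_left D D']))
    · exact hlip.elim id (ht.coarseLipschitz hC)
    · exact hexp.elim id (ht'.coarseExpanding hC')
    · exact hlip.elim (ht'.coarseLipschitz hC') id
    · exact hexp.elim (ht.coarseExpanding hC) id
  · rintro ⟨hf, he⟩
    obtain ⟨h₁, h₂⟩ := quasiIsometry_of_slow_sub hexp hlip he
    obtain ⟨D, hD⟩ := exists_shift_of_phiEquiv hf
    obtain ⟨C, hC⟩ := exists_orliczLorentz_le (f₁ := f₁) (f₂ := f₂) (D := D) h₁ h₂ he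
      (fun y => by simpa using (hD (y + D)).1)
    obtain ⟨C', hC'⟩ := exists_orliczLorentz_le (f₁ := f₂) (f₂ := f₁) (D := D) h₂ h₁
      (by simpa using he.neg) (fun y => (hD y).2)
    refine ⟨nexp (max C C'), nexp_pos _, fun u hu => ?_⟩
    have h1 : orliczLorentz leb (ofIso f₁) (ofIso g₁) u ≤
        (nexp (max C C') : ℝ≥0∞) * orliczLorentz leb (ofIso f₂) (ofIso g₂) u :=
      (hC u).trans (by gcongr; exact nexp_le_nexp.2 (le_max_left _ _))
    have h2 : orliczLorentz leb (ofIso f₂) (ofIso g₂) u ≤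
        (nexp (max C C') : ℝ≥0∞) * orliczLorentz leb (ofIso f₁) (ofIso g₁) u :=
      (hC' u).trans (by gcongr; exact nexp_le_nexp.2 (le_max_right _ _))
    refine ⟨and_congr_right fun _ => ⟨fun h => ?_, fun h => ?_⟩, ?_, h2⟩
    · exact h2.trans_lt (ENNReal.mul_lt_top ENNReal.coe_lt_top h)
    · exact h1.trans_lt (ENNReal.mul_lt_top ENNReal.coe_lt_top h)
    · exact (ENNReal.inv_mul_le_iff (by simp) ENNReal.coe_ne_top).2 h1

/-- An automorphism `L` is a quotient `η ∘ κ⁻¹` of perturbations of the identity by slow automorphisms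
if and only if `L - id` is slow. Given `L x - x ≈ ρ x - ψ x`, one takes `κ⁻¹ ≈ id - ψ` and
`η = L ∘ κ ≈ id + ρ ∘ κ`. -/
lemma eq_comp_phiInv_iff (L : ℝ ≃o ℝ) : Slow (fun x => L x - x) ↔
    ∃ H K : ℝ≥0 → ℝ≥0, IsNFunction H ∧ IsNFunction K ∧ ConditionJ H ∧ ConditionJ K ∧
      ofIso L = H ∘ phiInv K := by
  constructor
  · intro hd
    obtain ⟨ψ, ρ, hψ, hρ, D, hD⟩ := hd.exists_orderIso_control
    obtain ⟨ν, D', hν⟩ := hψ.neg.exists_orderIso_near_id_add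
    have hκq : QuasiIsometry ν.symm :=
      ((quasiIsometry_id.add_slow hψ.neg).of_near hν).symm
    obtain ⟨hK, hKJ⟩ := isNFunction_and_conditionJ (η := ν.symm) (ρ := ν.symm.trans ψ) (D := D')
      (fun x => by
        have := hν (ν.symm x)
        rw [OrderIso.apply_symm_apply] at this
        rw [OrderIso.trans_apply, abs_sub_comm]
        convert this using 2; ring) (hψ.comp hκq)
    obtain ⟨hH, hHJ⟩ := isNFunction_and_conditionJ (η := ν.symm.trans L) (ρ := ν.symm.trans ρ)
      (D := D + D')
      (fun x => by
        have h1 := hν (ν.symm x)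
        have h2 := hD (ν.symm x)
        rw [OrderIso.apply_symm_apply] at h1
        rw [OrderIso.trans_apply, OrderIso.trans_apply]
        rw [abs_le] at h1 h2 ⊢
        constructor <;> linarith) (hρ.comp hκq)
    refine ⟨_, _, hH, hK, hHJ, hKJ, ?_⟩
    rw [ofIso_comp_phiInv]
    congr 1; ext x; simp
  · rintro ⟨H, K, hH, hK, hHJ, hKJ, h⟩
    obtain ⟨η, rfl⟩ := hH.1.exists_eq_ofIso
    obtain ⟨κ, rfl⟩ := hK.1.exists_eq_ofIso
    rw [ofIso_comp_phiInv] at h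
    have hη := slow_of_conditionJ hHJ
    have hκ := slow_of_conditionJ hKJ
    have hκq : QuasiIsometry κ := by simpa using quasiIsometry_id.add_slow hκ
    simpa [ofIso_injective h] using (hη.sub hκ).comp hκq.symm

/-- The analogue of `eq_comp_phiInv_iff` for `L = η⁻¹ ∘ κ`. Given `L x - x ≈ ρ x - ω x`, one takes
`η = id + ω ∘ L⁻¹` and `κ = η ∘ L ≈ id + ρ`. -/
lemma eq_phiInv_comp_iff (L : ℝ ≃o ℝ) : Slow (fun x => L x - x) ↔
    ∃ H K : ℝ≥0 → ℝ≥0, IsNFunction H ∧ IsNFunction K ∧ ConditionJ H ∧ ConditionJ K ∧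
      ofIso L = phiInv H ∘ K := by
  constructor
  · intro hd
    obtain ⟨ω, ρ, hω, hρ, D, hD⟩ := hd.exists_orderIso_control
    have hLq : QuasiIsometry L := by simpa using quasiIsometry_id.add_slow hd
    obtain ⟨η, hη⟩ := exists_orderIso_id_add (L.symm.trans ω)
    obtain ⟨hH, hHJ⟩ := isNFunction_and_conditionJ (η := η) (ρ := L.symm.trans ω) (D := 0)
      (fun x => by simp [hη]) (hω.comp hLq.symm)
    obtain ⟨hK, hKJ⟩ := isNFunction_and_conditionJ (η := L.trans η) (ρ := ρ) (D := D)
      (fun x => by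
        have h := hD x
        rw [OrderIso.trans_apply, hη, OrderIso.trans_apply, OrderIso.symm_apply_apply,
          abs_sub_comm]
        convert h using 2; ring) hρ
    refine ⟨_, _, hH, hK, hHJ, hKJ, ?_⟩
    rw [phiInv_comp_ofIso]
    congr 1; ext x; simp
  · rintro ⟨H, K, hH, hK, hHJ, hKJ, h⟩
    obtain ⟨η, rfl⟩ := hH.1.exists_eq_ofIso
    obtain ⟨κ, rfl⟩ := hK.1.exists_eq_ofIso
    rw [phiInv_comp_ofIso] at h
    have hη := slow_of_conditionJ hHJ
    have hκ := slow_of_conditionJ hKJ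
    have hκq : QuasiIsometry κ := by simpa using quasiIsometry_id.add_slow hκ
    have hηq : QuasiIsometry η := by simpa using quasiIsometry_id.add_slow hη
    have hL : ∀ x, L x = η.symm (κ x) := ofIso_injective h
    simpa [hL] using hκ.sub (hη.comp (hηq.symm.comp hκq))

lemma exists_conditionJ_quotient_iff (g₁ g₂ : ℝ ≃o ℝ) : Slow (fun x => g₁ x - g₂ x) ↔
    ∃ H K : ℝ≥0 → ℝ≥0, IsNFunction H ∧ IsNFunction K ∧ ConditionJ H ∧ ConditionJ K ∧
      ∃ c : ℝ≥0, 0 < c ∧ ∀ t : ℝ≥0, 0 < t →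
        c⁻¹ * (ofIso g₁ t / ofIso g₂ t) ≤ H t / K t ∧
        H t / K t ≤ c * (ofIso g₁ t / ofIso g₂ t) := by
  constructor
  · intro he
    obtain ⟨ω, ρ, hω, hρ, D, hD⟩ := he.exists_orderIso_control
    obtain ⟨η, hη⟩ := exists_orderIso_id_add ρ
    obtain ⟨κ, hκ⟩ := exists_orderIso_id_add ω
    obtain ⟨hH, hHJ⟩ := isNFunction_and_conditionJ (η := η) (D := 0) (fun x => by simp [hη]) hρ
    obtain ⟨hK, hKJ⟩ := isNFunction_and_conditionJ (η := κ) (D := 0) (fun x => by simp [hκ]) hω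
    refine ⟨_, _, hH, hK, hHJ, hKJ,
      (exists_const_sandwich_iff (A := fun t => ofIso g₁ t / ofIso g₂ t)
        (B := fun t => ofIso η t / ofIso κ t) (ofIso_div_ofIso g₁ g₂)
        (ofIso_div_ofIso η κ)).2 ⟨D, fun x => ?_⟩⟩
    rw [hη, hκ]
    convert hD x using 2; ring
  · rintro ⟨H, K, hH, hK, hHJ, hKJ, h⟩
    obtain ⟨η, rfl⟩ := hH.1.exists_eq_ofIso
    obtain ⟨κ, rfl⟩ := hK.1.exists_eq_ofIso
    obtain ⟨C, hC⟩ := (exists_const_sandwich_iff (A := fun t => ofIso g₁ t / ofIso g₂ t)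
      (B := fun t => ofIso η t / ofIso κ t) (ofIso_div_ofIso g₁ g₂) (ofIso_div_ofIso η κ)).1 h
    refine ((slow_of_conditionJ hHJ).sub (slow_of_conditionJ hKJ)).of_near (C := C) fun x => ?_
    rw [abs_sub_comm]
    convert hC x using 2; ring

lemma exists_conditionL_product_iff (g₁ g₂ : ℝ ≃o ℝ) : Slow (fun x => g₁ x - g₂ x) ↔
    ∃ w₀ w₁ : ℝ≥0 → ℝ≥0, IsStrictlyMonotoneWeight w₀ ∧ IsStrictlyMonotoneWeight w₁ ∧
      ConditionL w₀ ∧ ConditionL w₁ ∧ ∃ c : ℝ≥0, 0 < c ∧ ∀ t : ℝ≥0, 0 < t →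
        c⁻¹ * (ofIso g₁ t / ofIso g₂ t) ≤ w₀ t * w₁ t ∧
        w₀ t * w₁ t ≤ c * (ofIso g₁ t / ofIso g₂ t) := by
  constructor
  · intro he
    obtain ⟨ω, ρ, hω, hρ, D, hD⟩ := he.exists_orderIso_control
    refine ⟨ofIso ρ, fun t => (ofIso ω t)⁻¹, hρ.isStrictlyMonotoneWeight,
      hω.isStrictlyMonotoneWeight_inv, hρ.conditionL (s := 1) (by norm_num) fun x => by simp,
      hω.conditionL (s := -1) (by norm_num) fun x => by simp [nexp_neg],
      (exists_const_sandwich_iff (A := fun t => ofIso g₁ t / ofIso g₂ t)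
        (B := fun t => ofIso ρ t * (ofIso ω t)⁻¹) (b := fun x => ρ x - ω x)
        (ofIso_div_ofIso g₁ g₂) fun x => ?_).2 ⟨D, fun x => ?_⟩⟩
    · rw [← ofIso_div_ofIso, div_eq_mul_inv]
    · convert hD x using 2; ring
  · rintro ⟨w₀, w₁, hw₀, hw₁, hL₀, hL₁, h⟩
    obtain ⟨C, hC⟩ := (exists_const_sandwich_iff (A := fun t => ofIso g₁ t / ofIso g₂ t)
      (B := fun t => w₀ t * w₁ t)
      (b := fun x => Real.log (w₀ (nexp x)) + Real.log (w₁ (nexp x)))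
      (ofIso_div_ofIso g₁ g₂) fun x => by
        rw [nexp_add, nexp_log (hw₀.1.pos _ (nexp_pos x)),
          nexp_log (hw₁.1.pos _ (nexp_pos x))]).1 h
    refine ((slow_of_conditionL hw₀ hL₀).add (slow_of_conditionL hw₁ hL₁)).of_near (C := C)
      fun x => ?_
    rw [abs_sub_comm]
    exact hC x

lemma exists_almostLinear_quotient_iff (g₁ g₂ : ℝ ≃o ℝ) : Slow (fun x => g₁ x - g₂ x) ↔
    ∃ F : ℝ≥0 → ℝ≥0, IsPhi F ∧ IsAlmostLinear F ∧ ∃ c : ℝ≥0, 0 < c ∧ ∀ t : ℝ≥0, 0 < t →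
      c⁻¹ * F t ≤ t * ofIso g₁ t / ofIso g₂ t ∧ t * ofIso g₁ t / ofIso g₂ t ≤ c * F t := by
  have hB : ∀ x, nexp x * ofIso g₁ (nexp x) / ofIso g₂ (nexp x) = nexp (x + (g₁ x - g₂ x)) :=
    fun x => by rw [mul_div_assoc, ofIso_div_ofIso, nexp_add]
  constructor
  · intro he
    obtain ⟨ρ, D, hρ⟩ := he.exists_orderIso_near_id_add
    refine ⟨ofIso ρ, isPhi_ofIso ρ, (isAlmostLinear_iff ρ).2 (he.of_near (C := D) fun x => ?_),
      (exists_const_sandwich_iff (A := ofIso ρ) (B := fun t => t * ofIso g₁ t / ofIso g₂ t)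
        (ofIso_nexp ρ) hB).2 ⟨D, fun x => ?_⟩⟩
    · convert hρ x using 2; ring
    · rw [abs_sub_comm]; exact hρ x
  · rintro ⟨F, hF, hlin, h⟩
    obtain ⟨f, rfl⟩ := hF.exists_eq_ofIso
    obtain ⟨C, hC⟩ := (exists_const_sandwich_iff (A := ofIso f)
      (B := fun t => t * ofIso g₁ t / ofIso g₂ t) (ofIso_nexp f) hB).1 h
    refine ((isAlmostLinear_iff f).1 hlin).of_near (C := C) fun x => ?_
    convert hC x using 2; ring

end OrliczLorentz

open OrliczLorentz

theorem theorem4p3 (F₁ F₂ G₁ G₂ : ℝ≥0 → ℝ≥0)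
    (hF₁ : IsPhi F₁) (hF₂ : IsPhi F₂) (hG₁ : IsPhi G₁) (hG₂ : IsPhi G₂)
    (hdil : IsDilatory G₁ ∨ IsDilatory G₂)
    (hdelta : SatisfiesDelta2 G₁ ∨ SatisfiesDelta2 G₂) :
    List.TFAE [
      SpacesEquiv leb F₁ G₁ F₂ G₂,
      PhiEquiv F₁ F₂ ∧ IsAlmostLinear (G₁ ∘ phiInv G₂),
      PhiEquiv F₁ F₂ ∧ ∃ H K : ℝ≥0 → ℝ≥0, IsNFunction H ∧ IsNFunction K ∧
        ConditionJ H ∧ ConditionJ K ∧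
        G₁ ∘ phiInv G₂ = H ∘ phiInv K,
      PhiEquiv F₁ F₂ ∧ ∃ H K : ℝ≥0 → ℝ≥0, IsNFunction H ∧ IsNFunction K ∧
        ConditionJ H ∧ ConditionJ K ∧
        G₁ ∘ phiInv G₂ = phiInv H ∘ K,
      PhiEquiv F₁ F₂ ∧ IsAlmostEquiv G₁ G₂,
      PhiEquiv F₁ F₂ ∧ ∃ H K : ℝ≥0 → ℝ≥0, IsNFunction H ∧ IsNFunction K ∧
        ConditionJ H ∧ ConditionJ K ∧ ∃ c : ℝ≥0, 0 < c ∧ ∀ t : ℝ≥0, 0 < t →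
          c⁻¹ * (G₁ t / G₂ t) ≤ H t / K t ∧ H t / K t ≤ c * (G₁ t / G₂ t),
      PhiEquiv F₁ F₂ ∧ ∃ w₀ w₁ : ℝ≥0 → ℝ≥0,
        IsStrictlyMonotoneWeight w₀ ∧ IsStrictlyMonotoneWeight w₁ ∧
        ConditionL w₀ ∧ ConditionL w₁ ∧ ∃ c : ℝ≥0, 0 < c ∧ ∀ t : ℝ≥0, 0 < t →
          c⁻¹ * (G₁ t / G₂ t) ≤ w₀ t * w₁ t ∧ w₀ t * w₁ t ≤ c * (G₁ t / G₂ t),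
      PhiEquiv F₁ F₂ ∧ ∃ F : ℝ≥0 → ℝ≥0, IsPhi F ∧ IsAlmostLinear F ∧
        ∃ c : ℝ≥0, 0 < c ∧ ∀ t : ℝ≥0, 0 < t →
          c⁻¹ * F t ≤ t * G₁ t / G₂ t ∧ t * G₁ t / G₂ t ≤ c * F t
    ] := by
  obtain ⟨f₁, rfl⟩ := hF₁.exists_eq_ofIso
  obtain ⟨f₂, rfl⟩ := hF₂.exists_eq_ofIso
  obtain ⟨g₁, rfl⟩ := hG₁.exists_eq_ofIso
  obtain ⟨g₂, rfl⟩ := hG₂.exists_eq_ofIso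
  have hexp : CoarseExpanding g₁ ∨ CoarseExpanding g₂ :=
    hdil.imp coarseExpanding_of_isDilatory coarseExpanding_of_isDilatory
  have hlip : CoarseLipschitz g₁ ∨ CoarseLipschitz g₂ :=
    hdelta.imp coarseLipschitz_of_satisfiesDelta2 coarseLipschitz_of_satisfiesDelta2
  have hL := slow_symm_trans_iff hexp hlip
  rw [ofIso_comp_phiInv]
  refine List.tfae_of_forall
    (PhiEquiv (ofIso f₁) (ofIso f₂) ∧ Slow (fun x => g₁ x - g₂ x)) _ ?_
  simp only [List.forall_mem_cons, List.not_mem_nil, false_implies, implies_true, and_true]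
  refine ⟨spacesEquiv_iff hexp hlip, and_congr_right' ?_, and_congr_right' ?_, and_congr_right' ?_,
    and_congr_right' (isAlmostEquiv_iff hlip),
    and_congr_right' (exists_conditionJ_quotient_iff g₁ g₂).symm,
    and_congr_right' (exists_conditionL_product_iff g₁ g₂).symm,
    and_congr_right' (exists_almostLinear_quotient_iff g₁ g₂).symm⟩
  · exact (isAlmostLinear_iff _).trans hL
  · exact (eq_comp_phiInv_iff _).symm.trans hL
  · exact (eq_phiInv_comp_iff _).symm.trans hL
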